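/- **Setting.** Let $m\ge1$ and let $\mathscr A_m$ be the real Clifford algebra generated by $e_1,\dots,e_m$ with $e_ie_j+e_je_i=-2\delta_{ij}$, with basis $e_T=e_{i_1}\cdots e_{i_l}$ ($T=\{i_1<\dots<i_l\}\subseteq\{1,\dots,m\}$, $e_\emptyset=e_0=1$), norm $|x|=(\sum_Tx_T^2)^{1/2}$, and conjugation the anti-automorphism with $\overline{e_i}=-e_i$ for $1\le i\le m$. Identify $x\in\mathbb R^{m+1}$ with $\sum_{i=0}^mx_ie_i\in\mathscr A_m$. Let $B^{m+1}$ be the open unit ball of $\mathbb R^{m+1}$, $S^m$ its boundary and $\omega_m$ the area of $S^m$. The Hardy space $\mathcal H^2(B^{m+1})$ consists of the left monogenic functions $f:B^{m+1}\to\mathscr A_m$ ($C^1$ with $\sum_{i=0}^me_i\partial f/\partial x_i=0$) such that $$\|f\|=\sup_{0<r<1}\Big(\frac1{\omega_m}\int_{S^m}|f(r\eta)|^2\,dS(\eta)\Big)^{1/2}<\infty ,$$ and for $f,g\in\mathcal H^2(B^{m+1})$ one puts $\langle f,g\rangle=\frac1{\omega_m}\int_{S^m}\overline{g(\eta)}f(\eta)\,dS(\eta)$,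 where $f(\eta),g(\eta)$ are the non-tangential boundary limits. The orthogonal projection of $\alpha$ onto the span of $\beta$ is the function $\mathscr P_\beta\alpha=\beta c$, $c\in\mathscr A_m$, with $\langle\alpha-\beta c,\beta\rangle=0$; thus $\mathscr P_\beta\alpha=\beta\langle\beta,\beta\rangle^{-1}\langle\alpha,\beta\rangle$ if $\langle\beta,\beta\rangle$ is invertible. For $a\in B^{m+1}$ let $S_a(x)=\overline{1-\overline ax}\,/\,|1-\overline ax|^{m+1}$. **Takenaka–Malmquist systems.** Given parameters $a_1,\dots,a_{k-1}\in B^{m+1}$ with functions $B_1,\dots,B_{k-1}$, and $b\in B^{m+1}\setminus\{a_1,\dots,a_{k-1}\}$, let $$T_{a_1,\dots,a_{k-1},b}=S_b-\sum_{i=1}^{k-1}\mathscr P_{B_i}S_b,\qquad B_{a_1,\dots,a_{k-1},b}=\frac{T_{a_1,\dots,a_{k-1},b}}{\|T_{a_1,\dots,a_{k-1},b}\|}.$$ If $a_k\notin\{a_1,\dots,a_{k-1}\}$, then $B_k=B_{a_1,\dots,a_{k-1},a_k}$. If $a_k\in\{a_1,\dots,a_{k-1}\}$, then $B_k\in\mathcal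 H^2(B^{m+1})$ is the limit in $\mathcal H^2(B^{m+1})$ of $B_{a_1,\dots,a_{k-1},a_k+\rho\omega}$ as $\rho\to0^+$, for some unit vector $\omega$. **Energy.** Let $n\ge1$, let $f\in\mathcal H^2(B^{m+1})$, let $a_1,\dots,a_{n-1}\in B^{m+1}$, possibly with repetitions, and let $B_1,\dots,B_{n-1}$ be a Takenaka–Malmquist system with these parameters. For $a\in B^{m+1}\setminus\{a_1,\dots,a_{n-1}\}$ put $$\mathcal E(a)=\big\|B_{a_1,\dots,a_{n-1},a}\,\langle B_{a_1,\dots,a_{n-1},a},B_{a_1,\dots,a_{n-1},a}\rangle^{-1}\,\langle f,B_{a_1,\dots,a_{n-1},a}\rangle\big\| .$$ For $a\in\{a_1,\dots,a_{n-1}\}$ the energy is taken in the limit sense: its values at $a$ are the limits $\lim_j\mathcal E(u_j)$ along sequences $u_j\to a$ in $B^{m+1}\setminus\{a_1,\dots,a_{n-1}\}$. **Theorem 5.1 (Maximum Selection Principle).** There is $a_n\in B^{m+1}$ at which the energy attains its supremum over the ball: some value of the energy at $a_n$ is the least upper bound of all values of the energy at all points $a\in B^{m+1}$. Moreover, $a_n$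 can be chosen so that, if it is equal to exactly one of the parameters $a_1,\dots,a_{n-1}$ (that is, $a_n=a_i$ for exactly one index $i$), then this maximal value is the directional limit $\lim_{\rho\to0^+}\mathcal E(a_n+\rho\omega)$ for some unit vector $\omega$. -/

import Mathlib

open MeasureTheory Filter Topology
open scoped symmDiff

noncomputable section

/-! ### The real Clifford algebra generated by `e₁, …, e_m` with `eᵢ eⱼ + eⱼ eᵢ = -2 δᵢⱼ` -/

/-- The Clifford numbers `x = ∑_T x_T e_T`, `T` running over the subsets of an `m`-element index
set, with the norm `|x| = (∑_T x_T ^ 2) ^ (1/2)`. -/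
def Cl (m : ℕ) : Type := EuclideanSpace ℝ (Finset (Fin m))

namespace Cl

variable {m : ℕ}

instance : NormedAddCommGroup (Cl m) :=
  inferInstanceAs (NormedAddCommGroup (EuclideanSpace ℝ (Finset (Fin m))))

instance : InnerProductSpace ℝ (Cl m) :=
  inferInstanceAs (InnerProductSpace ℝ (EuclideanSpace ℝ (Finset (Fin m))))

instance : FiniteDimensional ℝ (Cl m) :=
  inferInstanceAs (FiniteDimensional ℝ (EuclideanSpace ℝ (Finset (Fin m))))

/-- The coordinate `x_T`. -/
def coeff (x : Cl m) (T : Finset (Fin m)) : ℝ := WithLp.ofLp x T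

/-- The Clifford number with prescribed coordinates. -/
def ofCoeff (c : Finset (Fin m) → ℝ) : Cl m := WithLp.toLp 2 c

@[simp] theorem coeff_ofCoeff (c : Finset (Fin m) → ℝ) (T : Finset (Fin m)) :
    coeff (ofCoeff c) T = c T := rfl

@[simp] theorem coeff_add (x y : Cl m) (T : Finset (Fin m)) :
    coeff (x + y) T = coeff x T + coeff y T := rfl

@[simp] theorem coeff_zero (T : Finset (Fin m)) : coeff (0 : Cl m) T = 0 := rfl

@[simp] theorem coeff_smul (r : ℝ) (x : Cl m) (T : Finset (Fin m)) :
    coeff (r • x) T = r * coeff x T := rfl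

@[ext] theorem ext {x y : Cl m} (h : ∀ T, coeff x T = coeff y T) : x = y :=
  WithLp.ofLp_injective 2 (funext h)

theorem norm_eq (x : Cl m) : ‖x‖ = Real.sqrt (∑ T, coeff x T ^ 2) := by
  have h := EuclideanSpace.norm_eq (𝕜 := ℝ) (n := Finset (Fin m)) x
  simp only [Real.norm_eq_abs, sq_abs] at h
  exact h

/-- The basis element `e_T`; `e_∅` is the unit. -/
def e (T : Finset (Fin m)) : Cl m := ofCoeff fun S => if S = T then 1 else 0

/-- The sign in `e_A e_B = (-1)^{#(A ∩ B)} (-1)^{p(A,B)} e_{A ∆ B}`, where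
`p(A,B) = ∑_{j ∈ B} #{i ∈ A : i > j}`. -/
def sgn (A B : Finset (Fin m)) : ℝ :=
  (-1) ^ (A ∩ B).card * (-1) ^ (∑ j ∈ B, (A.filter fun i => j < i).card)

theorem sgn_eq_prod (A B : Finset (Fin m)) :
    sgn A B = ∏ j ∈ B, ∏ i ∈ A, (if j ≤ i then (-1 : ℝ) else 1) := by
  have h : ∀ j ∈ B, (∏ i ∈ A, (if j ≤ i then (-1 : ℝ) else 1)) =
      (if j ∈ A then (-1 : ℝ) else 1) * (-1) ^ (A.filter fun i => j < i).card := by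
    intro j _
    rw [← Finset.prod_const, Finset.prod_filter,
      ← Finset.prod_ite_eq' A j (fun _ => (-1 : ℝ)), ← Finset.prod_mul_distrib]
    refine Finset.prod_congr rfl fun i _ => ?_
    rcases lt_trichotomy i j with h | h | h
    · simp [h.ne, not_le.2 h, not_lt.2 h.le]
    · simp [h]
    · simp [h.ne', h.le, h]
  rw [Finset.prod_congr rfl h, Finset.prod_mul_distrib, Finset.prod_pow_eq_pow_sum, sgn,
    ← Finset.prod_filter, Finset.prod_const, Finset.filter_mem_eq_inter, Finset.inter_comm]

theorem prod_symmDiff {ι : Type*} [DecidableEq ι] (g : ι → ℝ) (hg : ∀ i, g i * g i = 1)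
    (A B : Finset ι) : ∏ i ∈ A ∆ B, g i = (∏ i ∈ A, g i) * ∏ i ∈ B, g i := by
  have h1 : (∏ i ∈ A \ B, g i) * ∏ i ∈ A ∩ B, g i = ∏ i ∈ A, g i := by
    rw [mul_comm]; exact Finset.prod_inter_mul_prod_sdiff A B g
  have h2 : (∏ i ∈ B \ A, g i) * ∏ i ∈ A ∩ B, g i = ∏ i ∈ B, g i := by
    rw [mul_comm, Finset.inter_comm]; exact Finset.prod_inter_mul_prod_sdiff B A g
  have h3 : (∏ i ∈ A ∩ B, g i) * (∏ i ∈ A ∩ B, g i) = 1 := by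
    rw [← Finset.prod_mul_distrib]; exact Finset.prod_eq_one fun i _ => hg i
  have h4 : ∏ i ∈ A ∆ B, g i = (∏ i ∈ A \ B, g i) * ∏ i ∈ B \ A, g i := by
    rw [symmDiff_def, Finset.sup_eq_union, Finset.prod_union]
    exact disjoint_sdiff_sdiff
  rw [h4, ← h1, ← h2]
  linear_combination (-(∏ i ∈ A \ B, g i) * ∏ i ∈ B \ A, g i) * h3

theorem sgn_symmDiff_right (A B C : Finset (Fin m)) :
    sgn A (B ∆ C) = sgn A B * sgn A C := by
  simp only [sgn_eq_prod]
  refine prod_symmDiff _ (fun j => ?_) B C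
  rw [← Finset.prod_mul_distrib]
  exact Finset.prod_eq_one fun i _ => by split_ifs <;> norm_num

theorem sgn_symmDiff_left (A B C : Finset (Fin m)) :
    sgn (A ∆ B) C = sgn A C * sgn B C := by
  simp only [sgn_eq_prod]
  rw [← Finset.prod_mul_distrib]
  refine Finset.prod_congr rfl fun j _ => ?_
  exact prod_symmDiff _ (fun i => by split_ifs <;> norm_num) A B

@[simp] theorem sgn_empty_left (A : Finset (Fin m)) : sgn ∅ A = 1 := by simp [sgn]

@[simp] theorem sgn_empty_right (A : Finset (Fin m)) : sgn A ∅ = 1 := by simp [sgn]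

/-- The bilinear product determined by `e_A e_B = sgn A B e_{A ∆ B}`: for given `A` and `C`, the
only `B` with `A ∆ B = C` is `A ∆ C`. -/
instance : Mul (Cl m) :=
  ⟨fun x y => ofCoeff fun C => ∑ A, sgn A (A ∆ C) * (coeff x A * coeff y (A ∆ C))⟩

instance : One (Cl m) := ⟨e ∅⟩

theorem coeff_mul (x y : Cl m) (C : Finset (Fin m)) :
    coeff (x * y) C = ∑ A, sgn A (A ∆ C) * (coeff x A * coeff y (A ∆ C)) := rfl

theorem coeff_one (C : Finset (Fin m)) : coeff (1 : Cl m) C = if C = ∅ then 1 else 0 := rfl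

protected theorem mul_assoc' (x y z : Cl m) : x * y * z = x * (y * z) := by
  ext C
  simp only [coeff_mul, Finset.sum_mul, Finset.mul_sum]
  rw [Finset.sum_comm]
  refine Finset.sum_congr rfl fun A _ => ?_
  refine Fintype.sum_equiv (Equiv.mk (fun D => A ∆ D) (fun D => A ∆ D)
    (fun D => symmDiff_symmDiff_cancel_left A D)
    (fun D => symmDiff_symmDiff_cancel_left A D)) _ _ fun D => ?_
  have h1 : (A ∆ D) ∆ (A ∆ C) = D ∆ C := by
    rw [symmDiff_comm A D, symmDiff_assoc, symmDiff_symmDiff_cancel_left]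
  have h2 : sgn D (D ∆ C) = sgn A (D ∆ C) * sgn (A ∆ D) (D ∆ C) := by
    rw [← sgn_symmDiff_left, symmDiff_symmDiff_cancel_left]
  have h3 : sgn A (A ∆ C) = sgn A (A ∆ D) * sgn A (D ∆ C) := by
    rw [← sgn_symmDiff_right, symmDiff_assoc, symmDiff_symmDiff_cancel_left]
  simp only [Equiv.coe_fn_mk, h1, h2, h3]
  ring

instance : Ring (Cl m) where
  __ := (inferInstance : AddCommGroup (Cl m))
  __ := (inferInstance : Mul (Cl m))
  __ := (inferInstance : One (Cl m))
  mul_assoc := Cl.mul_assoc'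
  left_distrib x y z := by
    ext C; simp only [coeff_mul, coeff_add, mul_add, Finset.sum_add_distrib]
  right_distrib x y z := by
    ext C; simp only [coeff_mul, coeff_add, mul_add, add_mul, Finset.sum_add_distrib]
  zero_mul x := by ext C; simp [coeff_mul]
  mul_zero x := by ext C; simp [coeff_mul]
  one_mul x := by
    ext C
    have h : (∅ : Finset (Fin m)) ∆ C = C := bot_symmDiff C
    rw [coeff_mul, Finset.sum_eq_single ∅] <;> simp +contextual [coeff_one, h]
  mul_one x := by
    ext C
    rw [coeff_mul, Finset.sum_eq_single C]
    · simp [coeff_one]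
    · intro A _ hA
      have : A ∆ C ≠ ∅ := fun h => hA (symmDiff_eq_bot.1 h)
      simp [coeff_one, this]
    · simp

/-- The multiplication table of the basis. -/
theorem e_mul_e (A B : Finset (Fin m)) : (e A : Cl m) * e B = sgn A B • e (A ∆ B) := by
  ext C
  rw [coeff_mul, Finset.sum_eq_single A]
  · have h : A ∆ C = B ↔ C = A ∆ B := by
      constructor
      · rintro rfl; rw [symmDiff_symmDiff_cancel_left]
      · rintro rfl; rw [symmDiff_symmDiff_cancel_left]
    by_cases hC : C = A ∆ B
    · subst hC; simp [e]
    · simp [e, h, hC]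
  · intro D _ hD; simp [e, hD]
  · simp

/-- The conjugation `x ↦ ∑_T x_T conj(e_T)`, where for `#T = l`
`conj(e_{i₁} ⋯ e_{i_l}) = (-e_{i_l}) ⋯ (-e_{i₁}) = (-1)^{l(l+1)/2} e_T`. -/
def conj (x : Cl m) : Cl m :=
  ofCoeff fun T => (-1) ^ (T.card * (T.card + 1) / 2) * coeff x T

end Cl

/-! ### Monogenic functions and the Hardy space of the unit ball -/

/-- The space `ℝ^{m+1}` of the vectors `x = (x₀, x₁, …, x_m)`. -/
abbrev Pt (m : ℕ) : Type := EuclideanSpace ℝ (Fin (m + 1))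

/-- The Clifford numbers `e₀ = 1, e₁, …, e_m`. -/
def unitVec {m : ℕ} (i : Fin (m + 1)) : Cl m :=
  Fin.cases (1 : Cl m) (fun j => Cl.e {j}) i

/-- The identification of `x` in `ℝ^{m+1}` with the Clifford number `∑ᵢ xᵢ eᵢ`. -/
def toCl {m : ℕ} (x : Pt m) : Cl m := ∑ i, x i • unitVec i

/-- The open unit ball `B^{m+1}`. -/
abbrev unitBall (m : ℕ) : Set (Pt m) := Metric.ball 0 1

/-- `f` is left monogenic on the unit ball: `f` is `C¹` there and `∑ᵢ eᵢ ∂f/∂xᵢ = 0`.  Functions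
on the ball are represented by functions on `ℝ^{m+1}` whose values off the ball play no role. -/
def IsMonogenic {m : ℕ} (f : Pt m → Cl m) : Prop :=
  ContDiffOn ℝ 1 f (unitBall m) ∧
    ∀ x ∈ unitBall m, ∑ i, unitVec i * fderiv ℝ f x (EuclideanSpace.single i 1) = 0

/-- The area `ω_m` of the unit sphere `S^m` in `ℝ^{m+1}`. -/
def sphereArea (m : ℕ) : ℝ := 2 * Real.pi ^ (((m : ℝ) + 1) / 2) / Real.Gamma (((m : ℝ) + 1) / 2)

/-- The surface measure on the unit sphere `S^m`. -/
def surface (m : ℕ) : Measure (Metric.sphere (0 : Pt m) 1) := (volume : Measure (Pt m)).toSphere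

/-- The normalized `L²` norm `(ω_m⁻¹ ∫_{S^m} |f(rη)|² dS)^{1/2}`. -/
def meanNorm {m : ℕ} (f : Pt m → Cl m) (r : ℝ) : ℝ :=
  Real.sqrt ((sphereArea m)⁻¹ * ∫ η : Metric.sphere (0 : Pt m) 1, ‖f (r • (η : Pt m))‖ ^ 2 ∂surface m)

/-- The norm `sup_{0 < r < 1} (ω_m⁻¹ ∫_{S^m} |f(rη)|² dS)^{1/2}`. -/
def hardyNorm {m : ℕ} (f : Pt m → Cl m) : ℝ := sSup (meanNorm f '' Set.Ioo 0 1)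

/-- Membership in the monogenic Hardy space `H²(B^{m+1})`. -/
def MemHardy {m : ℕ} (f : Pt m → Cl m) : Prop :=
  IsMonogenic f ∧ BddAbove (meanNorm f '' Set.Ioo 0 1)

/-- `f` has the non-tangential limit `L` at `η`: it tends to `L` inside every cone-like region
`{x ∈ B : |x - η| < α (1 - |x|)}`, `α > 1`. -/
def HasNTLimit {m : ℕ} (f : Pt m → Cl m) (η : Pt m) (L : Cl m) : Prop :=
  ∀ α : ℝ, 1 < α →
    Tendsto f (𝓝[{x | x ∈ unitBall m ∧ ‖x - η‖ < α * (1 - ‖x‖)}] η) (𝓝 L)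

open Classical in
/-- The non-tangential boundary limit of `f` at `η` (`0` where there is none). -/
def boundaryValue {m : ℕ} (f : Pt m → Cl m) (η : Pt m) : Cl m :=
  if h : ∃ L, HasNTLimit f η L then h.choose else 0

/-- The Clifford-valued inner product `⟨f, g⟩ = ω_m⁻¹ ∫_{S^m} conj(g(η)) f(η) dS`. -/
def hardyInner {m : ℕ} (f g : Pt m → Cl m) : Cl m :=
  (sphereArea m)⁻¹ • ∫ η : Metric.sphere (0 : Pt m) 1,
    Cl.conj (boundaryValue g η) * boundaryValue f η ∂surface m

/-! ### The Takenaka--Malmquist system -/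

/-- The Szegő kernel `S_a(x) = conj(1 - conj(a) x) / |1 - conj(a) x|^{m+1}`. -/
def szego {m : ℕ} (a x : Pt m) : Cl m :=
  (‖1 - Cl.conj (toCl a) * toCl x‖ ^ (m + 1))⁻¹ • Cl.conj (1 - Cl.conj (toCl a) * toCl x)

/-- The orthogonal projection `β c`, `⟨α - β c, β⟩ = 0`, of `α` onto the right module spanned by
`β`.  A suitable `c` exists and `β c` does not depend on its choice; if `⟨β, β⟩` is invertible,
then `c = ⟨β, β⟩⁻¹ ⟨α, β⟩`. -/
def proj {m : ℕ} (β α : Pt m → Cl m) : Pt m → Cl m := fun x =>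
  β x * Classical.epsilon fun c : Cl m => hardyInner (fun y => α y - β y * c) β = 0

/-- The Gram--Schmidt step `T_b = S_b - ∑_{i ∈ s} P_{B_i} S_b` with respect to the members `B_i`,
`i ∈ s`, of an orthogonal family. -/
def tmT {m n : ℕ} (B : Fin n → Pt m → Cl m) (s : Finset (Fin n)) (b : Pt m) : Pt m → Cl m :=
  fun x => szego b x - ∑ i ∈ s, proj (B i) (szego b) x

/-- The normalization `T_b / ‖T_b‖`. -/
def tmB {m n : ℕ} (B : Fin n → Pt m → Cl m) (s : Finset (Fin n)) (b : Pt m) : Pt m → Cl m :=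
  fun x => (hardyNorm (tmT B s b))⁻¹ • tmT B s b x

/-- `B₁, …, B_n` is a Takenaka--Malmquist system with the parameters `a₁, …, a_n`.
If `a_k` differs from the preceding parameters, then `B_k` is the Gram--Schmidt orthonormalization
of `S_{a_k}`.  If `a_k` equals one of them, then `B_k` is the limit in `H²` of
`B_{a₁, …, a_{k-1}, a_k + ρω}` as `ρ → 0+`, for some direction `ω`. -/
def IsTMSystem {m n : ℕ} (a : Fin n → Pt m) (B : Fin n → Pt m → Cl m) : Prop :=
  ∀ k : Fin n, MemHardy (B k) ∧
    ((∀ j < k, a j ≠ a k) →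
      Set.EqOn (B k) (tmB B (Finset.Iio k) (a k)) (unitBall m)) ∧
    ((∃ j < k, a j = a k) →
      ∃ ω : Pt m, ‖ω‖ = 1 ∧
        Tendsto (fun ρ : ℝ =>
          hardyNorm fun x => tmB B (Finset.Iio k) (a k + ρ • ω) x - B k x) (𝓝[>] 0) (𝓝 0))

/-- The energy `‖B_b ⟨B_b, B_b⟩⁻¹ ⟨f, B_b⟩‖` with `B_b = B_{a₁, …, a_n, b}`, for `b` different from
the parameters `a₁, …, a_n` of the system `B`. -/
def tmEnergy {m n : ℕ} (f : Pt m → Cl m) (B : Fin n → Pt m → Cl m) (b : Pt m) : ℝ :=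
  hardyNorm fun x =>
    tmB B Finset.univ b x *
      (Ring.inverse (hardyInner (tmB B Finset.univ b) (tmB B Finset.univ b)) *
        hardyInner f (tmB B Finset.univ b))

/-- `E` is a value of the energy at the parameter `b`.  For a new parameter it is the energy just
defined; for a parameter among `a₁, …, a_n` it is taken in the limit sense, as a limit of the
energies at new parameters tending to `b`. -/
def IsEnergyAt {m n : ℕ} (f : Pt m → Cl m) (a : Fin n → Pt m) (B : Fin n → Pt m → Cl m)
    (b : Pt m) (E : ℝ) : Prop :=
  (b ∉ Set.range a ∧ E = tmEnergy f B b) ∨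
  (b ∈ Set.range a ∧ ∃ u : ℕ → Pt m, (∀ j, u j ∈ unitBall m ∧ u j ∉ Set.range a) ∧
    Tendsto u atTop (𝓝 b) ∧ Tendsto (fun j => tmEnergy f B (u j)) atTop (𝓝 E))

end

/-! ### The Clifford algebra: conjugation, norm and units -/

noncomputable section

namespace Cl

variable {m : ℕ}

/-! Off the parameters, the energy at `b` is the norm of the projection of the boundary function F
of `f` onto the right module spanned by T_b, the Szegő kernel S_b minus its projections onto the
system (`tmC`). It is thus a function `energy F` of T_b that is bounded by the norm of F
(`energy_le`), invariant under nonzero real scaling of T_b (`energy_smul`) and continuous wherever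
the Clifford number ⟨T_b, T_b⟩ is invertible (`continuousAt_energy`). A maximizing sequence
subconverges in the closed ball, and three facts finish the proof.

Boundary: the energy tends to 0 at the unit sphere (`tendsto_energy_boundary`). Indeed S_b - T_b
stays bounded by the reproducing formula, ‖S_b‖ tends to infinity, and ⟨F, S_b⟩/‖S_b‖ tends to 0
because F has little L² mass near a point. So a positive supremum is approached at an interior
point; a zero supremum is attained at every point off the parameters.

Invertibility: the algebra may have zero divisors, so ⟨T_b, T_b⟩ ≠ 0 is not enough. For an imaginary
unit s and a complex polynomial q, the function x ↦ q(x₀ + s⟨s, x⟩)v is monogenic. If q vanishes to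
high enough order at the images of the parameters, it is orthogonal to the system, and its pairing
with T_b is a positive constant times q(z_b)v, where z_b = x₀ + s⟨s, x⟩ at x = b. For s in general
position q(z_b) is a nonzero element of a copy of ℂ, hence invertible, and this forces ⟨T_b, T_b⟩ to
be invertible (`isUnit_pair_self`, `IsTMFamily.isUnit_gram`).

Simple parameter: if a_i occurs once, T vanishes there and T_{a_i+d} = DT(d) + o(d). Now q can be
taken with a simple zero at a_i, so the same test shows that DT(ω) has an invertible square for
every ω ≠ 0. By scaling invariance, the energies along u_j → a_i subconverge to the energy of DT(ω),
with ω a limit of the directions of u_j - a_i, and this is also the limit along the ray in direction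
ω (`IsTMFamily.exists_direction`).

All this takes place among continuous functions on the closed ball. Cauchy's formula gives the
reproducing property of S_b and, through the Poisson kernel, the equality of Hardy norm and boundary
norm. The members of the system belong to this space because ρ ↦ T_{c+ρω} is smooth and not flat at
0 (`exists_leading_tmC`), so that a directional limit of normalized functions is a normalized
leading Taylor coefficient. -/

instance : IsScalarTower ℝ (Cl m) (Cl m) :=
  ⟨fun r x y => by
    ext T
    simp only [smul_eq_mul, coeff_mul, coeff_smul, Finset.mul_sum]
    exact Finset.sum_congr rfl fun _ _ => by ring⟩

instance : SMulCommClass ℝ (Cl m) (Cl m) :=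
  ⟨fun r x y => by
    ext T
    simp only [smul_eq_mul, coeff_mul, coeff_smul, Finset.mul_sum]
    exact Finset.sum_congr rfl fun _ _ => by ring⟩

instance : Algebra ℝ (Cl m) := Algebra.ofModule (fun r x y => smul_mul_assoc r x y)
  (fun r x y => mul_smul_comm r x y)

theorem inner_eq (x y : Cl m) : inner ℝ x y = ∑ T, coeff x T * coeff y T := by
  have h : inner ℝ x y = ∑ T, inner ℝ (coeff x T) (coeff y T) := rfl
  rw [h]
  exact Finset.sum_congr rfl fun T _ => by simp [mul_comm]

theorem sgn_mul_self (A B : Finset (Fin m)) : sgn A B * sgn A B = 1 := by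
  rw [← sgn_symmDiff_left, symmDiff_self]; exact sgn_empty_left B

/-- The sign in `conj` becomes a value of `sgn`, which is multiplicative in each argument for the
symmetric difference. All sign identities for the conjugation then follow from that
multiplicativity. -/
theorem sgn_self (A : Finset (Fin m)) : sgn A A = (-1) ^ (A.card * (A.card + 1) / 2) := by
  induction A using Finset.induction_on_max with
  | empty => simp
  | insert a s ha ih =>
    have hns : a ∉ s := fun h => lt_irrefl _ (ha a h)
    have e : insert a s = s ∆ {a} := by
      rw [symmDiff_comm, (Finset.disjoint_singleton_left.2 hns).symmDiff_eq_sup]; rfl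
    have h1 : sgn s {a} = 1 := by
      rw [sgn_eq_prod]; simp only [Finset.prod_singleton]
      exact Finset.prod_eq_one fun i hi => by simp [ha i hi]
    have h2 : sgn {a} s = (-1) ^ s.card := by
      rw [sgn_eq_prod]; simp only [Finset.prod_singleton]
      rw [Finset.prod_congr rfl (fun i hi => if_pos (ha i hi).le), Finset.prod_const]
    have h3 : sgn {a} {a} = (-1 : ℝ) := by simp [sgn_eq_prod]
    have h4 : (s.card + 1) * (s.card + 1 + 1) / 2 = s.card * (s.card + 1) / 2 + (s.card + 1) := by
      have : (s.card + 1) * (s.card + 1 + 1) = s.card * (s.card + 1) + (s.card + 1) * 2 := by ring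
      rw [this, Nat.add_mul_div_right _ _ two_pos]
    rw [Finset.card_insert_of_notMem hns, h4, e, sgn_symmDiff_left, sgn_symmDiff_right,
      sgn_symmDiff_right, h1, h2, h3, ih]
    ring

theorem coeff_conj (x : Cl m) (T : Finset (Fin m)) : coeff (conj x) T = sgn T T * coeff x T := by
  rw [sgn_self]; rfl

@[simp] theorem conj_conj (x : Cl m) : conj (conj x) = x := by
  ext T; rw [coeff_conj, coeff_conj, ← mul_assoc, sgn_mul_self, one_mul]

/-- Conjugation as a real linear map. -/
def conjₗ : Cl m →ₗ[ℝ] Cl m where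
  toFun := conj
  map_add' x y := by ext T; simp only [coeff_conj, coeff_add]; ring
  map_smul' r x := by ext T; simp only [coeff_conj, coeff_smul, RingHom.id_apply]; ring

theorem conj_add (x y : Cl m) : conj (x + y) = conj x + conj y := conjₗ.map_add x y
theorem conj_sub (x y : Cl m) : conj (x - y) = conj x - conj y := conjₗ.map_sub x y
theorem conj_neg (x : Cl m) : conj (-x) = -conj x := conjₗ.map_neg x
@[simp] theorem conj_zero : conj (0 : Cl m) = 0 := conjₗ.map_zero
theorem conj_smul (r : ℝ) (x : Cl m) : conj (r • x) = r • conj x := conjₗ.map_smul r x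
theorem conj_sum {ι : Type*} (s : Finset ι) (f : ι → Cl m) :
    conj (∑ i ∈ s, f i) = ∑ i ∈ s, conj (f i) := map_sum conjₗ f s

@[simp] theorem conj_one : conj (1 : Cl m) = 1 := by
  ext T; rw [coeff_conj, coeff_one]; split_ifs with h
  · subst h; simp
  · simp

theorem conj_mul (x y : Cl m) : conj (x * y) = conj y * conj x := by
  ext C
  simp only [coeff_conj, coeff_mul, Finset.mul_sum]
  refine Fintype.sum_equiv (Equiv.mk (fun A => A ∆ C) (fun A => A ∆ C)
    (fun A => by dsimp only; rw [symmDiff_assoc, symmDiff_self]; exact symmDiff_bot A)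
    (fun A => by dsimp only; rw [symmDiff_assoc, symmDiff_self]; exact symmDiff_bot A)) _ _ fun A => ?_
  have e : (A ∆ C) ∆ C = A := by rw [symmDiff_assoc, symmDiff_self]; exact symmDiff_bot A
  simp only [Equiv.coe_fn_mk, e]
  have h : C = A ∆ (A ∆ C) := (symmDiff_symmDiff_cancel_left A C).symm
  have h1 : sgn C C = sgn A A * sgn A (A ∆ C) * (sgn (A ∆ C) A * sgn (A ∆ C) (A ∆ C)) := by
    rw [← sgn_symmDiff_right, ← sgn_symmDiff_right, ← sgn_symmDiff_left, ← h]
  rw [h1]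
  linear_combination (sgn A A * sgn (A ∆ C) A * sgn (A ∆ C) (A ∆ C) * coeff x A * coeff y (A ∆ C))
    * sgn_mul_self A (A ∆ C)

@[simp] theorem norm_conj (x : Cl m) : ‖conj x‖ = ‖x‖ := by
  rw [norm_eq, norm_eq]
  congr 1
  refine Finset.sum_congr rfl fun T _ => ?_
  rw [coeff_conj, mul_pow, pow_two (sgn T T), sgn_mul_self, one_mul]

theorem coeff_conj_mul_empty (x y : Cl m) : coeff (conj x * y) ∅ = inner ℝ x y := by
  rw [coeff_mul, inner_eq]
  refine Finset.sum_congr rfl fun T _ => ?_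
  have h : T ∆ ∅ = T := symmDiff_bot T
  rw [h, coeff_conj, ← mul_assoc, ← mul_assoc, sgn_mul_self, one_mul]

/-- Conjugation gives the real adjoint of left multiplication. Through this the Clifford-valued
estimates below become real inner product estimates. -/
theorem inner_mul_left (a x y : Cl m) : inner ℝ (a * x) y = inner ℝ x (conj a * y) := by
  rw [← coeff_conj_mul_empty, ← coeff_conj_mul_empty, conj_mul, mul_assoc]

/-- Multiplication as a continuous bilinear map. -/
def mulL : Cl m →L[ℝ] Cl m →L[ℝ] Cl m :=
  LinearMap.toContinuousLinearMap
    (LinearMap.toContinuousLinearMap.toLinearMap ∘ₗ LinearMap.mul ℝ (Cl m))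

@[simp] theorem mulL_apply (x y : Cl m) : mulL x y = x * y := rfl

/-- Right multiplication by `c`. -/
def mulRightL (c : Cl m) : Cl m →L[ℝ] Cl m := mulL.flip c

@[simp] theorem mulRightL_apply (c x : Cl m) : mulRightL c x = x * c := rfl

/-- Conjugation as a continuous linear map. -/
def conjL : Cl m →L[ℝ] Cl m := LinearMap.toContinuousLinearMap conjₗ

@[simp] theorem conjL_apply (x : Cl m) : conjL x = conj x := rfl

@[fun_prop] theorem continuous_conj : Continuous (conj : Cl m → Cl m) := conjL.continuous

instance : ContinuousMul (Cl m) := ⟨mulL.continuous₂⟩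

/-- The Euclidean norm is not submultiplicative in general, so the operator norm of `mulL` enters
the estimates as a constant. -/
theorem norm_mul_le_mulL (x y : Cl m) : ‖x * y‖ ≤ ‖(mulL : Cl m →L[ℝ] _)‖ * ‖x‖ * ‖y‖ :=
  mulL.le_opNorm₂ x y

theorem norm_mul_of_conj_mul {a : Cl m} {r : ℝ} (hr : 0 ≤ r) (h : conj a * a = r ^ 2 • (1 : Cl m)) (x : Cl m) :
    ‖a * x‖ = r * ‖x‖ := by
  have h1 : ‖a * x‖ ^ 2 = (r * ‖x‖) ^ 2 := by
    rw [← real_inner_self_eq_norm_sq, inner_mul_left, ← mul_assoc, h, smul_mul_assoc, one_mul,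
      inner_smul_right, real_inner_self_eq_norm_sq]
    ring
  exact (pow_left_inj₀ (norm_nonneg _) (mul_nonneg hr (norm_nonneg _)) two_ne_zero).1 h1

@[simp] theorem norm_one' : ‖(1 : Cl m)‖ = 1 := by
  rw [norm_eq, Finset.sum_eq_single ∅] <;> simp +contextual [coeff_one]

instance : Nontrivial (Cl m) := ⟨0, 1, fun h => by
  have := norm_one' (m := m); rw [← h, norm_zero] at this; exact zero_ne_one this⟩

/-- In finite dimension an injective left multiplication is onto, so there is a right inverse, and
cancelling `a` on the left makes it two-sided. -/
theorem isUnit_of_forall_mul_eq_zero {a : Cl m} (h : ∀ v, a * v = 0 → v = 0) : IsUnit a := by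
  have hi : Function.Injective (LinearMap.mulLeft ℝ a) :=
    (injective_iff_map_eq_zero _).2 h
  obtain ⟨x, hx⟩ := (LinearMap.injective_iff_surjective.1 hi) 1
  have hx' : a * x = 1 := hx
  refine ⟨⟨a, x, hx', ?_⟩, rfl⟩
  refine sub_eq_zero.1 (h _ ?_)
  rw [mul_sub, ← mul_assoc, hx', one_mul, mul_one, sub_self]

end Cl

open Cl

/-! ### Paravectors and their multiplicative norm -/

section Paravector

variable {m : ℕ}

@[simp] theorem unitVec_zero : (unitVec 0 : Cl m) = 1 := rfl

theorem unitVec_succ (j : Fin m) : (unitVec j.succ : Cl m) = e {j} := rfl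

theorem conj_e (T : Finset (Fin m)) : conj (e T : Cl m) = sgn T T • e T := by
  ext S
  rw [coeff_conj, coeff_smul]
  by_cases h : S = T
  · subst h; rfl
  · simp [e, h]

theorem sgn_singleton (i j : Fin m) : sgn {i} {j} = if j ≤ i then (-1 : ℝ) else 1 := by
  simp [sgn_eq_prod]

theorem conj_unitVec_succ (j : Fin m) : conj (unitVec j.succ : Cl m) = -unitVec j.succ := by
  rw [unitVec_succ, conj_e, sgn_singleton]; simp

theorem e_singleton_mul_self (j : Fin m) : (e {j} : Cl m) * e {j} = -1 := by
  rw [e_mul_e, sgn_singleton, symmDiff_self]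
  simp only [le_refl, if_true, neg_smul, one_smul]; rfl

theorem e_singleton_anticomm {i j : Fin m} (h : i ≠ j) :
    (e {i} : Cl m) * e {j} = -(e {j} * e {i}) := by
  rw [e_mul_e, e_mul_e, sgn_singleton, sgn_singleton, symmDiff_comm]
  rcases lt_or_gt_of_ne h with h | h <;> simp [h.le, h.not_ge]

theorem conj_unitVec_mul_add (i j : Fin (m + 1)) :
    conj (unitVec i : Cl m) * unitVec j + conj (unitVec j) * unitVec i =
      if i = j then (2 : ℝ) • 1 else 0 := by
  refine Fin.cases ?_ (fun i => ?_) i <;> refine Fin.cases ?_ (fun j => ?_) j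
  · simp [two_smul]
  · simp [conj_unitVec_succ, (Fin.succ_ne_zero j).symm]
  · simp [conj_unitVec_succ, Fin.succ_ne_zero i]
  · rw [conj_unitVec_succ, conj_unitVec_succ, unitVec_succ, unitVec_succ]
    by_cases h : i = j
    · subst h; simp [e_singleton_mul_self, two_smul]
    · rw [neg_mul, neg_mul, e_singleton_anticomm h]; simp [h]

theorem unitVec_mul_conj_add (i j : Fin (m + 1)) :
    (unitVec i : Cl m) * conj (unitVec j) + unitVec j * conj (unitVec i) =
      if i = j then (2 : ℝ) • 1 else 0 := by
  refine Fin.cases ?_ (fun i => ?_) i <;> refine Fin.cases ?_ (fun j => ?_) j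
  · simp [two_smul]
  · simp [conj_unitVec_succ, (Fin.succ_ne_zero j).symm]
  · simp [conj_unitVec_succ, Fin.succ_ne_zero i]
  · rw [conj_unitVec_succ, conj_unitVec_succ, unitVec_succ, unitVec_succ]
    by_cases h : i = j
    · subst h; simp [e_singleton_mul_self, two_smul]
    · rw [mul_neg, mul_neg, e_singleton_anticomm h]; simp [h]

theorem conj_unitVec_mul_self (i : Fin (m + 1)) : conj (unitVec i : Cl m) * unitVec i = 1 := by
  have h := conj_unitVec_mul_add (m := m) i i
  rw [if_pos rfl, ← two_smul ℝ] at h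
  exact (smul_right_injective _ (two_ne_zero (α := ℝ))) h

theorem unitVec_mul_conj_self (i : Fin (m + 1)) : (unitVec i : Cl m) * conj (unitVec i) = 1 := by
  have h := unitVec_mul_conj_add (m := m) i i
  rw [if_pos rfl, ← two_smul ℝ] at h
  exact (smul_right_injective _ (two_ne_zero (α := ℝ))) h

/-- The identification of `ℝ^{m+1}` with the paravectors, as a continuous linear map. -/
def toClL : Pt m →L[ℝ] Cl m :=
  LinearMap.toContinuousLinearMap
    { toFun := toCl
      map_add' := fun x y => by simp [toCl, add_smul, Finset.sum_add_distrib]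
      map_smul' := fun r x => by simp [toCl, mul_smul, Finset.smul_sum] }

@[simp] theorem toClL_apply (x : Pt m) : toClL x = toCl x := rfl

theorem toCl_add (x y : Pt m) : toCl (x + y) = toCl x + toCl y := toClL.map_add x y
theorem toCl_sub (x y : Pt m) : toCl (x - y) = toCl x - toCl y := toClL.map_sub x y
theorem toCl_neg (x : Pt m) : toCl (-x) = -toCl x := toClL.map_neg x
theorem toCl_smul (r : ℝ) (x : Pt m) : toCl (r • x) = r • toCl x := toClL.map_smul r x
@[simp] theorem toCl_zero : toCl (0 : Pt m) = 0 := toClL.map_zero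

@[fun_prop] theorem continuous_toCl : Continuous (toCl : Pt m → Cl m) := toClL.continuous

@[simp] theorem toCl_single (i : Fin (m + 1)) :
    toCl (EuclideanSpace.single i 1 : Pt m) = unitVec i := by
  rw [toCl, Finset.sum_eq_single i] <;> simp +contextual

theorem pt_inner (x y : Pt m) : inner ℝ x y = ∑ i, x i * y i := by
  rw [PiLp.inner_apply]
  exact Finset.sum_congr rfl fun i _ => by simp [mul_comm]

theorem conj_toCl_mul_add (x y : Pt m) :
    conj (toCl x) * toCl y + conj (toCl y) * toCl x = (2 * inner ℝ x y) • (1 : Cl m) := by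
  have h1 : ∀ x y : Pt m, conj (toCl x) * toCl y =
      ∑ i, ∑ j, (x i * y j) • (conj (unitVec i : Cl m) * unitVec j) := fun x y => by
    simp only [toCl, conj_sum, conj_smul, Finset.sum_mul_sum, smul_mul_smul_comm]
  rw [h1, h1, Finset.sum_comm (f := fun i j => (y i * x j) • _), ← Finset.sum_add_distrib,
    pt_inner, Finset.mul_sum, Finset.sum_smul]
  refine Finset.sum_congr rfl fun i _ => ?_
  rw [← Finset.sum_add_distrib, Finset.sum_eq_single i]
  · rw [mul_comm (y i), ← smul_add, conj_unitVec_mul_add, if_pos rfl, smul_smul, mul_comm]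
  · intro j _ hj
    rw [mul_comm (y j), ← smul_add, conj_unitVec_mul_add, if_neg hj.symm, smul_zero]
  · simp

theorem toCl_mul_conj_add (x y : Pt m) :
    toCl x * conj (toCl y) + toCl y * conj (toCl x) = (2 * inner ℝ x y) • (1 : Cl m) := by
  have h1 : ∀ x y : Pt m, toCl x * conj (toCl y) =
      ∑ i, ∑ j, (x i * y j) • ((unitVec i : Cl m) * conj (unitVec j)) := fun x y => by
    simp only [toCl, conj_sum, conj_smul, Finset.sum_mul_sum, smul_mul_smul_comm]
  rw [h1, h1, Finset.sum_comm (f := fun i j => (y i * x j) • _), ← Finset.sum_add_distrib,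
    pt_inner, Finset.mul_sum, Finset.sum_smul]
  refine Finset.sum_congr rfl fun i _ => ?_
  rw [← Finset.sum_add_distrib, Finset.sum_eq_single i]
  · rw [mul_comm (y i), ← smul_add, unitVec_mul_conj_add, if_pos rfl, smul_smul, mul_comm]
  · intro j _ hj
    rw [mul_comm (y j), ← smul_add, unitVec_mul_conj_add, if_neg hj.symm, smul_zero]
  · simp

theorem conj_toCl_mul_self (x : Pt m) : conj (toCl x) * toCl x = (‖x‖ ^ 2) • (1 : Cl m) := by
  have h := conj_toCl_mul_add x x
  rw [← two_smul ℝ, mul_smul, real_inner_self_eq_norm_sq] at h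
  exact (smul_right_injective _ (two_ne_zero (α := ℝ))) h

theorem toCl_mul_conj_self (x : Pt m) : toCl x * conj (toCl x) = (‖x‖ ^ 2) • (1 : Cl m) := by
  have h := toCl_mul_conj_add x x
  rw [← two_smul ℝ, mul_smul, real_inner_self_eq_norm_sq] at h
  exact (smul_right_injective _ (two_ne_zero (α := ℝ))) h

theorem norm_toCl_mul (x : Pt m) (y : Cl m) : ‖toCl x * y‖ = ‖x‖ * ‖y‖ :=
  norm_mul_of_conj_mul (norm_nonneg x) (conj_toCl_mul_self x) y

theorem norm_conj_toCl_mul (x : Pt m) (y : Cl m) : ‖conj (toCl x) * y‖ = ‖x‖ * ‖y‖ :=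
  norm_mul_of_conj_mul (norm_nonneg x) (by rw [conj_conj]; exact toCl_mul_conj_self x) y

@[simp] theorem norm_toCl (x : Pt m) : ‖toCl x‖ = ‖x‖ := by
  have := norm_toCl_mul x 1; simpa using this

end Paravector

/-! ### The regularized Cauchy kernel and the Cauchy–Pompeiu formula -/

variable {m : ℕ}

/-- The Dirac operator `∑ᵢ eᵢ ∂ᵢ` of `ℝ^{m+1}`. -/
def dirac (q : Pt m → Cl m) (x : Pt m) : Cl m :=
  ∑ i, unitVec i * fderiv ℝ q x (EuclideanSpace.single i 1)

/-- The regularized Cauchy kernel `conj(x - c) / (|x - c|² + ε²)^{(m+1)/2}`. -/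
def cauchyReg (c : Pt m) (ε : ℝ) (x : Pt m) : Cl m :=
  ((‖x - c‖ ^ 2 + ε ^ 2) ^ (-((m : ℝ) + 1) / 2)) • conj (toCl (x - c))

/-- The divergence of the regularized Cauchy kernel, a multiple of an approximate identity. -/
def cauchyBump (c : Pt m) (ε : ℝ) (x : Pt m) : ℝ :=
  ((m : ℝ) + 1) * ε ^ 2 * (‖x - c‖ ^ 2 + ε ^ 2) ^ (-((m : ℝ) + 3) / 2)

/-- The derivative of the regularized Cauchy kernel. -/
def cauchyRegDeriv (c : Pt m) (ε : ℝ) (x : Pt m) : Pt m →L[ℝ] Cl m :=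
  ((‖x - c‖ ^ 2 + ε ^ 2) ^ (-((m : ℝ) + 1) / 2)) • (conjL ∘L toClL) +
    ((-((m : ℝ) + 1)) * (‖x - c‖ ^ 2 + ε ^ 2) ^ (-((m : ℝ) + 3) / 2)) •
      (innerSL ℝ (x - c)).smulRight (conj (toCl (x - c)))

theorem hasFDerivAt_cauchyReg (c : Pt m) (ε : ℝ) (x : Pt m) (h : 0 < ‖x - c‖ ^ 2 + ε ^ 2) :
    HasFDerivAt (cauchyReg c ε) (cauchyRegDeriv c ε x) x := by
  have h0 : HasFDerivAt (fun x : Pt m => x - c) (ContinuousLinearMap.id ℝ _) x :=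
    (hasFDerivAt_id x).sub_const c
  have h1 : HasFDerivAt (fun x : Pt m => ‖x - c‖ ^ 2 + ε ^ 2)
      ((2 : ℝ) • innerSL ℝ (x - c)) x := by
    refine (h0.norm_sq.add_const _).congr_fderiv ?_
    ext v; simp
  have h2 := h1.rpow_const (p := -((m : ℝ) + 1) / 2) (Or.inl h.ne')
  have h3 : HasFDerivAt (fun x : Pt m => conj (toCl (x - c))) (conjL ∘L toClL) x :=
    HasFDerivAt.comp (g := (conjL ∘L toClL : Pt m →L[ℝ] Cl m)) x
      (conjL ∘L toClL : Pt m →L[ℝ] Cl m).hasFDerivAt h0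
  refine (h2.smul h3).congr_fderiv ?_
  ext1 v
  have he : -((m : ℝ) + 1) / 2 - 1 = -((m : ℝ) + 3) / 2 := by ring
  simp only [cauchyRegDeriv, he, add_apply, smul_apply,
    ContinuousLinearMap.smulRight_apply, smul_smul, innerSL_apply_apply, smul_eq_mul]
  congr 2
  ring

theorem cauchyRegDeriv_single (c : Pt m) (ε : ℝ) (x : Pt m) (i : Fin (m + 1)) :
    cauchyRegDeriv c ε x (EuclideanSpace.single i 1) =
    ((‖x - c‖ ^ 2 + ε ^ 2) ^ (-((m : ℝ) + 1) / 2)) • conj (unitVec i) +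
    ((-((m : ℝ) + 1)) * (‖x - c‖ ^ 2 + ε ^ 2) ^ (-((m : ℝ) + 3) / 2)) •
      ((x - c) i • conj (toCl (x - c))) := by
  have h : inner ℝ (x - c) (EuclideanSpace.single i (1 : ℝ)) = (x - c) i := by
    rw [real_inner_comm, EuclideanSpace.inner_single_left]; simp
  simp only [cauchyRegDeriv, add_apply, smul_apply, ContinuousLinearMap.smulRight_apply,
    innerSL_apply_apply, ContinuousLinearMap.comp_apply, toClL_apply, toCl_single, conjL_apply, h]

theorem toCl_eq_sum (x : Pt m) : toCl x = ∑ i, x i • unitVec i := rfl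

theorem cauchyBump_aux (c : Pt m) (ε : ℝ) (x : Pt m) (h : 0 < ‖x - c‖ ^ 2 + ε ^ 2) :
    (‖x - c‖ ^ 2 + ε ^ 2) ^ (-((m : ℝ) + 1) / 2) * ((m : ℝ) + 1) +
      (-((m : ℝ) + 1)) * (‖x - c‖ ^ 2 + ε ^ 2) ^ (-((m : ℝ) + 3) / 2) * ‖x - c‖ ^ 2 =
      cauchyBump c ε x := by
  have he : -((m : ℝ) + 1) / 2 = -((m : ℝ) + 3) / 2 + 1 := by ring
  rw [he, Real.rpow_add_one h.ne', cauchyBump]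
  ring

theorem sum_cauchyRegDeriv_mul (c : Pt m) (ε : ℝ) (x : Pt m) (h : 0 < ‖x - c‖ ^ 2 + ε ^ 2) :
    ∑ i, cauchyRegDeriv c ε x (EuclideanSpace.single i 1) * unitVec i =
      cauchyBump c ε x • (1 : Cl m) := by
  simp only [cauchyRegDeriv_single, add_mul, smul_mul_assoc, conj_unitVec_mul_self,
    Finset.sum_add_distrib, ← Finset.smul_sum]
  have h1 : ∑ i, (x - c) i • (conj (toCl (x - c)) * unitVec i) = (‖x - c‖ ^ 2) • (1 : Cl m) := by
    rw [← conj_toCl_mul_self, toCl_eq_sum (x - c), Finset.mul_sum]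
    simp only [mul_smul_comm]
  rw [h1, ← cauchyBump_aux c ε x h]
  rw [Finset.sum_const, Finset.card_univ, Fintype.card_fin, ← Nat.cast_smul_eq_nsmul ℝ,
    smul_smul, smul_smul, ← add_smul]
  push_cast
  rfl

/-- The mirrored identity, with the units on the right, serves the integration by parts. This one,
at ε = 0, shows that the Cauchy kernel is left monogenic away from its pole. -/
theorem sum_mul_cauchyRegDeriv (c : Pt m) (ε : ℝ) (x : Pt m) (h : 0 < ‖x - c‖ ^ 2 + ε ^ 2) :
    ∑ i, unitVec i * cauchyRegDeriv c ε x (EuclideanSpace.single i 1) =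
      cauchyBump c ε x • (1 : Cl m) := by
  simp only [cauchyRegDeriv_single, mul_add, mul_smul_comm, unitVec_mul_conj_self,
    Finset.sum_add_distrib, ← Finset.smul_sum]
  have h1 : ∑ i, (x - c) i • (unitVec i * conj (toCl (x - c))) = (‖x - c‖ ^ 2) • (1 : Cl m) := by
    rw [← toCl_mul_conj_self, toCl_eq_sum (x - c), Finset.sum_mul]
    simp only [smul_mul_assoc]
  rw [h1, ← cauchyBump_aux c ε x h]
  rw [Finset.sum_const, Finset.card_univ, Fintype.card_fin, ← Nat.cast_smul_eq_nsmul ℝ,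
    smul_smul, smul_smul, ← add_smul]
  push_cast
  rfl

theorem cauchyReg_pos {c : Pt m} {ε : ℝ} (hε : 0 < ε) (x : Pt m) : 0 < ‖x - c‖ ^ 2 + ε ^ 2 := by
  positivity

theorem continuous_cauchyReg (c : Pt m) {ε : ℝ} (hε : 0 < ε) : Continuous (cauchyReg c ε) :=
  continuous_iff_continuousAt.2 fun x =>
    (hasFDerivAt_cauchyReg c ε x (cauchyReg_pos hε x)).continuousAt

theorem continuous_cauchyRegDeriv (c : Pt m) {ε : ℝ} (hε : 0 < ε) (v : Pt m) :
    Continuous (fun x => cauchyRegDeriv c ε x v) := by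
  have h : ∀ s : ℝ, Continuous fun x : Pt m => (‖x - c‖ ^ 2 + ε ^ 2) ^ s := fun s =>
    Continuous.rpow_const (by fun_prop) fun x => Or.inl (cauchyReg_pos hε x).ne'
  simp only [cauchyRegDeriv, add_apply, smul_apply,
    ContinuousLinearMap.smulRight_apply, innerSL_apply_apply]
  have h2 : Continuous fun x : Pt m => (inner ℝ (x - c) v : ℝ) := by fun_prop
  have h3 : Continuous fun x : Pt m => conj (toCl (x - c)) := by fun_prop
  exact ((h _).smul continuous_const).add ((continuous_const.mul (h _)).smul (h2.smul h3))

theorem continuous_dirac {q : Pt m → Cl m} (hq : ContDiff ℝ 1 q) : Continuous (dirac q) := by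
  unfold dirac
  have := hq.continuous_fderiv one_ne_zero
  fun_prop

theorem hasCompactSupport_dirac {q : Pt m → Cl m} (hc : HasCompactSupport q) :
    HasCompactSupport (dirac q) := by
  refine (hc.fderiv ℝ).mono ?_
  intro x hx h
  exact hx (by simp [dirac, h])

/-- Integration by parts in each variable: the derivatives of the kernel, multiplied by `unitVec i`
on the right, add up to the scalar `cauchyBump`. -/
theorem integral_cauchyReg_mul_dirac (c : Pt m) {ε : ℝ} (hε : 0 < ε) {q : Pt m → Cl m}
    (hq : ContDiff ℝ 1 q) (hc : HasCompactSupport q) :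
    ∫ x, cauchyReg c ε x * dirac q x = -∫ x, cauchyBump c ε x • q x := by
  have hfc := hq.continuous_fderiv one_ne_zero
  have hqc := hq.continuous
  have hfs : HasCompactSupport (fderiv ℝ q) := hc.fderiv ℝ
  have i1 : ∀ i : Fin (m + 1), Integrable (fun x =>
      cauchyRegDeriv c ε x (EuclideanSpace.single i 1) * (unitVec i * q x)) := fun i => by
    refine Continuous.integrable_of_hasCompactSupport
      ((continuous_cauchyRegDeriv c hε _).mul (by fun_prop)) (hc.mono fun x hx h => hx ?_)
    simp [h]
  have i2 : ∀ i : Fin (m + 1), Integrable (fun x =>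
      cauchyReg c ε x * (unitVec i * fderiv ℝ q x (EuclideanSpace.single i 1))) := fun i => by
    refine Continuous.integrable_of_hasCompactSupport
      ((continuous_cauchyReg c hε).mul (by fun_prop)) (hfs.mono fun x hx h => hx ?_)
    simp [h]
  have i3 : ∀ i : Fin (m + 1), Integrable (fun x =>
      cauchyReg c ε x * (unitVec i * q x)) := fun i => by
    refine Continuous.integrable_of_hasCompactSupport
      ((continuous_cauchyReg c hε).mul (by fun_prop)) (hc.mono fun x hx h => hx ?_)
    simp [h]
  have key : ∀ i : Fin (m + 1), ∫ x, cauchyReg c ε x *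
      (unitVec i * fderiv ℝ q x (EuclideanSpace.single i 1)) =
      -∫ x, cauchyRegDeriv c ε x (EuclideanSpace.single i 1) * (unitVec i * q x) := fun i =>
    integral_bilinear_hasFDerivAt_right_eq_neg_left_of_integrable (μ := volume)
      (f := cauchyReg c ε) (f' := cauchyRegDeriv c ε) (g := fun x => unitVec i * q x)
      (g' := fun x => (mulL (unitVec i)) ∘L (fderiv ℝ q x)) (B := mulL)
      (v := EuclideanSpace.single i 1)
      (i1 i) (i2 i) (i3 i) (fun x _ => hasFDerivAt_cauchyReg c ε x (cauchyReg_pos hε x))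
      (fun x _ => (mulL (unitVec i)).hasFDerivAt.comp x
        (hq.differentiable one_ne_zero x).hasFDerivAt)
  simp only [dirac, Finset.mul_sum]
  rw [integral_finsetSum _ fun i _ => i2 i, Finset.sum_congr rfl fun i _ => key i,
    Finset.sum_neg_distrib, ← integral_finsetSum _ fun i _ => i1 i]
  congr 2
  ext1 x
  simp only [← mul_assoc]
  rw [← Finset.sum_mul, sum_cauchyRegDeriv_mul c ε x (cauchyReg_pos hε x), smul_mul_assoc, one_mul]

/-- The total mass of the divergence of the regularized Cauchy kernel. -/
def cauchyConst (m : ℕ) : ℝ :=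
  ∫ y : Pt m, ((m : ℝ) + 1) * (1 + ‖y‖ ^ 2) ^ (-((m : ℝ) + 3) / 2)

theorem integrable_bump : Integrable
    (fun y : Pt m => ((m : ℝ) + 1) * (1 + ‖y‖ ^ 2) ^ (-((m : ℝ) + 3) / 2)) := by
  refine Integrable.const_mul ?_ _
  refine integrable_rpow_neg_one_add_norm_sq ?_
  simp

/-- Only the positivity of this constant matters below; its value is never needed. -/
theorem cauchyConst_pos : 0 < cauchyConst m := by
  rw [cauchyConst, integral_pos_iff_support_of_nonneg (fun y => by positivity) integrable_bump]
  have : Function.support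
      (fun y : Pt m => ((m : ℝ) + 1) * (1 + ‖y‖ ^ 2) ^ (-((m : ℝ) + 3) / 2)) = Set.univ := by
    ext y
    simp only [Function.mem_support, Set.mem_univ, iff_true]
    positivity
  rw [this]
  exact Measure.measure_univ_pos.2 (NeZero.ne _)

/-- With ε = 1/t the bump is the rescaling by t of one fixed integrable profile, with the factor
t^(m+1) that dimension m + 1 requires: an approximate identity. -/
theorem cauchyBump_inv (c : Pt m) {t : ℝ} (ht : 0 < t) (x : Pt m) :
    cauchyBump c t⁻¹ x =
      t ^ (m + 1) * (((m : ℝ) + 1) * (1 + ‖t • (c - x)‖ ^ 2) ^ (-((m : ℝ) + 3) / 2)) := by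
  have h1 : ‖x - c‖ ^ 2 + t⁻¹ ^ 2 = (1 + ‖t • (c - x)‖ ^ 2) * (t ^ 2)⁻¹ := by
    rw [norm_smul, norm_sub_rev c x, Real.norm_of_nonneg ht.le]
    field_simp
    ring
  have h2 : ((t ^ 2)⁻¹ : ℝ) ^ (-((m : ℝ) + 3) / 2) = t ^ (m + 3) := by
    rw [Real.inv_rpow (by positivity), ← Real.rpow_natCast t 2, ← Real.rpow_mul ht.le,
      ← Real.rpow_neg ht.le, ← Real.rpow_natCast]
    congr 1
    push_cast
    ring
  rw [cauchyBump, h1, Real.mul_rpow (by positivity) (by positivity), h2]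
  field_simp
  ring

theorem tendsto_cauchyBump (c : Pt m) {q : Pt m → Cl m} (hq : Integrable q)
    (hqc : ContinuousAt q c) :
    Tendsto (fun t : ℝ => ∫ x, cauchyBump c t⁻¹ x • q x) atTop (𝓝 (cauchyConst m • q c)) := by
  have hκ := cauchyConst_pos (m := m)
  have hdim : Module.finrank ℝ (Pt m) = m + 1 := by simp
  have := tendsto_integral_comp_smul_smul_of_integrable' (μ := (volume : Measure (Pt m)))
    (φ := fun y => (cauchyConst m)⁻¹ *
      (((m : ℝ) + 1) * (1 + ‖y‖ ^ 2) ^ (-((m : ℝ) + 3) / 2)))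
    (fun y => by positivity) ?_ ?_ hq hqc
  · refine (this.const_smul (cauchyConst m)).congr' ?_
    filter_upwards [eventually_gt_atTop 0] with t ht
    rw [← integral_smul]
    refine integral_congr_ae (Eventually.of_forall fun x => ?_)
    simp only
    rw [cauchyBump_inv c ht, smul_smul, hdim]
    congr 1
    field_simp
  · rw [integral_const_mul]
    exact inv_mul_cancel₀ hκ.ne'
  · rw [hdim]
    have h1 : Tendsto (fun y : Pt m => ((cauchyConst m)⁻¹ * ((m : ℝ) + 1)) * (‖y‖⁻¹ ^ 2))
        (Bornology.cobounded _) (𝓝 0) := by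
      have : Tendsto (fun y : Pt m => ‖y‖⁻¹) (Bornology.cobounded _) (𝓝 0) :=
        tendsto_inv_atTop_zero.comp tendsto_norm_cobounded_atTop
      simpa using (this.pow 2).const_mul ((cauchyConst m)⁻¹ * ((m : ℝ) + 1))
    refine squeeze_zero' (Eventually.of_forall fun y => by positivity) ?_ h1
    filter_upwards [tendsto_norm_cobounded_atTop.eventually (eventually_gt_atTop 0)] with y hy
    have h2 : (1 + ‖y‖ ^ 2) ^ (-((m : ℝ) + 3) / 2) ≤ (‖y‖ ^ (m + 3))⁻¹ := by
      calc (1 + ‖y‖ ^ 2) ^ (-((m : ℝ) + 3) / 2) ≤ (‖y‖ ^ 2) ^ (-((m : ℝ) + 3) / 2) :=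
            Real.rpow_le_rpow_of_nonpos (by positivity) (by linarith)
              (by apply div_nonpos_of_nonpos_of_nonneg <;> linarith [(m.cast_nonneg : (0 : ℝ) ≤ m)])
        _ = (‖y‖ ^ (m + 3))⁻¹ := by
          rw [← Real.rpow_natCast, ← Real.rpow_mul hy.le, ← Real.rpow_natCast,
            ← Real.rpow_neg hy.le]
          congr 1
          push_cast
          ring
    calc ‖y‖ ^ (m + 1) * ((cauchyConst m)⁻¹ *
          (((m : ℝ) + 1) * (1 + ‖y‖ ^ 2) ^ (-((m : ℝ) + 3) / 2)))
        ≤ ‖y‖ ^ (m + 1) * ((cauchyConst m)⁻¹ * (((m : ℝ) + 1) * (‖y‖ ^ (m + 3))⁻¹)) := by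
          gcongr
      _ = ((cauchyConst m)⁻¹ * ((m : ℝ) + 1)) * (‖y‖⁻¹ ^ 2) := by
          field_simp
          ring

theorem cauchyReg_zero (c x : Pt m) :
    cauchyReg c 0 x = (‖x - c‖ ^ (m + 1))⁻¹ • conj (toCl (x - c)) := by
  rw [cauchyReg]
  congr 1
  rw [zero_pow two_ne_zero, add_zero, ← Real.rpow_natCast, ← Real.rpow_natCast,
    ← Real.rpow_mul (norm_nonneg _), ← Real.rpow_neg (norm_nonneg _)]
  congr 1
  push_cast
  ring

theorem norm_cauchyReg_le {c x : Pt m} {ε δ : ℝ} (hδ : 0 < δ) (hx : δ ≤ ‖x - c‖) :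
    ‖cauchyReg c ε x‖ ≤ δ⁻¹ ^ m := by
  have hp : 0 < ‖x - c‖ := hδ.trans_le hx
  have h1 : (‖x - c‖ ^ 2 + ε ^ 2) ^ (-((m : ℝ) + 1) / 2) ≤ (‖x - c‖ ^ (m + 1))⁻¹ := by
    calc (‖x - c‖ ^ 2 + ε ^ 2) ^ (-((m : ℝ) + 1) / 2) ≤ (‖x - c‖ ^ 2) ^ (-((m : ℝ) + 1) / 2) :=
          Real.rpow_le_rpow_of_nonpos (by positivity) (by nlinarith [sq_nonneg ε])
            (by apply div_nonpos_of_nonpos_of_nonneg <;> linarith [(m.cast_nonneg : (0 : ℝ) ≤ m)])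
      _ = (‖x - c‖ ^ (m + 1))⁻¹ := by
        rw [← Real.rpow_natCast, ← Real.rpow_mul hp.le, ← Real.rpow_natCast, ← Real.rpow_neg hp.le]
        congr 1
        push_cast
        ring
  rw [cauchyReg, norm_smul, norm_conj, norm_toCl, Real.norm_of_nonneg (by positivity)]
  calc _ ≤ (‖x - c‖ ^ (m + 1))⁻¹ * ‖x - c‖ := by gcongr
    _ = ‖x - c‖⁻¹ ^ m := by rw [pow_succ, inv_pow]; field_simp
    _ ≤ δ⁻¹ ^ m := by gcongr

/-- Dominated convergence: `D` vanishes on a δ-ball around the pole, and off this ball the kernels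
are bounded by δ^(-m) uniformly in ε. -/
theorem tendsto_integral_cauchyReg_mul (c : Pt m) {D : Pt m → Cl m} (hD : Continuous D)
    (hDs : HasCompactSupport D) (h0 : D =ᶠ[𝓝 c] 0) :
    Tendsto (fun t : ℝ => ∫ x, cauchyReg c t⁻¹ x * D x) atTop
      (𝓝 (∫ x, cauchyReg c 0 x * D x)) := by
  obtain ⟨δ, hδ, hball⟩ := Metric.eventually_nhds_iff.1 h0
  refine tendsto_integral_filter_of_dominated_convergence
    (fun x => ‖(mulL : Cl m →L[ℝ] _)‖ * (δ⁻¹ ^ m) * ‖D x‖) ?_ ?_ ?_ ?_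
  · filter_upwards [eventually_gt_atTop 0] with t ht
    exact ((continuous_cauchyReg c (inv_pos.2 ht)).mul hD).aestronglyMeasurable
  · refine Eventually.of_forall fun t => Eventually.of_forall fun x => ?_
    by_cases hx : dist x c < δ
    · rw [hball hx]; simp
    · rw [dist_eq_norm, not_lt] at hx
      refine (norm_mul_le_mulL _ _).trans ?_
      gcongr
      exact norm_cauchyReg_le hδ hx
  · exact ((hD.norm.integrable_of_hasCompactSupport hDs.norm)).const_mul _
  · refine Eventually.of_forall fun x => ?_
    by_cases hx : dist x c < δ
    · rw [hball hx]; simp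
    · rw [dist_eq_norm, not_lt] at hx
      have hp : 0 < ‖x - c‖ := hδ.trans_le hx
      refine Tendsto.mul_const _ (Tendsto.smul_const ?_ _)
      refine Tendsto.rpow_const ?_ (Or.inl (by positivity))
      exact tendsto_const_nhds.add (tendsto_inv_atTop_zero.pow 2)

/-- This is the Cauchy–Pompeiu formula. The vanishing of `dirac q` near `c` keeps the singularity of
the kernel out of the integral. -/
theorem cauchyConst_smul_eq (c : Pt m) {q : Pt m → Cl m} (hq : ContDiff ℝ 1 q)
    (hc : HasCompactSupport q) (h0 : dirac q =ᶠ[𝓝 c] 0) :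
    cauchyConst m • q c = -∫ x, cauchyReg c 0 x * dirac q x := by
  refine tendsto_nhds_unique (tendsto_cauchyBump c (hq.continuous.integrable_of_hasCompactSupport hc)
    hq.continuous.continuousAt) ?_
  refine (tendsto_integral_cauchyReg_mul c (continuous_dirac hq) (hasCompactSupport_dirac hc)
    h0).neg.congr' ?_
  filter_upwards [eventually_gt_atTop 0] with t ht
  rw [integral_cauchyReg_mul_dirac c (inv_pos.2 ht) hq hc, neg_neg]

/-! ### Polar coordinates, radial cutoffs and Cauchy's formula on spheres -/

theorem integral_polar {F : Type*} [NormedAddCommGroup F] [NormedSpace ℝ F] {H : Pt m → F}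
    (hH : Integrable H) :
    ∫ x, H x = ∫ r in Set.Ioi (0 : ℝ), r ^ m • ∫ η, H (r • (η : Pt m)) ∂surface m := by
  have hdim : Module.finrank ℝ (Pt m) - 1 = m := by simp
  have hmp := (volume : Measure (Pt m)).measurePreserving_homeomorphUnitSphereProd
  have hemb := (homeomorphUnitSphereProd (Pt m)).measurableEmbedding
  set G : Metric.sphere (0 : Pt m) 1 × Set.Ioi (0 : ℝ) → F := fun p => H ((p.2 : ℝ) • (p.1 : Pt m))
    with hG
  have hcomp : ∀ x : ({0}ᶜ : Set (Pt m)), G (homeomorphUnitSphereProd (Pt m) x) = H x := by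
    intro x
    have h0 : ‖(x : Pt m)‖ ≠ 0 := norm_ne_zero_iff.2 x.2
    simp only [hG, homeomorphUnitSphereProd_apply_fst_coe, homeomorphUnitSphereProd_apply_snd_coe,
      smul_smul]
    rw [mul_inv_cancel₀ h0, one_smul]
  have hint : Integrable G ((volume : Measure (Pt m)).toSphere.prod
      (Measure.volumeIoiPow (Module.finrank ℝ (Pt m) - 1))) := by
    refine (hmp.integrable_comp_emb hemb).1 ?_
    have : G ∘ (homeomorphUnitSphereProd (Pt m)) = fun x : ({0}ᶜ : Set (Pt m)) => H x := funext hcomp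
    rw [this]
    have := (integrableOn_iff_comap_subtypeVal (f := H) (μ := volume)
      (s := ({0}ᶜ : Set (Pt m))) (measurableSet_singleton _).compl).1 hH.integrableOn
    exact this
  calc ∫ x, H x = ∫ x : ({0}ᶜ : Set (Pt m)), H x ∂((volume : Measure (Pt m)).comap (↑)) := by
        rw [integral_subtype_comap (measurableSet_singleton _).compl, restrict_compl_singleton]
    _ = ∫ p, G p ∂((volume : Measure (Pt m)).toSphere.prod
      (Measure.volumeIoiPow (Module.finrank ℝ (Pt m) - 1))) := by
        rw [← hmp.integral_comp hemb]
        exact integral_congr_ae (Eventually.of_forall fun x => (hcomp x).symm)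
    _ = ∫ r : Set.Ioi (0 : ℝ), (∫ η, H ((r : ℝ) • (η : Pt m)) ∂surface m)
          ∂Measure.volumeIoiPow (Module.finrank ℝ (Pt m) - 1) := integral_prod_symm G hint
    _ = _ := by
      simp only [Measure.volumeIoiPow, ENNReal.ofReal]
      rw [integral_withDensity_eq_integral_smul, hdim,
        integral_subtype_comap measurableSet_Ioi fun r : ℝ =>
          Real.toNNReal (r ^ m) • ∫ η, H (r • (η : Pt m)) ∂surface m,
        setIntegral_congr_fun measurableSet_Ioi fun x hx ↦ ?_]
      · rw [NNReal.smul_def, Real.coe_toNNReal _ (pow_nonneg hx.out.le _)]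
      · exact (measurable_subtype_coe.pow_const _).real_toNNReal

/-- The radial cutoff `x ↦ ∫_{|x|}^1 φ`. -/
def radialCutoff (φ : ℝ → ℝ) (x : Pt m) : ℝ := ∫ r in ‖x‖..1, φ r

section Cutoff

variable {φ : ℝ → ℝ} {α β : ℝ}

theorem radialCutoff_eq_zero (hβ : β < 1) (hφβ : ∀ r, β ≤ r → φ r = 0) {x : Pt m} (hx : β ≤ ‖x‖) :
    radialCutoff φ x = 0 := by
  rw [radialCutoff]
  refine intervalIntegral.integral_zero_ae (Eventually.of_forall fun r hr => hφβ r ?_)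
  rw [Set.uIoc, Set.mem_Ioc] at hr
  exact (le_min hx hβ.le).trans hr.1.le

theorem radialCutoff_eq (hφ : Continuous φ) (hφα : ∀ r, r ≤ α → φ r = 0)
    (hβ : β < 1) (hφβ : ∀ r, β ≤ r → φ r = 0)
    {x : Pt m} (hx : ‖x‖ ≤ α) : radialCutoff φ x = ∫ r in Set.Ioi (0 : ℝ), φ r := by
  have h1 : ∫ r in Set.Ioi (0 : ℝ), φ r = ∫ r in (0 : ℝ)..1, φ r := by
    rw [intervalIntegral.integral_of_le zero_le_one]
    refine (setIntegral_eq_of_subset_of_forall_sdiff_eq_zero measurableSet_Ioi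
      Set.Ioc_subset_Ioi_self fun r hr => hφβ r ?_).symm ▸ rfl
    by_contra h
    exact hr.2 ⟨hr.1, (not_le.1 h).le.trans hβ.le⟩
  have h2 : ∫ r in (0 : ℝ)..‖x‖, φ r = 0 := by
    refine intervalIntegral.integral_zero_ae (Eventually.of_forall fun r hr => hφα r ?_)
    rw [Set.uIoc_of_le (norm_nonneg x)] at hr
    exact hr.2.trans hx
  rw [h1, ← intervalIntegral.integral_add_adjacent_intervals (hφ.intervalIntegrable 0 ‖x‖)
    (hφ.intervalIntegrable ‖x‖ 1), h2, zero_add, radialCutoff]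

theorem hasFDerivAt_radialCutoff (hφ : Continuous φ) (hα : 0 < α) (hφα : ∀ r, r ≤ α → φ r = 0)
    (hβ : β < 1) (hφβ : ∀ r, β ≤ r → φ r = 0) (x : Pt m) :
    HasFDerivAt (radialCutoff φ) (-(φ ‖x‖ * ‖x‖⁻¹) • innerSL ℝ x) x := by
  -- The norm is not differentiable at 0, but the cutoff is constant on the ball of radius `α`.
  by_cases hx : x = 0
  · subst hx
    have h : radialCutoff φ =ᶠ[𝓝 (0 : Pt m)] fun _ => ∫ r in Set.Ioi (0 : ℝ), φ r := by
      filter_upwards [Metric.ball_mem_nhds (0 : Pt m) hα] with y hy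
      exact radialCutoff_eq hφ hφα hβ hφβ (mem_ball_zero_iff.1 hy).le
    refine ((hasFDerivAt_const _ _).congr_of_eventuallyEq h).congr_fderiv ?_
    simp
  · have hp : 0 < ‖x‖ := norm_pos_iff.2 hx
    have h1 : HasDerivAt (fun u : ℝ => ∫ r in u..1, φ r) (-φ ‖x‖) ‖x‖ :=
      intervalIntegral.integral_hasDerivAt_left (hφ.intervalIntegrable _ _)
        (hφ.stronglyMeasurableAtFilter _ _) hφ.continuousAt
    have h2 : HasFDerivAt (fun x : Pt m => ‖x‖) (‖x‖⁻¹ • innerSL ℝ x) x := by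
      have h3 := (hasStrictFDerivAt_norm_sq x).hasFDerivAt.sqrt (by positivity)
      have h4 : (fun y : Pt m => √(‖y‖ ^ 2)) = fun y => ‖y‖ :=
        funext fun y => Real.sqrt_sq (norm_nonneg y)
      rw [h4, Real.sqrt_sq hp.le] at h3
      refine h3.congr_fderiv ?_
      rw [← Nat.cast_smul_eq_nsmul ℝ, smul_smul]
      congr 1
      field_simp
      norm_num
    refine (h1.comp_hasFDerivAt x h2).congr_fderiv ?_
    rw [smul_smul, neg_mul]

end Cutoff

theorem continuousAt_cauchyReg_zero {c x : Pt m} (h : x ≠ c) : ContinuousAt (cauchyReg c 0) x := by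
  refine (hasFDerivAt_cauchyReg c 0 x ?_).continuousAt
  have := norm_pos_iff.2 (sub_ne_zero.2 h)
  positivity

theorem continuous_cauchyReg_mul (c : Pt m) {D : Pt m → Cl m} (hD : Continuous D)
    (h0 : D =ᶠ[𝓝 c] 0) : Continuous fun x => cauchyReg c 0 x * D x := by
  refine continuous_iff_continuousAt.2 fun x => ?_
  by_cases h : x = c
  · subst h
    have : (fun y => cauchyReg x 0 y * D y) =ᶠ[𝓝 x] fun _ => 0 := by
      filter_upwards [h0] with y hy
      rw [hy]; simp
    exact continuousAt_const.congr this.symm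
  · exact (continuousAt_cauchyReg_zero h).mul hD.continuousAt

section Cutoff

variable {φ : ℝ → ℝ} {α β : ℝ}

theorem contDiff_radialCutoff (hφ : Continuous φ) (hα : 0 < α) (hφα : ∀ r, r ≤ α → φ r = 0)
    (hβ : β < 1) (hφβ : ∀ r, β ≤ r → φ r = 0) :
    ContDiff ℝ 1 (radialCutoff φ : Pt m → ℝ) := by
  have h := hasFDerivAt_radialCutoff (m := m) hφ hα hφα hβ hφβ
  refine contDiff_one_iff_fderiv.2 ⟨fun x => (h x).differentiableAt, ?_⟩
  -- Where ‖x‖ ≤ α the factor `φ ‖x‖` vanishes, so ‖x‖ may be replaced by `max α ‖x‖`, whose inverse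
  -- is continuous everywhere.
  have h1 : fderiv ℝ (radialCutoff φ) =
      fun x : Pt m => -(φ ‖x‖ * (max α ‖x‖)⁻¹) • innerSL ℝ x := by
    ext1 x
    rw [(h x).fderiv]
    rcases le_total ‖x‖ α with hx | hx
    · rw [hφα _ hx]; simp
    · rw [max_eq_right hx]
  rw [h1]
  have h2 : Continuous fun x : Pt m => (max α ‖x‖)⁻¹ :=
    Continuous.inv₀ (by fun_prop) fun x => (hα.trans_le (le_max_left _ _)).ne'
  have h3 : Continuous fun x : Pt m => φ ‖x‖ := hφ.comp continuous_norm
  exact (h3.mul h2).neg.smul (innerSL ℝ).continuous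

theorem contDiff_radialCutoff_smul (hφ : Continuous φ) (hα : 0 < α)
    (hφα : ∀ r, r ≤ α → φ r = 0) (hβ : β < 1) (hφβ : ∀ r, β ≤ r → φ r = 0) {g : Pt m → Cl m}
    (hg : IsMonogenic g) : ContDiff ℝ 1 fun x => radialCutoff φ x • g x := by
  refine contDiff_iff_contDiffAt.2 fun x => ?_
  by_cases hx : x ∈ unitBall m
  · exact (contDiff_radialCutoff hφ hα hφα hβ hφβ).contDiffAt.smul
      (hg.1.contDiffAt (Metric.isOpen_ball.mem_nhds hx))
  · have hx' : β < ‖x‖ := by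
      rw [mem_ball_zero_iff, not_lt] at hx
      exact hβ.trans_le hx
    have : (fun x => radialCutoff φ x • g x) =ᶠ[𝓝 x] fun _ => 0 := by
      filter_upwards [continuous_norm.continuousAt.eventually (lt_mem_nhds hx')] with y hy
      rw [radialCutoff_eq_zero hβ hφβ (le_of_lt hy), zero_smul]
    exact contDiffAt_const.congr_of_eventuallyEq this

theorem hasCompactSupport_radialCutoff_smul (hβ : β < 1) (hφβ : ∀ r, β ≤ r → φ r = 0)
    (g : Pt m → Cl m) : HasCompactSupport fun x => radialCutoff φ x • g x := by
  refine HasCompactSupport.intro (isCompact_closedBall (0 : Pt m) β) fun x hx => ?_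
  rw [mem_closedBall_zero_iff, not_le] at hx
  rw [radialCutoff_eq_zero hβ hφβ hx.le, zero_smul]

/-- By the Leibniz rule only the derivative of the cutoff survives, since `g` is monogenic; it is
radial with density `φ`. -/
theorem dirac_radialCutoff_smul (hφ : Continuous φ) (hα : 0 < α)
    (hφα : ∀ r, r ≤ α → φ r = 0) (hβ : β < 1) (hφβ : ∀ r, β ≤ r → φ r = 0) {g : Pt m → Cl m}
    (hg : IsMonogenic g) (x : Pt m) :
    dirac (fun x => radialCutoff φ x • g x) x = -(φ ‖x‖ * ‖x‖⁻¹) • (toCl x * g x) := by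
  by_cases hx : x ∈ unitBall m
  · have h1 := hasFDerivAt_radialCutoff hφ hα hφα hβ hφβ x
    have h2 := ((hg.1.contDiffAt (Metric.isOpen_ball.mem_nhds hx)).differentiableAt
      one_ne_zero).hasFDerivAt
    have h3 : ∀ i : Fin (m + 1), inner ℝ x (EuclideanSpace.single i (1 : ℝ)) = x i := fun i => by
      rw [real_inner_comm, EuclideanSpace.inner_single_left]; simp
    rw [dirac, (h1.fun_smul h2).fderiv]
    simp only [add_apply, smul_apply, ContinuousLinearMap.smulRight_apply, innerSL_apply_apply, h3,
      mul_add, mul_smul_comm, Finset.sum_add_distrib, ← Finset.smul_sum, hg.2 x hx, smul_zero,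
      zero_add, smul_eq_mul, mul_smul]
    congr 2
    rw [toCl_eq_sum, Finset.sum_mul]
    simp only [smul_mul_assoc]
  · rw [mem_ball_zero_iff, not_lt] at hx
    have : (fun x => radialCutoff φ x • g x) =ᶠ[𝓝 x] fun _ => 0 := by
      filter_upwards [continuous_norm.continuousAt.eventually (lt_mem_nhds (hβ.trans_le hx))]
        with y hy
      rw [radialCutoff_eq_zero hβ hφβ (le_of_lt hy), zero_smul]
    rw [dirac, this.fderiv_eq, hφβ _ (hβ.le.trans hx)]
    simp

end Cutoff

/-- The Cauchy integral of `g` over the sphere of radius `r`. -/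
def cauchySphere (c : Pt m) (g : Pt m → Cl m) (r : ℝ) : Cl m :=
  r ^ m • ∫ η, cauchyReg c 0 (r • (η : Pt m)) * (toCl (η : Pt m) * g (r • (η : Pt m))) ∂surface m

/-- The Cauchy–Pompeiu formula for the cutoff times `g`, in polar coordinates: the derivative of the
cutoff turns `φ` into a weight on the Cauchy integrals over spheres. The condition on `φ` near ‖c‖
keeps the pole off the support. -/
theorem integral_smul_cauchySphere {c : Pt m} {g : Pt m → Cl m} (hg : IsMonogenic g)
    {φ : ℝ → ℝ} {α β : ℝ} (hφ : Continuous φ) (hα : 0 < α)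
    (hφα : ∀ r, r ≤ α → φ r = 0) (hβ : β < 1) (hφβ : ∀ r, β ≤ r → φ r = 0)
    (hc : ∀ᶠ r in 𝓝 ‖c‖, φ r = 0) :
    ∫ r, φ r • cauchySphere c g r = cauchyConst m • (radialCutoff φ c • g c) := by
  have hq := contDiff_radialCutoff_smul hφ hα hφα hβ hφβ hg
  have hqs := hasCompactSupport_radialCutoff_smul (m := m) hβ hφβ g
  have h0 : dirac (fun x => radialCutoff φ x • g x) =ᶠ[𝓝 c] 0 := by
    filter_upwards [continuous_norm.continuousAt.eventually hc] with x hx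
    rw [dirac_radialCutoff_smul hφ hα hφα hβ hφβ hg, hx]; simp
  have hint : Integrable fun x =>
      cauchyReg c 0 x * dirac (fun x => radialCutoff φ x • g x) x := by
    refine (continuous_cauchyReg_mul c (continuous_dirac hq) h0).integrable_of_hasCompactSupport
      ((hasCompactSupport_dirac hqs).mono fun x hx h => hx ?_)
    simp only [h, mul_zero]
  rw [cauchyConst_smul_eq c hq hqs h0, integral_polar hint, ← integral_neg,
    ← setIntegral_eq_integral_of_forall_compl_eq_zero (s := Set.Ioi 0)]
  · refine setIntegral_congr_fun measurableSet_Ioi fun r hr => ?_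
    have hr' : (0 : ℝ) < r := hr
    simp only [cauchySphere]
    rw [smul_comm, ← smul_neg]
    congr 1
    rw [← integral_smul, ← integral_neg]
    refine integral_congr_ae (Eventually.of_forall fun η => ?_)
    have hn : ‖r • (η : Pt m)‖ = r := by
      rw [norm_smul, norm_eq_of_mem_sphere, mul_one, Real.norm_of_nonneg hr'.le]
    simp only
    rw [dirac_radialCutoff_smul hφ hα hφα hβ hφβ hg, hn, toCl_smul, mul_smul_comm, smul_mul_assoc,
      mul_smul_comm, smul_smul, ← neg_smul]
    congr 1
    field_simp
  · intro r hr
    rw [hφα r ((not_lt.1 hr).trans hα.le), zero_smul]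

theorem continuousOn_integral_sphere {F : Type*} [NormedAddCommGroup F] [NormedSpace ℝ F]
    {s : Set ℝ} {H : ℝ → Metric.sphere (0 : Pt m) 1 → F}
    (hH : ContinuousOn (Function.uncurry H) (s ×ˢ Set.univ)) :
    ContinuousOn (fun r => ∫ η, H r η ∂surface m) s := by
  have : IsFiniteMeasure (surface m) := by unfold surface; infer_instance
  exact continuousOn_integral_of_compact_support (k := Set.univ) isCompact_univ hH
    fun p x _ hx => absurd (Set.mem_univ x) hx

theorem continuousOn_cauchySphere {c : Pt m} {g : Pt m → Cl m} {s : Set ℝ}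
    (hg : ContinuousOn g {x | ‖x‖ ∈ s}) (hs : ∀ r ∈ s, 0 < r) (hc : ‖c‖ ∉ s) :
    ContinuousOn (cauchySphere c g) s := by
  have hn : ∀ r ∈ s, ∀ η : Metric.sphere (0 : Pt m) 1, ‖r • (η : Pt m)‖ = r := fun r hr η => by
    rw [norm_smul, norm_eq_of_mem_sphere, mul_one, Real.norm_of_nonneg (hs r hr).le]
  refine (continuousOn_id.pow m).smul (continuousOn_integral_sphere ?_)
  have hmap : Continuous fun p : ℝ × Metric.sphere (0 : Pt m) 1 => p.1 • (p.2 : Pt m) := by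
    fun_prop
  refine ContinuousOn.mul ?_ (ContinuousOn.mul ?_ ?_)
  · rintro ⟨r, η⟩ ⟨hr, -⟩
    have h : r • (η : Pt m) ≠ c := fun h => hc (by rw [← h, hn r hr η]; exact hr)
    exact (ContinuousAt.comp (f := fun p : ℝ × Metric.sphere (0 : Pt m) 1 => p.1 • (p.2 : Pt m))
      (g := cauchyReg c 0) (x := (r, η)) (continuousAt_cauchyReg_zero h)
      hmap.continuousAt).continuousWithinAt
  · exact Continuous.continuousOn (by fun_prop)
  · refine hg.comp hmap.continuousOn ?_
    rintro ⟨r, η⟩ ⟨hr, -⟩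
    exact (congrArg (· ∈ s) (hn r hr η)).mpr hr

theorem exists_Icc_of_isCompact {K : Set ℝ} (hK : IsCompact K) {u v : ℝ} (huv : u < v)
    (h : K ⊆ Set.Ioo u v) : ∃ α β, u < α ∧ β < v ∧ ∀ r ∈ K, α < r ∧ r < β := by
  rcases K.eq_empty_or_nonempty with rfl | hne
  · exact ⟨(u + v) / 2, (u + v) / 2, by linarith, by linarith, fun r hr => absurd hr (by simp)⟩
  · obtain ⟨a, ha⟩ := hK.exists_isLeast hne
    obtain ⟨b, hb⟩ := hK.exists_isGreatest hne
    have h1 := h ha.1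
    have h2 := h hb.1
    refine ⟨(u + a) / 2, (b + v) / 2, by linarith [h1.1], by linarith [h2.2], fun r hr => ?_⟩
    have := ha.2 hr
    have := hb.2 hr
    constructor <;> linarith [h1.1, h2.2]

-- The averages of the Cauchy integrals against all smooth `φ` supported in (u, v) are known, so the
-- fundamental lemma of the calculus of variations determines them almost everywhere, and continuity
-- determines them everywhere. The two values reflect that the cutoff at `c` is ∫φ when `c` lies
-- inside the shell and 0 when it lies outside.
open Classical in
theorem cauchySphere_eq_of_mem_Ioo {c : Pt m} {g : Pt m → Cl m} (hg : IsMonogenic g) {u v : ℝ}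
    (hu : 0 ≤ u) (hv : v ≤ 1) (hc : ‖c‖ ≤ u ∨ v ≤ ‖c‖) {r : ℝ} (hr : r ∈ Set.Ioo u v) :
    cauchySphere c g r = if ‖c‖ ≤ u then cauchyConst m • g c else 0 := by
  have huv : u < v := hr.1.trans hr.2
  set k : Cl m := if ‖c‖ ≤ u then cauchyConst m • g c else 0 with hk
  have hcn : ‖c‖ ∉ Set.Ioo u v := fun h => hc.elim (fun h' => absurd h.1 (not_lt.2 h'))
    (fun h' => absurd h.2 (not_lt.2 h'))
  have hcont : ContinuousOn (cauchySphere c g) (Set.Ioo u v) := by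
    refine continuousOn_cauchySphere (hg.1.continuousOn.mono fun x hx => ?_)
      (fun r hr => hu.trans_lt hr.1) hcn
    exact mem_ball_zero_iff.2 (hx.2.trans_le hv)
  have hae : ∀ᵐ r ∂(volume : Measure ℝ), r ∈ Set.Ioo u v → cauchySphere c g r - k = 0 := by
    refine isOpen_Ioo.ae_eq_zero_of_integral_contDiff_smul_eq_zero
      ((hcont.sub continuousOn_const).locallyIntegrableOn measurableSet_Ioo) ?_
    intro φ hφ hφc hφs
    obtain ⟨α, β, hα, hβ, hαβ⟩ := exists_Icc_of_isCompact hφc huv hφs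
    have hφα : ∀ r, r ≤ α → φ r = 0 := fun r hr => by
      by_contra h
      exact absurd (hαβ r (subset_tsupport φ h)).1 (not_lt.2 hr)
    have hφβ : ∀ r, β ≤ r → φ r = 0 := fun r hr => by
      by_contra h
      exact absurd (hαβ r (subset_tsupport φ h)).2 (not_lt.2 hr)
    have hφc0 : ∀ᶠ r in 𝓝 ‖c‖, φ r = 0 :=
      notMem_tsupport_iff_eventuallyEq.1 fun h => hcn (hφs h)
    have h1 := integral_smul_cauchySphere hg hφ.continuous (hu.trans_lt hα) hφα
      (hβ.trans_le hv) hφβ hφc0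
    have hi1 : Integrable fun r => φ r • cauchySphere c g r := by
      refine Continuous.integrable_of_hasCompactSupport ?_
        (hφc.mono fun r hr h => hr (by simp [h]))
      refine continuous_iff_continuousAt.2 fun r => ?_
      by_cases hr : r ∈ tsupport φ
      · exact hφ.continuous.continuousAt.smul
          (hcont.continuousAt (isOpen_Ioo.mem_nhds (hφs hr)))
      · have : (fun r => φ r • cauchySphere c g r) =ᶠ[𝓝 r] fun _ => 0 := by
          filter_upwards [notMem_tsupport_iff_eventuallyEq.1 hr] with y hy
          rw [hy]; simp
        exact continuousAt_const.congr this.symm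
    have hi2 : Integrable fun r => φ r • k :=
      (hφ.continuous.integrable_of_hasCompactSupport hφc).smul_const k
    simp only [smul_sub]
    rw [integral_sub hi1 hi2, h1, integral_smul_const, hk]
    split_ifs with hcu
    · rw [radialCutoff_eq hφ.continuous hφα (hβ.trans_le hv) hφβ (hcu.trans hα.le),
        setIntegral_eq_integral_of_forall_compl_eq_zero, smul_comm, sub_self]
      intro r hr
      exact hφα r ((not_lt.1 hr).trans (hu.trans hα.le))
    · rw [radialCutoff_eq_zero (hβ.trans_le hv) hφβ (hβ.le.trans (hc.resolve_left hcu)), zero_smul,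
        smul_zero, smul_zero, sub_self]
  have hae' : cauchySphere c g =ᵐ[volume.restrict (Set.Ioo u v)] fun _ => k := by
    rw [EventuallyEq, ae_restrict_iff' measurableSet_Ioo]
    filter_upwards [hae] with r hr hr'
    exact sub_eq_zero.1 (hr hr')
  exact Measure.eqOn_open_of_ae_eq hae' isOpen_Ioo hcont continuousOn_const hr

/-- **Cauchy's integral formula** for a left monogenic function on a sphere around `0`. -/
theorem cauchySphere_eq {c : Pt m} {g : Pt m → Cl m} (hg : IsMonogenic g) {r : ℝ}
    (hcr : ‖c‖ < r) (hr : r < 1) : cauchySphere c g r = cauchyConst m • g c := by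
  rw [cauchySphere_eq_of_mem_Ioo hg (norm_nonneg c) le_rfl (Or.inl le_rfl) ⟨hcr, hr⟩,
    if_pos le_rfl]

/-- **Cauchy's theorem** for a left monogenic function on a sphere around `0`. -/
theorem cauchySphere_eq_zero {c : Pt m} {g : Pt m → Cl m} (hg : IsMonogenic g) {r : ℝ}
    (hr0 : 0 < r) (hr : r < 1) (hc : 1 ≤ ‖c‖) : cauchySphere c g r = 0 := by
  rw [cauchySphere_eq_of_mem_Ioo hg le_rfl le_rfl (Or.inr hc) ⟨hr0, hr⟩, if_neg]
  exact not_le.2 (zero_lt_one.trans_le hc)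

instance : IsFiniteMeasure (surface m) := by unfold surface; infer_instance
instance : (surface m).IsOpenPosMeasure := by unfold surface; infer_instance

/-- Positivity is all that is used of ω_m. It is never identified with the total mass of `surface`;
the quotient of the two is absorbed in `areaConst`. -/
theorem sphereArea_pos : 0 < sphereArea m := by
  unfold sphereArea
  have : 0 < Real.Gamma (((m : ℝ) + 1) / 2) := Real.Gamma_pos_of_pos (by positivity)
  have := Real.pi_pos
  positivity

/-! ### The Hilbert space structure of Clifford-valued functions on the sphere -/

/-- The normalized `L²` norm on the unit sphere. -/
def l2norm (F : Metric.sphere (0 : Pt m) 1 → Cl m) : ℝ :=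
  Real.sqrt ((sphereArea m)⁻¹ * ∫ η, ‖F η‖ ^ 2 ∂surface m)

theorem meanNorm_eq_l2norm (f : Pt m → Cl m) (r : ℝ) :
    meanNorm f r = l2norm fun η : Metric.sphere (0 : Pt m) 1 => f (r • (η : Pt m)) := rfl

theorem l2norm_nonneg (F : Metric.sphere (0 : Pt m) 1 → Cl m) : 0 ≤ l2norm F := Real.sqrt_nonneg _

theorem l2norm_sq (F : Metric.sphere (0 : Pt m) 1 → Cl m) :
    l2norm F ^ 2 = (sphereArea m)⁻¹ * ∫ η, ‖F η‖ ^ 2 ∂surface m :=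
  Real.sq_sqrt (mul_nonneg (inv_nonneg.2 sphereArea_pos.le)
    (integral_nonneg fun η => by positivity))

theorem l2norm_eq_norm_toLp {F : Metric.sphere (0 : Pt m) 1 → Cl m} (hF : MemLp F 2 (surface m)) :
    l2norm F = Real.sqrt (sphereArea m)⁻¹ * ‖hF.toLp F‖ := by
  rw [l2norm, Real.sqrt_mul (inv_nonneg.2 sphereArea_pos.le)]
  congr 1
  rw [Real.sqrt_eq_iff_mul_self_eq (integral_nonneg fun η => by positivity) (norm_nonneg _),
    ← real_inner_self_eq_norm_mul_norm, L2.inner_def]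
  refine integral_congr_ae ?_
  filter_upwards [hF.coeFn_toLp] with η hη
  rw [hη, real_inner_self_eq_norm_sq]

theorem l2norm_add_le {F G : Metric.sphere (0 : Pt m) 1 → Cl m} (hF : MemLp F 2 (surface m))
    (hG : MemLp G 2 (surface m)) : l2norm (fun η => F η + G η) ≤ l2norm F + l2norm G := by
  have h : l2norm (fun η => F η + G η) = l2norm (F + G) := rfl
  rw [h, l2norm_eq_norm_toLp hF, l2norm_eq_norm_toLp hG, l2norm_eq_norm_toLp (hF.add hG),
    MemLp.toLp_add, ← mul_add]
  gcongr
  exact norm_add_le _ _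

theorem l2norm_mul_le {F : Metric.sphere (0 : Pt m) 1 → Cl m} (hF : MemLp F 2 (surface m))
    (c : Cl m) : l2norm (fun η => F η * c) ≤ ‖(mulL : Cl m →L[ℝ] _)‖ * l2norm F * ‖c‖ := by
  refine (pow_le_pow_iff_left₀ (l2norm_nonneg _)
    (by have := l2norm_nonneg F; positivity) two_ne_zero).1 ?_
  rw [l2norm_sq, mul_pow, mul_pow, l2norm_sq]
  have h1 : ∫ η, ‖F η * c‖ ^ 2 ∂surface m ≤
      ∫ η, (‖(mulL : Cl m →L[ℝ] _)‖ * ‖c‖) ^ 2 * ‖F η‖ ^ 2 ∂surface m := by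
    refine integral_mono_of_nonneg (Eventually.of_forall fun η => by positivity)
      (hF.integrable_norm_pow two_ne_zero |>.const_mul _)
      (Eventually.of_forall fun η => ?_)
    dsimp only
    rw [← mul_pow]
    gcongr
    refine (norm_mul_le_mulL _ _).trans (le_of_eq (by ring))
  rw [integral_const_mul] at h1
  calc _ ≤ (sphereArea m)⁻¹ * ((‖(mulL : Cl m →L[ℝ] _)‖ * ‖c‖) ^ 2 * ∫ η, ‖F η‖ ^ 2 ∂surface m) := by
        have := sphereArea_pos (m := m)
        gcongr
    _ = _ := by ring

/-- The Clifford-valued pairing `ω_m⁻¹ ∫ conj(G) F dS`. -/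
def pairing (F G : Metric.sphere (0 : Pt m) 1 → Cl m) : Cl m :=
  (sphereArea m)⁻¹ • ∫ η, conj (G η) * F η ∂surface m

theorem hardyInner_eq_pairing (f g : Pt m → Cl m) :
    hardyInner f g = pairing (fun η : Metric.sphere (0 : Pt m) 1 => boundaryValue f η)
      (fun η : Metric.sphere (0 : Pt m) 1 => boundaryValue g η) := rfl

theorem memLp_of_continuous {F : Metric.sphere (0 : Pt m) 1 → Cl m} (hF : Continuous F) :
    MemLp F 2 (surface m) := by
  obtain ⟨C, hC⟩ := (isCompact_range hF).isBounded.exists_norm_le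
  exact MemLp.of_bound hF.aestronglyMeasurable C
    (Eventually.of_forall fun η => hC _ (Set.mem_range_self η))

theorem MemLp.mul_right_const {F : Metric.sphere (0 : Pt m) 1 → Cl m}
    (hF : MemLp F 2 (surface m)) (c : Cl m) : MemLp (fun η => F η * c) 2 (surface m) :=
  (mulRightL c).comp_memLp' hF

theorem integrable_conj_mul {F G : Metric.sphere (0 : Pt m) 1 → Cl m}
    (hF : MemLp F 2 (surface m)) (hG : MemLp G 2 (surface m)) :
    Integrable (fun η => conj (G η) * F η) (surface m) := by
  have h1 : Integrable (fun η => ‖G η‖ * ‖F η‖) (surface m) := hG.norm.integrable_mul hF.norm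
  refine (h1.const_mul ‖(mulL : Cl m →L[ℝ] _)‖).mono' ?_ (Eventually.of_forall fun η => ?_)
  · exact mulL.aestronglyMeasurable_comp₂
      (conjL.continuous.comp_aestronglyMeasurable hG.1) hF.1
  · refine (norm_mul_le_mulL _ _).trans (le_of_eq ?_)
    rw [norm_conj]; ring

/-- The components of the Clifford-valued pairing are real L² inner products, which makes the real
Cauchy–Schwarz inequality applicable. -/
theorem inner_pairing {F G : Metric.sphere (0 : Pt m) 1 → Cl m}
    (hF : MemLp F 2 (surface m)) (hG : MemLp G 2 (surface m)) (c : Cl m) :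
    inner ℝ c (pairing F G) = (sphereArea m)⁻¹ * ∫ η, inner ℝ (G η * c) (F η) ∂surface m := by
  rw [pairing, inner_smul_right, ← integral_inner (integrable_conj_mul hF hG)]
  congr 2
  ext1 η
  rw [inner_mul_left]

theorem abs_integral_inner_le {F G : Metric.sphere (0 : Pt m) 1 → Cl m}
    (hF : MemLp F 2 (surface m)) (hG : MemLp G 2 (surface m)) :
    |(sphereArea m)⁻¹ * ∫ η, inner ℝ (G η) (F η) ∂surface m| ≤ l2norm G * l2norm F := by
  have h := abs_real_inner_le_norm (hG.toLp G) (hF.toLp F)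
  have h2 : ∫ η, inner ℝ (G η) (F η) ∂surface m = inner ℝ (hG.toLp G) (hF.toLp F) := by
    rw [L2.inner_def]
    refine integral_congr_ae ?_
    filter_upwards [hF.coeFn_toLp, hG.coeFn_toLp] with η h1 h2
    rw [h1, h2]
  have hw := sphereArea_pos (m := m)
  rw [l2norm_eq_norm_toLp hF, l2norm_eq_norm_toLp hG, h2, abs_mul, abs_of_pos (inv_pos.2 hw)]
  calc (sphereArea m)⁻¹ * |inner ℝ (hG.toLp G) (hF.toLp F)|
      ≤ (sphereArea m)⁻¹ * (‖hG.toLp G‖ * ‖hF.toLp F‖) := by gcongr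
    _ = (√(sphereArea m)⁻¹ * √(sphereArea m)⁻¹) * (‖hG.toLp G‖ * ‖hF.toLp F‖) := by
      rw [Real.mul_self_sqrt (inv_nonneg.2 hw.le)]
    _ = _ := by ring

theorem norm_pairing_le {F G : Metric.sphere (0 : Pt m) 1 → Cl m}
    (hF : MemLp F 2 (surface m)) (hG : MemLp G 2 (surface m)) :
    ‖pairing F G‖ ≤ ‖(mulL : Cl m →L[ℝ] _)‖ * l2norm G * l2norm F := by
  by_cases h0 : ‖pairing F G‖ = 0
  · rw [h0]
    have := l2norm_nonneg G
    have := l2norm_nonneg F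
    positivity
  -- The component formula is tested with c equal to the pairing itself.
  have h1 : ‖pairing F G‖ * ‖pairing F G‖ ≤
      (‖(mulL : Cl m →L[ℝ] _)‖ * l2norm G * l2norm F) * ‖pairing F G‖ := by
    rw [← real_inner_self_eq_norm_mul_norm, inner_pairing hF hG]
    refine (le_abs_self _).trans ((abs_integral_inner_le hF (MemLp.mul_right_const hG _)).trans ?_)
    calc _ ≤ (‖(mulL : Cl m →L[ℝ] _)‖ * l2norm G * ‖pairing F G‖) * l2norm F :=
          mul_le_mul_of_nonneg_right (l2norm_mul_le hG _) (l2norm_nonneg F)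
      _ = _ := by ring
  exact le_of_mul_le_mul_right h1 (lt_of_le_of_ne (norm_nonneg _) (Ne.symm h0))

theorem pairing_mul_left (F G : Metric.sphere (0 : Pt m) 1 → Cl m)
    (hF : MemLp F 2 (surface m)) (hG : MemLp G 2 (surface m)) (c : Cl m) :
    pairing (fun η => F η * c) G = pairing F G * c := by
  rw [pairing, pairing, smul_mul_assoc]
  congr 1
  have := (mulRightL c).integral_comp_comm (integrable_conj_mul hF hG)
  simpa [mul_assoc] using this

theorem pairing_mul_right (F G : Metric.sphere (0 : Pt m) 1 → Cl m)
    (hF : MemLp F 2 (surface m)) (hG : MemLp G 2 (surface m)) (c : Cl m) :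
    pairing F (fun η => G η * c) = conj c * pairing F G := by
  rw [pairing, pairing, mul_smul_comm]
  congr 1
  have := (mulL (conj c)).integral_comp_comm (integrable_conj_mul hF hG)
  simpa [mul_assoc, conj_mul] using this

theorem conj_pairing (F G : Metric.sphere (0 : Pt m) 1 → Cl m)
    (hF : MemLp F 2 (surface m)) (hG : MemLp G 2 (surface m)) :
    conj (pairing F G) = pairing G F := by
  rw [pairing, pairing, conj_smul]
  congr 1
  have := conjL.integral_comp_comm (integrable_conj_mul hF hG)
  simpa [conj_mul] using this.symm

theorem pairing_add_left {F F' G : Metric.sphere (0 : Pt m) 1 → Cl m}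
    (hF : MemLp F 2 (surface m)) (hF' : MemLp F' 2 (surface m)) (hG : MemLp G 2 (surface m)) :
    pairing (fun η => F η + F' η) G = pairing F G + pairing F' G := by
  simp only [pairing, mul_add]
  rw [integral_add (integrable_conj_mul hF hG) (integrable_conj_mul hF' hG), smul_add]

theorem pairing_add_right {F G G' : Metric.sphere (0 : Pt m) 1 → Cl m}
    (hF : MemLp F 2 (surface m)) (hG : MemLp G 2 (surface m)) (hG' : MemLp G' 2 (surface m)) :
    pairing F (fun η => G η + G' η) = pairing F G + pairing F G' := by
  simp only [pairing, conj_add, add_mul]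
  rw [integral_add (integrable_conj_mul hF hG) (integrable_conj_mul hF hG'), smul_add]

theorem pairing_smul_left (r : ℝ) (F G : Metric.sphere (0 : Pt m) 1 → Cl m) :
    pairing (fun η => r • F η) G = r • pairing F G := by
  simp only [pairing, mul_smul_comm]
  rw [integral_smul, smul_comm]

theorem pairing_smul_right (r : ℝ) (F G : Metric.sphere (0 : Pt m) 1 → Cl m) :
    pairing F (fun η => r • G η) = r • pairing F G := by
  simp only [pairing, conj_smul, smul_mul_assoc]
  rw [integral_smul, smul_comm]

/-- Continuous functions on the closed unit ball with values in the Clifford algebra. -/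
abbrev BallC (m : ℕ) : Type := C(Metric.closedBall (0 : Pt m) 1, Cl m)

/-! ### Evaluation, boundary norm and boundary pairing on the closed ball -/

namespace BallC

open Classical in
/-- The function on `ℝ^{m+1}` given by `u` on the closed ball and by `0` outside. -/
def ev (u : BallC m) (x : Pt m) : Cl m :=
  if h : x ∈ Metric.closedBall (0 : Pt m) 1 then u ⟨x, h⟩ else 0

theorem ev_coe (u : BallC m) (x : Metric.closedBall (0 : Pt m) 1) : u.ev x = u x := by
  rw [ev, dif_pos x.2]

theorem ev_of_mem (u : BallC m) {x : Pt m} (h : x ∈ Metric.closedBall (0 : Pt m) 1) :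
    u.ev x = u ⟨x, h⟩ := by
  rw [ev, dif_pos h]

@[simp] theorem ev_add (u v : BallC m) (x : Pt m) : (u + v).ev x = u.ev x + v.ev x := by
  unfold ev; split_ifs <;> simp

@[simp] theorem ev_sub (u v : BallC m) (x : Pt m) : (u - v).ev x = u.ev x - v.ev x := by
  unfold ev; split_ifs <;> simp

@[simp] theorem ev_smul (r : ℝ) (u : BallC m) (x : Pt m) : (r • u).ev x = r • u.ev x := by
  unfold ev; split_ifs <;> simp

@[simp] theorem ev_zero (x : Pt m) : (0 : BallC m).ev x = 0 := by
  unfold ev; split_ifs <;> simp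

theorem ev_sum {ι : Type*} (s : Finset ι) (u : ι → BallC m) (x : Pt m) :
    (∑ i ∈ s, u i).ev x = ∑ i ∈ s, (u i).ev x := by
  classical
  induction s using Finset.induction_on with
  | empty => simp
  | insert a s ha ih => rw [Finset.sum_insert ha, Finset.sum_insert ha, ev_add, ih]

theorem norm_ev_le (u : BallC m) (x : Pt m) : ‖u.ev x‖ ≤ ‖u‖ := by
  unfold ev
  split_ifs with h
  · exact u.norm_coe_le_norm _
  · simp

theorem continuousOn_ev (u : BallC m) : ContinuousOn u.ev (Metric.closedBall 0 1) := by
  rw [continuousOn_iff_continuous_domRestrict]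
  exact u.continuous.congr fun x => (ev_coe u x).symm

/-- Right multiplication by a Clifford number. -/
def rmul (c : Cl m) : BallC m →L[ℝ] BallC m :=
  (mulRightL c).compLeftContinuous ℝ _

@[simp] theorem ev_rmul (c : Cl m) (u : BallC m) (x : Pt m) : (rmul c u).ev x = u.ev x * c := by
  unfold ev; split_ifs
  · rfl
  · simp

theorem sphere_mem (η : Metric.sphere (0 : Pt m) 1) : (η : Pt m) ∈ Metric.closedBall (0 : Pt m) 1 :=
  Metric.sphere_subset_closedBall η.2

theorem smul_sphere_mem {r : ℝ} (h0 : 0 ≤ r) (h1 : r ≤ 1) (η : Metric.sphere (0 : Pt m) 1) :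
    r • (η : Pt m) ∈ Metric.closedBall (0 : Pt m) 1 := by
  rw [mem_closedBall_zero_iff, norm_smul, norm_eq_of_mem_sphere, mul_one, Real.norm_of_nonneg h0]
  exact h1

theorem continuous_ev_sphere (u : BallC m) :
    Continuous fun η : Metric.sphere (0 : Pt m) 1 => u.ev η := by
  refine u.continuousOn_ev.comp_continuous continuous_subtype_val sphere_mem

theorem continuous_ev_smul_sphere (u : BallC m) {r : ℝ} (h0 : 0 ≤ r) (h1 : r ≤ 1) :
    Continuous fun η : Metric.sphere (0 : Pt m) 1 => u.ev (r • (η : Pt m)) :=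
  u.continuousOn_ev.comp_continuous (by fun_prop) (smul_sphere_mem h0 h1)

theorem memLp (u : BallC m) :
    MemLp (fun η : Metric.sphere (0 : Pt m) 1 => u.ev η) 2 (surface m) :=
  memLp_of_continuous u.continuous_ev_sphere

theorem eqOn_closedBall {u v : BallC m} (h : ∀ x ∈ unitBall m, u.ev x = v.ev x) :
    Set.EqOn u.ev v.ev (Metric.closedBall 0 1) :=
  Set.EqOn.of_subset_closure h u.continuousOn_ev v.continuousOn_ev Metric.ball_subset_closedBall
    (by rw [closure_ball _ one_ne_zero])

theorem ext_ball {u v : BallC m} (h : ∀ x ∈ unitBall m, u.ev x = v.ev x) : u = v := by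
  ext1 x
  rw [← ev_coe, ← ev_coe]
  exact eqOn_closedBall h x.2

/-- The boundary norm. -/
def bnorm (u : BallC m) : ℝ := l2norm fun η : Metric.sphere (0 : Pt m) 1 => u.ev η

/-- The boundary pairing. -/
def pair (u v : BallC m) : Cl m :=
  pairing (fun η : Metric.sphere (0 : Pt m) 1 => u.ev η) (fun η => v.ev η)

end BallC

theorem l2norm_le_of_bound {F : Metric.sphere (0 : Pt m) 1 → Cl m} {M : ℝ} (hM : 0 ≤ M)
    (h : ∀ η, ‖F η‖ ≤ M) :
    l2norm F ≤ Real.sqrt ((sphereArea m)⁻¹ * (surface m).real Set.univ) * M := by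
  have hw := sphereArea_pos (m := m)
  rw [l2norm, ← Real.sqrt_sq hM, ← Real.sqrt_mul (by positivity)]
  refine Real.sqrt_le_sqrt ?_
  rw [mul_assoc]
  gcongr
  have : ∫ η, ‖F η‖ ^ 2 ∂surface m ≤ ∫ _, M ^ 2 ∂surface m := by
    refine integral_mono_of_nonneg (Eventually.of_forall fun η => by positivity)
      (integrable_const _) (Eventually.of_forall fun η => ?_)
    have := h η
    dsimp only
    gcongr
  simpa using this

/-- The constant comparing the sup norm with the `L²` norm. -/
def areaConst (m : ℕ) : ℝ := Real.sqrt ((sphereArea m)⁻¹ * (surface m).real Set.univ)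

theorem areaConst_nonneg : 0 ≤ areaConst m := Real.sqrt_nonneg _

namespace BallC

theorem bnorm_eq_meanNorm (u : BallC m) : u.bnorm = meanNorm u.ev 1 := by
  rw [meanNorm_eq_l2norm, bnorm]; simp

theorem bnorm_nonneg (u : BallC m) : 0 ≤ u.bnorm := l2norm_nonneg _

theorem meanNorm_ev_le (u : BallC m) (r : ℝ) : meanNorm u.ev r ≤ areaConst m * ‖u‖ :=
  l2norm_le_of_bound (norm_nonneg u) fun _ => u.norm_ev_le _

theorem bnorm_le (u : BallC m) : u.bnorm ≤ areaConst m * ‖u‖ := by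
  rw [bnorm_eq_meanNorm]; exact u.meanNorm_ev_le 1

theorem bnorm_sq (u : BallC m) : u.bnorm ^ 2 =
    (sphereArea m)⁻¹ * ∫ η : Metric.sphere (0 : Pt m) 1, ‖u.ev η‖ ^ 2 ∂surface m := l2norm_sq _

theorem inner_one_pair_self (u : BallC m) : inner ℝ (1 : Cl m) (pair u u) = u.bnorm ^ 2 := by
  rw [pair, inner_pairing u.memLp u.memLp, bnorm_sq]
  simp only [mul_one, real_inner_self_eq_norm_sq]

theorem bnorm_add_le (u v : BallC m) : (u + v).bnorm ≤ u.bnorm + v.bnorm := by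
  simp only [bnorm, ev_add]
  exact l2norm_add_le u.memLp v.memLp

theorem pair_rmul_left (u v : BallC m) (c : Cl m) : pair (rmul c u) v = pair u v * c := by
  simp only [pair, ev_rmul]
  exact pairing_mul_left _ _ u.memLp v.memLp c

theorem pair_rmul_right (u v : BallC m) (c : Cl m) : pair u (rmul c v) = conj c * pair u v := by
  simp only [pair, ev_rmul]
  exact pairing_mul_right _ _ u.memLp v.memLp c

theorem conj_pair (u v : BallC m) : conj (pair u v) = pair v u :=
  conj_pairing _ _ u.memLp v.memLp

theorem norm_pair_le (u v : BallC m) :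
    ‖pair u v‖ ≤ ‖(mulL : Cl m →L[ℝ] _)‖ * v.bnorm * u.bnorm := norm_pairing_le u.memLp v.memLp

/-- The boundary pairing as a continuous bilinear map. -/
def pairL : BallC m →L[ℝ] BallC m →L[ℝ] Cl m :=
  LinearMap.mkContinuous₂
    (LinearMap.mk₂ ℝ pair
      (fun u u' v => by
        simp only [pair, ev_add]; exact pairing_add_left u.memLp u'.memLp v.memLp)
      (fun r u v => by simp only [pair, ev_smul]; exact pairing_smul_left r _ _)
      (fun u v v' => by
        simp only [pair, ev_add]; exact pairing_add_right u.memLp v.memLp v'.memLp)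
      (fun r u v => by simp only [pair, ev_smul]; exact pairing_smul_right r _ _))
    (‖(mulL : Cl m →L[ℝ] _)‖ * areaConst m * areaConst m) (fun u v => by
      have h1 := norm_pair_le u v
      have h2 := u.bnorm_le
      have h3 := v.bnorm_le
      have h4 := u.bnorm_nonneg
      have h5 := v.bnorm_nonneg
      have h6 := areaConst_nonneg (m := m)
      calc ‖pair u v‖ ≤ ‖(mulL : Cl m →L[ℝ] _)‖ * v.bnorm * u.bnorm := h1
        _ ≤ ‖(mulL : Cl m →L[ℝ] _)‖ * (areaConst m * ‖v‖) * (areaConst m * ‖u‖) := by gcongr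
        _ = _ := by ring)

theorem pairL_apply (u v : BallC m) : pairL u v = pair u v := rfl

theorem pair_sub_left (u u' v : BallC m) : pair (u - u') v = pair u v - pair u' v := by
  simp only [← pairL_apply, map_sub, sub_apply]

theorem pair_sub_right (u v v' : BallC m) : pair u (v - v') = pair u v - pair u v' := by
  simp only [← pairL_apply, map_sub]

theorem pair_sum_left {ι : Type*} (s : Finset ι) (u : ι → BallC m) (v : BallC m) :
    pair (∑ i ∈ s, u i) v = ∑ i ∈ s, pair (u i) v := by
  simp only [← pairL_apply, map_sum, sum_apply]

theorem pair_sum_right {ι : Type*} (s : Finset ι) (u : BallC m) (v : ι → BallC m) :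
    pair u (∑ i ∈ s, v i) = ∑ i ∈ s, pair u (v i) := by
  simp only [← pairL_apply, map_sum]

theorem pair_smul_left (r : ℝ) (u v : BallC m) : pair (r • u) v = r • pair u v := by
  simp only [← pairL_apply, map_smul, smul_apply]

theorem pair_smul_right (r : ℝ) (u v : BallC m) : pair u (r • v) = r • pair u v := by
  simp only [← pairL_apply, map_smul]

theorem pair_zero_left (v : BallC m) : pair 0 v = 0 := by
  simp only [← pairL_apply, map_zero, zero_apply]

/-! ### The Hardy norm of a continuous function on the closed ball -/

theorem bddAbove_meanNorm (u : BallC m) : BddAbove (meanNorm u.ev '' Set.Ioo 0 1) :=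
  ⟨areaConst m * ‖u‖, by rintro _ ⟨r, -, rfl⟩; exact u.meanNorm_ev_le r⟩

theorem continuousOn_meanNorm (u : BallC m) : ContinuousOn (meanNorm u.ev) (Set.Icc 0 1) := by
  unfold meanNorm
  refine ContinuousOn.sqrt (continuousOn_const.mul (continuousOn_integral_sphere ?_))
  refine ContinuousOn.pow (ContinuousOn.norm ?_) 2
  refine u.continuousOn_ev.comp (f := fun p : ℝ × Metric.sphere (0 : Pt m) 1 => p.1 • (p.2 : Pt m))
    (Continuous.continuousOn (by fun_prop)) ?_
  rintro ⟨r, η⟩ ⟨hr, -⟩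
  exact smul_sphere_mem hr.1 hr.2 η

/-- The spherical means are continuous up to radius 1, so the boundary norm is a limit of means over
smaller spheres. -/
theorem bnorm_le_hardyNorm (u : BallC m) : u.bnorm ≤ hardyNorm u.ev := by
  have h1 : Tendsto (meanNorm u.ev) (𝓝[Set.Ioo 0 1] 1) (𝓝 u.bnorm) := by
    rw [bnorm_eq_meanNorm]
    exact (u.continuousOn_meanNorm 1 (by simp)).mono_left
      (nhdsWithin_mono _ Set.Ioo_subset_Icc_self)
  have : (𝓝[Set.Ioo (0 : ℝ) 1] 1).NeBot := by
    rw [← mem_closure_iff_nhdsWithin_neBot, closure_Ioo zero_ne_one]; simp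
  refine le_of_tendsto h1 ?_
  filter_upwards [self_mem_nhdsWithin] with r hr
  exact le_csSup u.bddAbove_meanNorm ⟨r, hr, rfl⟩

end BallC

/-! ### Monogenic functions -/

theorem IsMonogenic.congr {f g : Pt m → Cl m} (hf : IsMonogenic f)
    (h : Set.EqOn f g (unitBall m)) : IsMonogenic g := by
  refine ⟨hf.1.congr fun x hx => (h hx).symm, fun x hx => ?_⟩
  have h1 : g =ᶠ[𝓝 x] f := by
    filter_upwards [Metric.isOpen_ball.mem_nhds hx] with y hy
    exact (h hy).symm
  rw [h1.fderiv_eq]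
  exact hf.2 x hx

theorem IsMonogenic.differentiableAt {f : Pt m → Cl m} (hf : IsMonogenic f) {x : Pt m}
    (hx : x ∈ unitBall m) : DifferentiableAt ℝ f x :=
  (hf.1.contDiffAt (Metric.isOpen_ball.mem_nhds hx)).differentiableAt one_ne_zero

theorem IsMonogenic.add {f g : Pt m → Cl m} (hf : IsMonogenic f) (hg : IsMonogenic g) :
    IsMonogenic fun x => f x + g x := by
  refine ⟨hf.1.add hg.1, fun x hx => ?_⟩
  rw [fderiv_fun_add (hf.differentiableAt hx) (hg.differentiableAt hx)]
  simp only [add_apply, mul_add, Finset.sum_add_distrib, hf.2 x hx, hg.2 x hx, add_zero]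

theorem IsMonogenic.mul_const {f : Pt m → Cl m} (hf : IsMonogenic f) (c : Cl m) :
    IsMonogenic fun x => f x * c := by
  refine ⟨(mulRightL c).contDiff.comp_contDiffOn hf.1, fun x hx => ?_⟩
  have h : HasFDerivAt (fun x => f x * c) ((mulRightL c) ∘L (fderiv ℝ f x)) x :=
    (mulRightL c).hasFDerivAt.comp x (hf.differentiableAt hx).hasFDerivAt
  rw [h.fderiv]
  simp only [ContinuousLinearMap.comp_apply, mulRightL_apply, ← mul_assoc]
  rw [← Finset.sum_mul, hf.2 x hx, zero_mul]

theorem isMonogenic_const (c : Cl m) : IsMonogenic fun _ => c :=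
  ⟨contDiffOn_const, fun x _ => by simp⟩

namespace BallC

/-- The continuous functions on the closed ball that are left monogenic inside. -/
def mono (m : ℕ) : Submodule ℝ (BallC m) where
  carrier := {u | IsMonogenic u.ev}
  zero_mem' := (isMonogenic_const 0).congr fun x _ => by simp
  add_mem' hu hv := (IsMonogenic.add hu hv).congr fun x _ => by simp
  smul_mem' r u hu := (IsMonogenic.mul_const hu (r • (1 : Cl m))).congr fun x _ => by simp

theorem rmul_mem_mono {u : BallC m} (hu : u ∈ mono m) (c : Cl m) : rmul c u ∈ mono m :=
  (IsMonogenic.mul_const hu c).congr fun x _ => by simp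

/-- Cauchy's formula is known for radii below 1; continuity on the closed ball carries it to the
unit sphere. -/
theorem eq_of_eq_on_Ioo {C : ℝ → Cl m} {a : ℝ} (ha : a < 1) {k : Cl m}
    (hC : ContinuousOn C (Set.Ioc a 1)) (h : ∀ r, a < r → r < 1 → C r = k) : C 1 = k := by
  have h1 : Set.EqOn C (fun _ => k) (Set.Ioc a 1) :=
    Set.EqOn.of_subset_closure (s := Set.Ioo a 1) (fun r hr => h r hr.1 hr.2) hC continuousOn_const
      Set.Ioo_subset_Ioc_self (by rw [closure_Ioo ha.ne]; exact Set.Ioc_subset_Icc_self)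
  exact h1 ⟨ha, le_rfl⟩

theorem cauchySphere_one {u : BallC m} (hu : u ∈ mono m) {c : Pt m} (hc : c ∈ unitBall m) :
    cauchySphere c u.ev 1 = cauchyConst m • u.ev c := by
  rw [mem_ball_zero_iff] at hc
  refine eq_of_eq_on_Ioo hc ?_ fun r h1 h2 => cauchySphere_eq hu h1 h2
  refine continuousOn_cauchySphere (u.continuousOn_ev.mono fun x hx => ?_)
    (fun r hr => (norm_nonneg c).trans_lt hr.1) (fun h => lt_irrefl _ h.1)
  exact mem_closedBall_zero_iff.2 hx.2

theorem cauchySphere_one_eq_zero {u : BallC m} (hu : u ∈ mono m) {c : Pt m} (hc : 1 < ‖c‖) :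
    cauchySphere c u.ev 1 = 0 := by
  refine eq_of_eq_on_Ioo zero_lt_one ?_ fun r h1 h2 => cauchySphere_eq_zero hu h1 h2 hc.le
  refine continuousOn_cauchySphere (u.continuousOn_ev.mono fun x hx => ?_)
    (fun r hr => hr.1) (fun h => absurd h.2 (not_le.2 hc))
  exact mem_closedBall_zero_iff.2 hx.2

end BallC

/-! ### The Szegő kernel and its reproducing property -/

theorem cauchySphere_one_def (c : Pt m) (g : Pt m → Cl m) : cauchySphere c g 1 =
    ∫ η : Metric.sphere (0 : Pt m) 1,
      ((‖(η : Pt m) - c‖ ^ (m + 1))⁻¹ • (1 - conj (toCl c) * toCl (η : Pt m))) * g η ∂surface m := by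
  rw [cauchySphere, one_pow, one_smul]
  refine integral_congr_ae (Eventually.of_forall fun η => ?_)
  dsimp only
  rw [one_smul, ← mul_assoc, cauchyReg_zero, smul_mul_assoc, toCl_sub, conj_sub, sub_mul,
    conj_toCl_mul_self, norm_eq_of_mem_sphere, one_pow, one_smul]

theorem one_sub_conj_mul {b : Pt m} (x : Pt m) (hb : b ≠ 0) :
    1 - conj (toCl b) * toCl x = conj (toCl b) * toCl ((‖b‖ ^ 2)⁻¹ • b - x) := by
  have : ‖b‖ ^ 2 ≠ 0 := by positivity
  rw [toCl_sub, mul_sub, toCl_smul, mul_smul_comm, conj_toCl_mul_self, smul_smul,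
    inv_mul_cancel₀ this, one_smul]

/-- On the sphere, 1 - conj(b)η = conj(η - b)η. Hence the Cauchy kernel times the normal is the
conjugate of S_b, and Cauchy's formula is the reproducing property. -/
theorem norm_one_sub_conj_mul_sphere (b : Pt m) (η : Metric.sphere (0 : Pt m) 1) :
    ‖1 - conj (toCl b) * toCl (η : Pt m)‖ = ‖(η : Pt m) - b‖ := by
  have h : 1 - conj (toCl b) * toCl (η : Pt m) = conj (toCl ((η : Pt m) - b)) * toCl (η : Pt m) := by
    rw [toCl_sub, conj_sub, sub_mul, conj_toCl_mul_self, norm_eq_of_mem_sphere, one_pow, one_smul]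
  rw [h, norm_conj_toCl_mul, norm_toCl, norm_eq_of_mem_sphere, mul_one]

theorem szego_sphere (b : Pt m) (η : Metric.sphere (0 : Pt m) 1) :
    szego b η = (‖(η : Pt m) - b‖ ^ (m + 1))⁻¹ • conj (1 - conj (toCl b) * toCl (η : Pt m)) := by
  rw [szego, norm_one_sub_conj_mul_sphere]

theorem one_sub_conj_mul_ne_zero {b x : Pt m} (hb : b ∈ unitBall m)
    (hx : x ∈ Metric.closedBall (0 : Pt m) 1) : ‖1 - conj (toCl b) * toCl x‖ ≠ 0 := by
  rw [mem_ball_zero_iff] at hb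
  rw [mem_closedBall_zero_iff] at hx
  intro h
  have h1 : conj (toCl b) * toCl x = 1 := (sub_eq_zero.1 (norm_eq_zero.1 h)).symm
  have h2 : ‖b‖ * ‖x‖ = 1 := by rw [← norm_toCl x, ← norm_conj_toCl_mul, h1, norm_one']
  nlinarith [norm_nonneg b, norm_nonneg x]

theorem continuousOn_szego {b : Pt m} (hb : b ∈ unitBall m) :
    ContinuousOn (szego b) (Metric.closedBall 0 1) := by
  have h1 : Continuous fun x : Pt m => ‖1 - conj (toCl b) * toCl x‖ ^ (m + 1) := by fun_prop
  have h2 : Continuous fun x : Pt m => conj (1 - conj (toCl b) * toCl x) := by fun_prop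
  exact (h1.continuousOn.inv₀ fun x hx => pow_ne_zero _ (one_sub_conj_mul_ne_zero hb hx)).smul
    h2.continuousOn

open Classical in
/-- The Szegő kernel at `b` as a continuous function on the closed ball. -/
def szegoC (b : Pt m) : BallC m :=
  if h : b ∈ unitBall m then
    ⟨fun x => szego b x, continuousOn_iff_continuous_domRestrict.1 (continuousOn_szego h)⟩ else 0

theorem ev_szegoC {b x : Pt m} (hb : b ∈ unitBall m) (hx : x ∈ Metric.closedBall (0 : Pt m) 1) :
    (szegoC b).ev x = szego b x := by
  rw [szegoC, dif_pos hb, BallC.ev_of_mem _ hx]; rfl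

/-- The reproducing property of the Szegő kernel. -/
theorem BallC.pair_szegoC {u : BallC m} (hu : u ∈ mono m) {c : Pt m} (hc : c ∈ unitBall m) :
    pair u (szegoC c) = ((sphereArea m)⁻¹ * cauchyConst m) • u.ev c := by
  rw [mul_smul, ← cauchySphere_one hu hc, cauchySphere_one_def, pair, pairing]
  congr 1
  refine integral_congr_ae (Eventually.of_forall fun η => ?_)
  dsimp only
  rw [ev_szegoC hc (sphere_mem η), szego_sphere, conj_smul, conj_conj]

theorem isMonogenic_cauchyReg {c : Pt m} (hc : c ∉ unitBall m) :
    IsMonogenic (cauchyReg c 0) := by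
  have hne : ∀ x ∈ unitBall m, 0 < ‖x - c‖ ^ 2 + (0 : ℝ) ^ 2 := fun x hx => by
    have : x - c ≠ 0 := sub_ne_zero.2 fun h => hc (h ▸ hx)
    have := norm_pos_iff.2 this
    positivity
  refine ⟨fun x hx => ?_, fun x hx => ?_⟩
  · have h1 : ContDiffAt ℝ 1 (fun x : Pt m => ‖x - c‖ ^ 2 + (0 : ℝ) ^ 2) x :=
      (((contDiff_norm_sq ℝ).comp (contDiff_id.sub contDiff_const)).add contDiff_const).contDiffAt
    have h2 : ContDiffAt ℝ 1 (fun x : Pt m => conj (toCl (x - c))) x :=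
      ((conjL ∘L toClL : Pt m →L[ℝ] Cl m).contDiff.comp
        (contDiff_id.sub contDiff_const)).contDiffAt
    exact ((h1.rpow_const_of_ne (hne x hx).ne').smul h2).contDiffWithinAt
  · rw [(hasFDerivAt_cauchyReg c 0 x (hne x hx)).fderiv, sum_mul_cauchyRegDeriv c 0 x (hne x hx)]
    simp [cauchyBump]

/-- Since 1 - conj(b)x = conj(b)(b/|b|² - x), S_b is a Cauchy kernel with pole at the inverse point
b/|b|², up to a constant on the right. For `b` in the ball this pole lies outside, so S_b is
monogenic. -/
theorem szego_eq_cauchyReg {b : Pt m} (hb : b ≠ 0) (x : Pt m) :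
    szego b x = cauchyReg ((‖b‖ ^ 2)⁻¹ • b) 0 x * (-(‖b‖ ^ (m + 1))⁻¹ • toCl b) := by
  rw [szego, one_sub_conj_mul x hb, norm_conj_toCl_mul, norm_toCl, conj_mul, conj_conj,
    cauchyReg_zero, ← norm_sub_rev x, ← neg_sub x, toCl_neg, conj_neg, smul_mul_smul_comm,
    neg_mul, mul_pow, mul_inv, mul_neg, smul_neg, neg_smul, mul_comm]

theorem norm_inversion {b : Pt m} : ‖(‖b‖ ^ 2)⁻¹ • b‖ = ‖b‖⁻¹ := by
  by_cases hb : b = 0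
  · simp [hb]
  · have : ‖b‖ ≠ 0 := norm_ne_zero_iff.2 hb
    rw [norm_smul, norm_inv, norm_pow, norm_norm]
    field_simp

theorem szego_zero (x : Pt m) : szego 0 x = 1 := by simp [szego]

theorem isMonogenic_szego {b : Pt m} (hb : b ∈ unitBall m) : IsMonogenic (szego b) := by
  by_cases h : b = 0
  · subst h
    exact (isMonogenic_const 1).congr fun x _ => (szego_zero x).symm
  · refine (IsMonogenic.mul_const (isMonogenic_cauchyReg (c := (‖b‖ ^ 2)⁻¹ • b) ?_)
      (-(‖b‖ ^ (m + 1))⁻¹ • toCl b)).congr fun x _ => (szego_eq_cauchyReg h x).symm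
    rw [mem_ball_zero_iff] at *
    rw [norm_inversion, not_lt]
    exact (one_le_inv₀ (norm_pos_iff.2 h)).2 hb.le

theorem szegoC_mem_mono {b : Pt m} (hb : b ∈ unitBall m) : szegoC b ∈ BallC.mono m :=
  (isMonogenic_szego hb).congr fun _ hx => (ev_szegoC hb (Metric.ball_subset_closedBall hx)).symm

/-- The Poisson kernel of the unit ball. -/
def poisson (x : Pt m) (η : Metric.sphere (0 : Pt m) 1) : ℝ :=
  (‖(η : Pt m) - x‖ ^ (m + 1))⁻¹ * (1 - ‖x‖ ^ 2)

/-! ### The Poisson formula and spherical means -/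

theorem norm_sub_sphere_ne_zero {c : Pt m} (hc : ‖c‖ ≠ 1) (η : Metric.sphere (0 : Pt m) 1) :
    ‖(η : Pt m) - c‖ ≠ 0 := by
  rw [norm_ne_zero_iff, sub_ne_zero]
  rintro rfl
  exact hc (norm_eq_of_mem_sphere η)

theorem continuous_inv_norm_sub {c : Pt m} (hc : ‖c‖ ≠ 1) :
    Continuous fun η : Metric.sphere (0 : Pt m) 1 => (‖(η : Pt m) - c‖ ^ (m + 1))⁻¹ := by
  have h : Continuous fun η : Metric.sphere (0 : Pt m) 1 => ‖(η : Pt m) - c‖ ^ (m + 1) := by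
    fun_prop
  exact h.inv₀ fun η => pow_ne_zero _ (norm_sub_sphere_ne_zero hc η)

theorem integrable_sphere {F : Type*} [NormedAddCommGroup F]
    {f : Metric.sphere (0 : Pt m) 1 → F} (hf : Continuous f) : Integrable f (surface m) :=
  hf.integrable_of_hasCompactSupport (HasCompactSupport.of_compactSpace f)

/-- The scalar Poisson kernel is the Cauchy kernel with pole x minus a multiple of the one with pole
at the inverse point: the Clifford-valued terms cancel. The second kernel integrates to 0 by
Cauchy's theorem. -/
theorem poisson_smul_eq {x : Pt m} (h0 : x ≠ 0) (η : Metric.sphere (0 : Pt m) 1) (v : Cl m) :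
    poisson x η • v =
      ((‖(η : Pt m) - x‖ ^ (m + 1))⁻¹ • (1 - conj (toCl x) * toCl (η : Pt m))) * v -
      (‖x‖ ^ 2 * (‖x‖ ^ (m + 1))⁻¹) • (((‖(η : Pt m) - (‖x‖ ^ 2)⁻¹ • x‖ ^ (m + 1))⁻¹ •
        (1 - conj (toCl ((‖x‖ ^ 2)⁻¹ • x)) * toCl (η : Pt m))) * v) := by
  have hx : ‖x‖ ≠ 0 := norm_ne_zero_iff.2 h0
  have h1 : ‖(η : Pt m) - x‖ = ‖x‖ * ‖(η : Pt m) - (‖x‖ ^ 2)⁻¹ • x‖ := by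
    rw [← norm_one_sub_conj_mul_sphere, one_sub_conj_mul _ h0, norm_conj_toCl_mul, norm_toCl,
      norm_sub_rev]
  have h2 : ‖x‖ ^ 2 * (‖x‖ ^ (m + 1))⁻¹ * (‖(η : Pt m) - (‖x‖ ^ 2)⁻¹ • x‖ ^ (m + 1))⁻¹ =
      ‖x‖ ^ 2 * (‖(η : Pt m) - x‖ ^ (m + 1))⁻¹ := by
    rw [h1, mul_pow, mul_inv]; ring
  rw [smul_mul_assoc, smul_mul_assoc, smul_smul, h2, toCl_smul, conj_smul, poisson]
  simp only [smul_mul_assoc, sub_mul, one_mul, smul_sub, smul_smul]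
  have h3 : ‖x‖ ^ 2 * (‖(η : Pt m) - x‖ ^ (m + 1))⁻¹ * (‖x‖ ^ 2)⁻¹ =
      (‖(η : Pt m) - x‖ ^ (m + 1))⁻¹ := by field_simp
  rw [h3, mul_sub, mul_one, sub_smul, mul_comm (‖x‖ ^ 2)]
  abel

namespace BallC

/-- The **Poisson formula** for left monogenic functions. -/
theorem integral_poisson_smul {u : BallC m} (hu : u ∈ mono m) {x : Pt m} (hx : x ∈ unitBall m) :
    ∫ η : Metric.sphere (0 : Pt m) 1, poisson x η • u.ev η ∂surface m =
      cauchyConst m • u.ev x := by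
  have h1 := cauchySphere_one hu hx
  rw [cauchySphere_one_def] at h1
  rw [mem_ball_zero_iff] at hx
  by_cases h0 : x = 0
  · subst h0
    rw [← h1]
    refine integral_congr_ae (Eventually.of_forall fun η => ?_)
    simp [poisson]
  · have hx0 : 0 < ‖x‖ := norm_pos_iff.2 h0
    have hx1 : 1 < ‖(‖x‖ ^ 2)⁻¹ • x‖ := by
      rw [norm_inversion]; exact (one_lt_inv₀ hx0).2 hx
    have h2 := cauchySphere_one_eq_zero hu hx1
    rw [cauchySphere_one_def] at h2
    have hc : ∀ c : Pt m, ‖c‖ ≠ 1 → Integrable (fun η : Metric.sphere (0 : Pt m) 1 =>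
        ((‖(η : Pt m) - c‖ ^ (m + 1))⁻¹ • (1 - conj (toCl c) * toCl (η : Pt m))) * u.ev η)
        (surface m) := fun c hc => by
      have h3 : Continuous fun η : Metric.sphere (0 : Pt m) 1 =>
        1 - conj (toCl c) * toCl (η : Pt m) := by fun_prop
      exact integrable_sphere (((continuous_inv_norm_sub hc).smul h3).mul u.continuous_ev_sphere)
    simp only [poisson_smul_eq h0]
    rw [integral_sub (hc x hx.ne) ((hc _ hx1.ne').fun_smul (‖x‖ ^ 2 * (‖x‖ ^ (m + 1))⁻¹)), h1, integral_smul, h2, smul_zero,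
      sub_zero]

end BallC

theorem poisson_pos {x : Pt m} (hx : x ∈ unitBall m) (η : Metric.sphere (0 : Pt m) 1) :
    0 < poisson x η := by
  rw [mem_ball_zero_iff] at hx
  have h1 : 0 < ‖(η : Pt m) - x‖ := lt_of_le_of_ne (norm_nonneg _)
    (norm_sub_sphere_ne_zero hx.ne η).symm
  have h2 : 0 < 1 - ‖x‖ ^ 2 := by nlinarith [norm_nonneg x]
  unfold poisson
  positivity

theorem continuous_poisson {x : Pt m} (hx : x ∈ unitBall m) : Continuous (poisson x) :=
  (continuous_inv_norm_sub (mem_ball_zero_iff.1 hx).ne).mul continuous_const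

theorem integral_poisson {x : Pt m} (hx : x ∈ unitBall m) :
    ∫ η, poisson x η ∂surface m = cauchyConst m := by
  have h1 : ContinuousMap.const _ (1 : Cl m) ∈ BallC.mono m := by
    refine (isMonogenic_const 1).congr fun y hy => ?_
    rw [BallC.ev_of_mem _ (Metric.ball_subset_closedBall hy)]; rfl
  have h2 := BallC.integral_poisson_smul h1 hx
  rw [BallC.ev_of_mem _ (Metric.ball_subset_closedBall hx), ContinuousMap.const_apply] at h2
  have h3 : ∀ η : Metric.sphere (0 : Pt m) 1,
      BallC.ev (ContinuousMap.const _ (1 : Cl m)) η = 1 := fun η => by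
    rw [BallC.ev_of_mem _ (BallC.sphere_mem η)]; rfl
  simp only [h3] at h2
  rw [integral_smul_const] at h2
  exact smul_left_injective ℝ (one_ne_zero (α := Cl m)) h2

theorem norm_smul_sphere_sub_comm {r : ℝ} (ζ η : Metric.sphere (0 : Pt m) 1) :
    ‖(η : Pt m) - r • (ζ : Pt m)‖ = ‖(ζ : Pt m) - r • (η : Pt m)‖ := by
  have h : ‖(η : Pt m) - r • (ζ : Pt m)‖ ^ 2 = ‖(ζ : Pt m) - r • (η : Pt m)‖ ^ 2 := by
    rw [norm_sub_sq_real, norm_sub_sq_real, norm_smul, norm_smul, norm_eq_of_mem_sphere,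
      norm_eq_of_mem_sphere, inner_smul_right, inner_smul_right, real_inner_comm]
  exact (pow_left_inj₀ (norm_nonneg _) (norm_nonneg _) two_ne_zero).1 h

theorem poisson_comm {r : ℝ} (ζ η : Metric.sphere (0 : Pt m) 1) :
    poisson (r • (ζ : Pt m)) η = poisson (r • (η : Pt m)) ζ := by
  rw [poisson, poisson, norm_smul_sphere_sub_comm, norm_smul, norm_smul, norm_eq_of_mem_sphere,
    norm_eq_of_mem_sphere]

theorem smul_sphere_mem_ball {r : ℝ} (h0 : 0 ≤ r) (h1 : r < 1) (η : Metric.sphere (0 : Pt m) 1) :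
    r • (η : Pt m) ∈ unitBall m := by
  rw [mem_ball_zero_iff, norm_smul, norm_eq_of_mem_sphere, mul_one, Real.norm_of_nonneg h0]
  exact h1

namespace BallC

/-- Jensen's inequality for the positive Poisson weight, obtained from the nonnegativity of the
weighted integral of (|u| - |u(x)|)². -/
theorem cauchyConst_mul_norm_sq_le {u : BallC m} (hu : u ∈ mono m) {x : Pt m}
    (hx : x ∈ unitBall m) :
    cauchyConst m * ‖u.ev x‖ ^ 2 ≤ ∫ η : Metric.sphere (0 : Pt m) 1,
      poisson x η * ‖u.ev η‖ ^ 2 ∂surface m := by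
  set A := ‖u.ev x‖ with hA
  have hP := continuous_poisson hx
  have hn : Continuous fun η : Metric.sphere (0 : Pt m) 1 => ‖u.ev η‖ := u.continuous_ev_sphere.norm
  have h1 : cauchyConst m * A ≤
      ∫ η : Metric.sphere (0 : Pt m) 1, poisson x η * ‖u.ev η‖ ∂surface m := by
    have := norm_integral_le_integral_norm (μ := surface m)
      (fun η : Metric.sphere (0 : Pt m) 1 => poisson x η • u.ev η)
    rw [integral_poisson_smul hu hx, norm_smul, Real.norm_of_nonneg cauchyConst_pos.le] at this
    simpa only [norm_smul, Real.norm_of_nonneg (poisson_pos hx _).le] using this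
  have h2 : 0 ≤ ∫ η : Metric.sphere (0 : Pt m) 1, poisson x η * (‖u.ev η‖ - A) ^ 2 ∂surface m :=
    integral_nonneg fun η => mul_nonneg (poisson_pos hx η).le (sq_nonneg _)
  have h3 : ∫ η : Metric.sphere (0 : Pt m) 1, poisson x η * (‖u.ev η‖ - A) ^ 2 ∂surface m =
      (∫ η : Metric.sphere (0 : Pt m) 1, poisson x η * ‖u.ev η‖ ^ 2 ∂surface m) -
      2 * A * (∫ η : Metric.sphere (0 : Pt m) 1, poisson x η * ‖u.ev η‖ ∂surface m) +
      A ^ 2 * cauchyConst m := by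
    rw [← integral_poisson hx, ← integral_const_mul, ← integral_const_mul,
      ← integral_sub (integrable_sphere (by fun_prop)) (integrable_sphere (by fun_prop)),
      ← integral_add (integrable_sphere (by fun_prop)) (integrable_sphere (by fun_prop))]
    congr 1
    ext1 η
    ring
  have hA0 : 0 ≤ A := norm_nonneg _
  nlinarith

theorem continuous_poisson_uncurry {r : ℝ} (h0 : 0 ≤ r) (h1 : r < 1) :
    Continuous fun p : Metric.sphere (0 : Pt m) 1 × Metric.sphere (0 : Pt m) 1 =>
      poisson (r • (p.1 : Pt m)) p.2 := by
  unfold poisson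
  have h : Continuous fun p : Metric.sphere (0 : Pt m) 1 × Metric.sphere (0 : Pt m) 1 =>
    ‖(p.2 : Pt m) - r • (p.1 : Pt m)‖ ^ (m + 1) := by fun_prop
  have h2 : Continuous fun p : Metric.sphere (0 : Pt m) 1 × Metric.sphere (0 : Pt m) 1 =>
    1 - ‖r • (p.1 : Pt m)‖ ^ 2 := by fun_prop
  exact (h.inv₀ fun p => pow_ne_zero _ (norm_sub_sphere_ne_zero
    (mem_ball_zero_iff.1 (smul_sphere_mem_ball h0 h1 p.1)).ne _)).mul h2

/-- The spherical means of a monogenic function are dominated by its boundary norm. -/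
theorem meanNorm_le_bnorm {u : BallC m} (hu : u ∈ mono m) {r : ℝ} (h0 : 0 ≤ r) (h1 : r < 1) :
    meanNorm u.ev r ≤ u.bnorm := by
  have hn : Continuous fun η : Metric.sphere (0 : Pt m) 1 => ‖u.ev η‖ := u.continuous_ev_sphere.norm
  have hκ := cauchyConst_pos (m := m)
  have hPc := continuous_poisson_uncurry (m := m) h0 h1
  have hPi : Integrable (Function.uncurry fun ζ η : Metric.sphere (0 : Pt m) 1 =>
      poisson (r • (ζ : Pt m)) η * ‖u.ev η‖ ^ 2) ((surface m).prod (surface m)) := by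
    refine Continuous.integrable_of_hasCompactSupport (f := Function.uncurry _) ?_
      (HasCompactSupport.of_compactSpace _)
    exact hPc.mul ((hn.comp continuous_snd).pow 2)
  have key : cauchyConst m * ∫ ζ : Metric.sphere (0 : Pt m) 1, ‖u.ev (r • (ζ : Pt m))‖ ^ 2 ∂surface m ≤
      cauchyConst m * ∫ η : Metric.sphere (0 : Pt m) 1, ‖u.ev η‖ ^ 2 ∂surface m := by
    calc _ = ∫ ζ : Metric.sphere (0 : Pt m) 1,
          cauchyConst m * ‖u.ev (r • (ζ : Pt m))‖ ^ 2 ∂surface m := (integral_const_mul _ _).symm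
      _ ≤ ∫ ζ : Metric.sphere (0 : Pt m) 1, ∫ η : Metric.sphere (0 : Pt m) 1,
          poisson (r • (ζ : Pt m)) η * ‖u.ev η‖ ^ 2 ∂surface m ∂surface m := by
        refine integral_mono_of_nonneg (Eventually.of_forall fun ζ => by positivity)
          hPi.integral_prod_left (Eventually.of_forall fun ζ => ?_)
        exact cauchyConst_mul_norm_sq_le hu (smul_sphere_mem_ball h0 h1 ζ)
      _ = ∫ η : Metric.sphere (0 : Pt m) 1, ∫ ζ : Metric.sphere (0 : Pt m) 1,
          poisson (r • (ζ : Pt m)) η * ‖u.ev η‖ ^ 2 ∂surface m ∂surface m :=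
        integral_integral_swap hPi
      _ = ∫ η : Metric.sphere (0 : Pt m) 1, cauchyConst m * ‖u.ev η‖ ^ 2 ∂surface m := by
        congr 1
        ext1 η
        rw [integral_mul_const]
        -- By symmetry of the kernel, the integral over the pole direction ζ becomes the total
        -- Poisson mass at rη.
        simp only [fun ζ => poisson_comm (r := r) ζ η]
        rw [integral_poisson (smul_sphere_mem_ball h0 h1 η)]
      _ = _ := integral_const_mul _ _
  have key2 := le_of_mul_le_mul_left key hκ
  have hw := sphereArea_pos (m := m)
  rw [bnorm, l2norm, meanNorm]
  refine Real.sqrt_le_sqrt ?_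
  gcongr

/-- The reproducing formula applied to S_b at its own parameter `b`. -/
theorem bnorm_szegoC_sq {b : Pt m} (hb : b ∈ unitBall m) :
    (szegoC b).bnorm ^ 2 = (sphereArea m)⁻¹ * cauchyConst m * ((1 - ‖b‖ ^ 2) ^ m)⁻¹ := by
  have h1 := pair_szegoC (szegoC_mem_mono hb) hb
  rw [← inner_one_pair_self, h1, ev_szegoC hb (Metric.ball_subset_closedBall hb), szego,
    conj_toCl_mul_self]
  rw [mem_ball_zero_iff] at hb
  have hp : 0 < 1 - ‖b‖ ^ 2 := by nlinarith [norm_nonneg b]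
  have h2 : (1 : Cl m) - ‖b‖ ^ 2 • (1 : Cl m) = (1 - ‖b‖ ^ 2) • (1 : Cl m) := by
    rw [sub_smul, one_smul]
  rw [h2, norm_smul, norm_one', mul_one, Real.norm_of_nonneg hp.le, conj_smul, conj_one, smul_smul,
    smul_smul, inner_smul_right, real_inner_self_eq_norm_sq, norm_one', one_pow, mul_one]
  field_simp
  ring

end BallC

/-! ### Smooth dependence of the Szegő kernel on its parameter -/

section Sqrt

variable {K : Type*} [TopologicalSpace K]

/-- The pointwise square root of a continuous function. -/
def sqrtC (u : C(K, ℝ)) : C(K, ℝ) := ⟨fun x => Real.sqrt (u x), by fun_prop⟩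

/-- The pointwise inverse of a positive continuous function. -/
def invC (u : C(K, ℝ)) (hu : ∀ x, 0 < u x) : C(K, ℝ) :=
  ⟨fun x => (u x)⁻¹, u.continuous.inv₀ fun x => (hu x).ne'⟩

theorem mul_invC (u : C(K, ℝ)) (hu : ∀ x, 0 < u x) : u * invC u hu = 1 := by
  ext x; exact mul_inv_cancel₀ (hu x).ne'

variable [CompactSpace K]

theorem isOpen_setOf_pos : IsOpen {u : C(K, ℝ) | ∀ x, 0 < u x} := by
  have := ContinuousMap.isOpen_setOfPred_mapsTo (X := K) (Y := ℝ) isCompact_univ (isOpen_Ioi (a := 0))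
  simpa [Set.MapsTo] using this

/-- The inverse function theorem for w ↦ w² in the Banach algebra of continuous functions: the
derivative at a positive w is multiplication by the invertible function 2w. -/
theorem contDiffAt_sqrtC {u : C(K, ℝ)} (hu : ∀ x, 0 < u x) {n : WithTop ℕ∞} (hn : n ≠ 0) :
    ContDiffAt ℝ n sqrtC u := by
  set w := sqrtC u with hw
  have hwpos : ∀ x, 0 < w x := fun x => Real.sqrt_pos.2 (hu x)
  have hwsq : w * w = u := by ext x; exact Real.mul_self_sqrt (hu x).le
  set f : C(K, ℝ) → C(K, ℝ) := fun w => w * w with hf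
  have hfc : ContDiffAt ℝ n f w := (contDiff_id.mul contDiff_id).contDiffAt
  have hw2 : ∀ x, 0 < ((2 : ℝ) • w) x := fun x => mul_pos two_pos (hwpos x)
  set f' : C(K, ℝ) ≃L[ℝ] C(K, ℝ) := ContinuousLinearEquiv.equivOfInverse
    (ContinuousLinearMap.mul ℝ C(K, ℝ) ((2 : ℝ) • w))
    (ContinuousLinearMap.mul ℝ C(K, ℝ) (invC _ hw2))
    (fun v => by
      simp only [ContinuousLinearMap.mul_apply']
      rw [← mul_assoc, mul_comm (invC _ hw2), mul_invC, one_mul])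
    (fun v => by
      simp only [ContinuousLinearMap.mul_apply']
      rw [← mul_assoc, mul_invC, one_mul]) with hf'
  have hfd : HasFDerivAt f (f' : C(K, ℝ) →L[ℝ] C(K, ℝ)) w := by
    refine ((hasFDerivAt_id w).mul (hasFDerivAt_id w)).congr_fderiv ?_
    ext v x
    simp [hf', two_mul]
  have h1 := hfc.to_localInverse hfd hn
  have hs : HasStrictFDerivAt f (f' : C(K, ℝ) →L[ℝ] C(K, ℝ)) w := hfc.hasStrictFDerivAt' hfd hn
  have hfw : f w = u := hwsq
  rw [hfw] at h1
  refine h1.congr_of_eventuallyEq ?_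
  have h2 := hs.eventually_right_inverse
  have h3 : ContinuousAt (hfc.localInverse hfd hn) u := h1.continuousAt
  have h4 : hfc.localInverse hfd hn u = w := by
    have := hs.localInverse_apply_image
    rw [hfw] at this
    exact this
  -- Positivity is an open condition on a compact space, so near `u` the local inverse is the
  -- positive square root.
  have h5 : ∀ᶠ y in 𝓝 u, ∀ x, 0 < hfc.localInverse hfd hn y x :=
    h3.eventually (by rw [h4]; exact isOpen_setOf_pos.mem_nhds hwpos)
  rw [hfw] at h2
  filter_upwards [h2, h5] with y hy hy'
  ext x
  have : (hfc.localInverse hfd hn y) x * (hfc.localInverse hfd hn y) x = y x :=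
    congrArg (fun v : C(K, ℝ) => v x) hy
  change Real.sqrt (y x) = _
  rw [← this, Real.sqrt_mul_self (hy' x).le]

end Sqrt

theorem inner_toCl (x y : Pt m) : inner ℝ (toCl x) (toCl y) = inner ℝ x y :=
  LinearIsometry.inner_map_map (⟨toClL.toLinearMap, norm_toCl⟩ : Pt m →ₗᵢ[ℝ] Cl m) x y

theorem norm_one_sub_conj_mul_sq (b x : Pt m) :
    ‖1 - conj (toCl b) * toCl x‖ ^ 2 = 1 - 2 * inner ℝ b x + ‖b‖ ^ 2 * ‖x‖ ^ 2 := by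
  rw [norm_sub_sq_real, norm_one', norm_conj_toCl_mul, norm_toCl, ← inner_mul_left, mul_one,
    inner_toCl]
  ring

namespace BallC

/-- Multiplication of a Clifford-valued function by a real-valued one. -/
def smulC : C(Metric.closedBall (0 : Pt m) 1, ℝ) →L[ℝ] BallC m →L[ℝ] BallC m :=
  LinearMap.mkContinuous₂
    (LinearMap.mk₂ ℝ (fun a u => (⟨fun x => a x • u x, by fun_prop⟩ : BallC m))
      (fun a a' u => by ext1 x; exact add_smul _ _ _)
      (fun r a u => by ext1 x; exact mul_smul _ _ _)
      (fun a u u' => by ext1 x; exact smul_add _ _ _)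
      (fun r a u => by ext1 x; exact smul_comm (a x) r (u x))) 1 (fun a u => by
        rw [ContinuousMap.norm_le _ (by positivity), one_mul]
        intro x
        refine (norm_smul_le _ _).trans ?_
        exact mul_le_mul (a.norm_coe_le_norm x) (u.norm_coe_le_norm x) (norm_nonneg _)
          (norm_nonneg _))

theorem smulC_apply (a : C(Metric.closedBall (0 : Pt m) 1, ℝ)) (u : BallC m)
    (x : Metric.closedBall (0 : Pt m) 1) : smulC a u x = a x • u x := rfl

end BallC

/-- The function `x ↦ ⟨b, x⟩` on the closed ball. -/
def innerC : Pt m →L[ℝ] C(Metric.closedBall (0 : Pt m) 1, ℝ) :=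
  LinearMap.toContinuousLinearMap
    { toFun := fun b => ⟨fun x => inner ℝ b (x : Pt m), by fun_prop⟩
      map_add' := fun b c => by ext x; exact inner_add_left b c (x : Pt m)
      map_smul' := fun r b => by ext x; exact real_inner_smul_left b (x : Pt m) r }

/-- The function `x ↦ conj(x) b` on the closed ball. -/
def conjMulC : Pt m →L[ℝ] BallC m :=
  LinearMap.toContinuousLinearMap
    { toFun := fun b => ⟨fun x => conj (toCl (x : Pt m)) * toCl b, by fun_prop⟩
      map_add' := fun b c => by ext1 x; simp [toCl_add, mul_add]
      map_smul' := fun r b => by ext1 x; simp [toCl_smul] }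

/-- The function `x ↦ |1 - conj(b) x|²` on the closed ball. -/
def denomC (b : Pt m) : C(Metric.closedBall (0 : Pt m) 1, ℝ) :=
  1 - (2 : ℝ) • innerC b + ‖b‖ ^ 2 • ⟨fun x => ‖(x : Pt m)‖ ^ 2, by fun_prop⟩

theorem denomC_apply (b : Pt m) (x : Metric.closedBall (0 : Pt m) 1) :
    denomC b x = ‖1 - conj (toCl b) * toCl (x : Pt m)‖ ^ 2 := by
  rw [norm_one_sub_conj_mul_sq]; rfl

theorem contDiff_denomC {n : WithTop ℕ∞} : ContDiff ℝ n (denomC (m := m)) := by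
  unfold denomC
  exact (contDiff_const.sub (innerC.contDiff.const_smul _)).add
    ((contDiff_norm_sq ℝ).smul contDiff_const)

theorem denomC_pos {b : Pt m} (hb : b ∈ unitBall m) (x : Metric.closedBall (0 : Pt m) 1) :
    0 < denomC b x := by
  have h := one_sub_conj_mul_ne_zero hb x.2
  rw [denomC_apply]
  positivity

/-- The Szegő kernel depends smoothly on its parameter, uniformly on the closed ball. -/
theorem contDiffAt_szegoC {b : Pt m} (hb : b ∈ unitBall m) {n : WithTop ℕ∞} (hn : n ≠ 0) :
    ContDiffAt ℝ n szegoC b := by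
  have hpos : ∀ b ∈ unitBall m, ∀ x, 0 < sqrtC (denomC b) x := fun b hb x =>
    Real.sqrt_pos.2 (denomC_pos hb x)
  have hunit : ∀ b (hb : b ∈ unitBall m), Ring.inverse (sqrtC (denomC b)) =
      invC (sqrtC (denomC b)) (hpos b hb) := fun b hb =>
    Ring.inverse_unit ⟨sqrtC (denomC b), invC _ (hpos b hb), mul_invC _ _,
      (mul_comm _ _).trans (mul_invC _ _)⟩
  -- `denomC` is quadratic in `b` with values in the continuous functions, so smoothness here is
  -- uniform in x.
  have h1 : ContDiffAt ℝ n (fun b : Pt m => sqrtC (denomC b)) b :=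
    (contDiffAt_sqrtC (denomC_pos hb) hn).comp b contDiff_denomC.contDiffAt
  have hu : IsUnit (sqrtC (denomC b)) := IsUnit.of_mul_eq_one _ (mul_invC _ (hpos b hb))
  have h2 : ContDiffAt ℝ n (fun b : Pt m => Ring.inverse (sqrtC (denomC b))) b := by
    obtain ⟨v, hv⟩ := hu
    have := contDiffAt_ringInverse (n := n) ℝ v
    rw [hv] at this
    exact this.comp b h1
  have h3 : ContDiffAt ℝ n (fun b : Pt m => (BallC.smulC (Ring.inverse (sqrtC (denomC b)) ^ (m + 1)))
      (ContinuousMap.const _ 1 - conjMulC b)) b := by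
    refine ContDiffAt.clm_apply ?_ ?_
    · have hs : ContDiff ℝ n (fun a => BallC.smulC (m := m) a) := by fun_prop
      exact hs.contDiffAt.comp b (h2.pow (m + 1))
    · exact (contDiff_const.sub conjMulC.contDiff).contDiffAt
  refine h3.congr_of_eventuallyEq ?_
  filter_upwards [Metric.isOpen_ball.mem_nhds hb] with c hc
  ext1 x
  rw [← BallC.ev_coe, ev_szegoC hc x.2, BallC.smulC_apply, hunit c hc, szego]
  congr 1
  · have : sqrtC (denomC c) x = ‖1 - conj (toCl c) * toCl (x : Pt m)‖ := by
      change Real.sqrt (denomC c x) = _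
      rw [denomC_apply, Real.sqrt_sq (norm_nonneg _)]
    change _ = ((sqrtC (denomC c) x)⁻¹) ^ (m + 1)
    rw [this, inv_pow]
  · rw [conj_sub, conj_one, Cl.conj_mul, conj_conj]; rfl

/-! ### Monogenic functions built from complex polynomials -/

/-- The complex coordinate `x₀ + i⟨s, x⟩`. -/
def complexCoord (s : Pt m) : Pt m →L[ℝ] ℂ :=
  (EuclideanSpace.proj (0 : Fin (m + 1))).smulRight (1 : ℂ) + (innerSL ℝ s).smulRight Complex.I

theorem complexCoord_apply (s x : Pt m) :
    complexCoord s x = (x 0 : ℂ) + ((inner ℝ s x : ℝ) : ℂ) * Complex.I := by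
  simp [complexCoord]

/-- The map `a + bi ↦ a + bs` of the complex numbers to the Clifford algebra. -/
def complexToCl (s : Pt m) : ℂ →L[ℝ] Cl m :=
  Complex.reCLM.smulRight (1 : Cl m) + Complex.imCLM.smulRight (toCl s)

theorem complexToCl_apply (s : Pt m) (z : ℂ) :
    complexToCl s z = z.re • (1 : Cl m) + z.im • toCl s := rfl

/-- A unit vector orthogonal to the axis `e₀`. -/
def IsImaginaryUnit (s : Pt m) : Prop := s 0 = 0 ∧ ‖s‖ = 1

theorem IsImaginaryUnit.conj {s : Pt m} (hs : IsImaginaryUnit s) : conj (toCl s) = -toCl s := by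
  rw [toCl_eq_sum, Fin.sum_univ_succ, hs.1, zero_smul, zero_add, conj_sum, ← Finset.sum_neg_distrib]
  exact Finset.sum_congr rfl fun i _ => by rw [conj_smul, conj_unitVec_succ, smul_neg]

theorem IsImaginaryUnit.mul_self {s : Pt m} (hs : IsImaginaryUnit s) :
    toCl s * toCl s = -1 := by
  have h := conj_toCl_mul_self s
  rw [hs.conj, hs.2, neg_mul, one_pow, one_smul] at h
  rw [← h, neg_neg]

/-- As s² = -1, the span of 1 and s is a copy of ℂ, in which nonzero elements are invertible. -/
theorem IsImaginaryUnit.map_mul {s : Pt m} (hs : IsImaginaryUnit s) (z w : ℂ) :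
    complexToCl s (z * w) = complexToCl s z * complexToCl s w := by
  simp only [complexToCl_apply, Complex.mul_re, Complex.mul_im, add_mul, mul_add, smul_mul_assoc,
    mul_smul_comm, one_mul, mul_one, hs.mul_self]
  module

theorem complexToCl_one (s : Pt m) : complexToCl s 1 = 1 := by simp [complexToCl_apply]

theorem IsImaginaryUnit.map_mul_inv {s : Pt m} (hs : IsImaginaryUnit s) {z : ℂ} (hz : z ≠ 0) :
    complexToCl s z * complexToCl s z⁻¹ = 1 := by
  rw [← hs.map_mul, mul_inv_cancel₀ hz, complexToCl_one]

theorem complexCoord_single (s : Pt m) (i : Fin (m + 1)) :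
    complexCoord s (EuclideanSpace.single i 1) =
      (if i = 0 then 1 else 0) + ((s i : ℝ) : ℂ) * Complex.I := by
  rw [complexCoord_apply, real_inner_comm, EuclideanSpace.inner_single_left]
  by_cases h : i = 0
  · subst h; simp
  · simp [h, Ne.symm h]

/-- The function `x ↦ q(x₀ + s⟨s, x⟩) v`. -/
def polyFn (s : Pt m) (q : Polynomial ℂ) (v : Cl m) (x : Pt m) : Cl m :=
  complexToCl s (q.eval (complexCoord s x)) * v

theorem hasFDerivAt_polyFn (s : Pt m) (q : Polynomial ℂ) (v : Cl m) (x : Pt m) :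
    HasFDerivAt (polyFn s q v) (mulRightL v ∘L complexToCl s ∘L
      (ContinuousLinearMap.mul ℝ ℂ (q.derivative.eval (complexCoord s x))) ∘L complexCoord s) x := by
  have h1 : HasFDerivAt (fun z : ℂ => q.eval z)
      (ContinuousLinearMap.mul ℝ ℂ (q.derivative.eval (complexCoord s x))) (complexCoord s x) := by
    refine ((q.hasDerivAt (complexCoord s x)).hasFDerivAt.restrictScalars ℝ).congr_fderiv ?_
    ext z
    simp [mul_comm]
  have h2 := h1.comp x (complexCoord s).hasFDerivAt
  have h3 := (mulRightL v ∘L complexToCl s).hasFDerivAt.comp x h2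
  exact h3

theorem contDiff_polyFn (s : Pt m) (q : Polynomial ℂ) (v : Cl m) {n : WithTop ℕ∞} :
    ContDiff ℝ n (polyFn s q v) := by
  have h1 : ContDiff ℝ n fun z : ℂ => q.eval z :=
    (q.differentiable.contDiff (n := n)).restrict_scalars ℝ
  exact (mulRightL v ∘L complexToCl s).contDiff.comp (h1.comp (complexCoord s).contDiff)

/-- The function depends on x₀ and ⟨s, x⟩ only. The derivative in x₀ contributes q', the others
contribute s·s·q' = -q'. -/
theorem isMonogenic_polyFn {s : Pt m} (hs : IsImaginaryUnit s) (q : Polynomial ℂ) (v : Cl m) :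
    IsMonogenic (polyFn s q v) := by
  refine ⟨(contDiff_polyFn s q v).contDiffOn, fun x _ => ?_⟩
  rw [(hasFDerivAt_polyFn s q v x).fderiv]
  set w := q.derivative.eval (complexCoord s x)
  have h1 : ∀ i : Fin (m + 1), (mulRightL v ∘L complexToCl s ∘L
      (ContinuousLinearMap.mul ℝ ℂ w) ∘L complexCoord s) (EuclideanSpace.single i 1) =
      ((if i = 0 then (1 : ℝ) else 0) • complexToCl s w +
        s i • (toCl s * complexToCl s w)) * v := fun i => by
    simp only [ContinuousLinearMap.comp_apply, ContinuousLinearMap.mul_apply', mulRightL_apply,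
      complexCoord_single, mul_add]
    have hI : complexToCl s Complex.I = toCl s := by simp [complexToCl_apply]
    have h2 : w * ((s i : ℂ) * Complex.I) = (s i : ℝ) • (Complex.I * w) := by
      rw [Complex.real_smul]; ring
    have h3 : w * (if i = 0 then (1 : ℂ) else 0) = (if i = 0 then (1 : ℝ) else 0) • w := by
      split_ifs <;> simp
    rw [h2, h3, map_add, map_smul, map_smul, hs.map_mul, hI]
  simp only [h1, ← mul_assoc]
  rw [← Finset.sum_mul]
  simp only [mul_add, mul_smul_comm, Finset.sum_add_distrib]
  have h4 : ∑ i : Fin (m + 1), (if i = 0 then (1 : ℝ) else 0) • (unitVec i * complexToCl s w) =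
      complexToCl s w := by
    rw [Finset.sum_eq_single 0] <;> simp +contextual
  have h5 : ∑ i : Fin (m + 1), s i • (unitVec i * (toCl s * complexToCl s w)) =
      -complexToCl s w := by
    simp only [← smul_mul_assoc]
    rw [← Finset.sum_mul, ← toCl_eq_sum, ← mul_assoc, hs.mul_self, neg_one_mul]
  rw [h4, h5, add_neg_cancel, zero_mul]

/-- The function `x ↦ q(x₀ + s⟨s, x⟩) v` on the closed ball. -/
def polyC (s : Pt m) (q : Polynomial ℂ) (v : Cl m) : BallC m :=
  ⟨fun x => polyFn s q v x, (contDiff_polyFn s q v (n := 0)).continuous.comp continuous_subtype_val⟩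

theorem ev_polyC (s : Pt m) (q : Polynomial ℂ) (v : Cl m) {x : Pt m}
    (hx : x ∈ Metric.closedBall (0 : Pt m) 1) : (polyC s q v).ev x = polyFn s q v x := by
  rw [BallC.ev_of_mem _ hx]; rfl

theorem polyC_mem_mono {s : Pt m} (hs : IsImaginaryUnit s) (q : Polynomial ℂ) (v : Cl m) :
    polyC s q v ∈ BallC.mono m :=
  (isMonogenic_polyFn hs q v).congr fun _ hx =>
    (ev_polyC s q v (Metric.ball_subset_closedBall hx)).symm

/-- The coordinate of y vanishes only if y₀ = 0 and s ⊥ y, so s has to avoid finitely many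
hyperplanes in the space x₀ = 0. This space is nonzero because m ≥ 1. -/
theorem exists_imaginaryUnit (hm : 1 ≤ m) {ι : Type*} [Finite ι] (y : ι → Pt m)
    (hy : ∀ i, y i ≠ 0) : ∃ s : Pt m, IsImaginaryUnit s ∧ ∀ i, complexCoord s (y i) ≠ 0 := by
  classical
  set e₁ : Pt m := EuclideanSpace.single (Fin.succ ⟨0, hm⟩) 1 with he
  -- A vector with y₀ ≠ 0 imposes no condition and is replaced by `e₁`; the index `none` ensures
  -- that the vector found is nonzero and can be normalized.
  set y' : Option ι → Pt m := fun o => o.elim e₁ fun i => if y i 0 = 0 then y i else e₁ with hy'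
  set p : Submodule ℝ (Pt m) :=
    LinearMap.ker (EuclideanSpace.proj (0 : Fin (m + 1)) : Pt m →L[ℝ] ℝ).toLinearMap
    with hp
  have hmem : ∀ t : Pt m, t ∈ p ↔ t 0 = 0 := fun t => Iff.rfl
  have he0 : e₁ 0 = 0 := by simp [he]
  have hen : e₁ ≠ 0 := by
    intro h
    have := congrArg norm h
    simp [he] at this
  have hyp : ∀ o, y' o ∈ p ∧ y' o ≠ 0 := by
    rintro (_ | i)
    · exact ⟨he0, hen⟩
    · simp only [hy', Option.elim_some]
      split_ifs with h
      · exact ⟨h, hy i⟩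
      · exact ⟨he0, hen⟩
  obtain ⟨t, htp, ht⟩ := Module.Dual.exists_forall_mem_ne_zero_of_forall_exists p
    (fun o => (innerSL ℝ (y' o)).toLinearMap) fun o => ⟨y' o, (hyp o).1, by
      change inner ℝ (y' o) (y' o) ≠ 0
      exact inner_self_ne_zero.2 (hyp o).2⟩
  have ht0 : t ≠ 0 := fun h => ht none (by rw [h, map_zero])
  have htn : ‖t‖ ≠ 0 := norm_ne_zero_iff.2 ht0
  refine ⟨‖t‖⁻¹ • t, ⟨?_, ?_⟩, fun i h => ?_⟩
  · have : t 0 = 0 := htp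
    simp [this]
  · rw [norm_smul, norm_inv, norm_norm, inv_mul_cancel₀ htn]
  · rw [complexCoord_apply] at h
    have hre := congrArg Complex.re h
    have him := congrArg Complex.im h
    simp only [Complex.add_re, Complex.add_im, Complex.ofReal_re, Complex.ofReal_im, Complex.mul_re,
      Complex.mul_im, Complex.I_re, Complex.I_im, mul_zero, mul_one, zero_add, add_zero, sub_zero,
      Complex.zero_re, Complex.zero_im, real_inner_smul_left] at hre him
    have h1 := ht (some i)
    simp only [hy', Option.elim_some, if_pos hre] at h1
    have h2 : inner ℝ t (y i) ≠ 0 := by rw [real_inner_comm]; exact h1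
    exact h2 ((mul_eq_zero.1 him).resolve_left (inv_ne_zero htn))

/-- The polynomial with a zero of order `N i` at `z i`, for every `i`. -/
def zeroPoly {ι : Type*} [Fintype ι] (z : ι → ℂ) (N : ι → ℕ) : Polynomial ℂ :=
  ∏ i, (Polynomial.X - Polynomial.C (z i)) ^ N i

theorem eval_zeroPoly {ι : Type*} [Fintype ι] (z : ι → ℂ) (N : ι → ℕ) (w : ℂ) :
    (zeroPoly z N).eval w = ∏ i, (w - z i) ^ N i := by
  simp [zeroPoly, Polynomial.eval_prod]

/-! ### Non-tangential boundary values -/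

/-- The cone-like approach region at `η` of aperture `α`. -/
def approachRegion (η : Pt m) (α : ℝ) : Set (Pt m) :=
  {x | x ∈ unitBall m ∧ ‖x - η‖ < α * (1 - ‖x‖)}

theorem approachRegion_mono (η : Pt m) {α β : ℝ} (h : α ≤ β) :
    approachRegion η α ⊆ approachRegion η β := fun _ hx =>
  ⟨hx.1, hx.2.trans_le (mul_le_mul_of_nonneg_right h
    (sub_nonneg.2 (mem_ball_zero_iff.1 hx.1).le))⟩

theorem tendsto_radial (η : Metric.sphere (0 : Pt m) 1) {α : ℝ} (hα : 1 < α) :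
    Tendsto (fun r : ℝ => r • (η : Pt m)) (𝓝[Set.Ioo 0 1] 1) (𝓝[approachRegion (η : Pt m) α] η) := by
  refine tendsto_nhdsWithin_iff.2 ⟨?_, ?_⟩
  · have h : Continuous fun r : ℝ => r • (η : Pt m) := by fun_prop
    have h1 := h.tendsto 1
    rw [one_smul] at h1
    exact h1.mono_left nhdsWithin_le_nhds
  · filter_upwards [self_mem_nhdsWithin] with r hr
    have hn : ‖r • (η : Pt m)‖ = r := by
      rw [norm_smul, norm_eq_of_mem_sphere, mul_one, Real.norm_of_nonneg hr.1.le]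
    refine ⟨mem_ball_zero_iff.2 (hn.trans_lt hr.2), ?_⟩
    have h2 : ‖r • (η : Pt m) - η‖ = 1 - r := by
      have h3 : r • (η : Pt m) - η = (r - 1) • (η : Pt m) := by rw [sub_smul, one_smul]
      rw [h3, norm_smul, norm_eq_of_mem_sphere, mul_one, Real.norm_eq_abs,
        abs_of_neg (by linarith [hr.2])]
      ring
    rw [h2, hn]
    nlinarith [hr.2]

instance : (𝓝[Set.Ioo (0 : ℝ) 1] 1).NeBot := by
  rw [nhdsWithin_Ioo_eq_nhdsLT one_pos]; infer_instance

theorem approachRegion_neBot (η : Metric.sphere (0 : Pt m) 1) {α : ℝ} (hα : 1 < α) :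
    (𝓝[approachRegion (η : Pt m) α] (η : Pt m)).NeBot := (tendsto_radial η hα).neBot

theorem HasNTLimit.unique {f : Pt m → Cl m} {η : Metric.sphere (0 : Pt m) 1} {L L' : Cl m}
    (h : HasNTLimit f η L) (h' : HasNTLimit f η L') : L = L' :=
  haveI : (𝓝[{x | x ∈ unitBall m ∧ ‖x - η‖ < 2 * (1 - ‖x‖)}] (η : Pt m)).NeBot :=
    approachRegion_neBot η one_lt_two
  tendsto_nhds_unique (h 2 one_lt_two) (h' 2 one_lt_two)

theorem HasNTLimit.boundaryValue_eq {f : Pt m → Cl m} {η : Metric.sphere (0 : Pt m) 1} {L : Cl m}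
    (h : HasNTLimit f η L) : boundaryValue f η = L := by
  have hex : ∃ L, HasNTLimit f η L := ⟨L, h⟩
  rw [boundaryValue, dif_pos hex]
  exact hex.choose_spec.unique h

theorem boundaryValue_of_eqOn {g : Pt m → Cl m} {u : BallC m}
    (h : ∀ x ∈ unitBall m, g x = u.ev x) (η : Metric.sphere (0 : Pt m) 1) :
    boundaryValue g η = u.ev η := by
  refine HasNTLimit.boundaryValue_eq fun α _ => ?_
  have h1 : Tendsto u.ev (𝓝[approachRegion (η : Pt m) α] η) (𝓝 (u.ev η)) :=
    (u.continuousOn_ev η (BallC.sphere_mem η)).mono_left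
      (nhdsWithin_mono _ fun x hx => Metric.ball_subset_closedBall hx.1)
  refine h1.congr' ?_
  filter_upwards [self_mem_nhdsWithin] with x hx
  exact (h x hx.1).symm

theorem hardyInner_of_eqOn_right (f : Pt m → Cl m) {g : Pt m → Cl m} {v : BallC m}
    (h : ∀ x ∈ unitBall m, g x = v.ev x) :
    hardyInner f g = pairing (fun η : Metric.sphere (0 : Pt m) 1 => boundaryValue f η)
      (fun η => v.ev η) := by
  rw [hardyInner_eq_pairing]
  congr 1
  funext η
  exact boundaryValue_of_eqOn h η

theorem hardyInner_of_eqOn {f g : Pt m → Cl m} {u v : BallC m}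
    (hf : ∀ x ∈ unitBall m, f x = u.ev x) (h : ∀ x ∈ unitBall m, g x = v.ev x) :
    hardyInner f g = BallC.pair u v := by
  rw [hardyInner_of_eqOn_right f h, BallC.pair]
  congr 1
  funext η
  exact boundaryValue_of_eqOn hf η

theorem meanNorm_congr {f g : Pt m → Cl m} (h : ∀ x ∈ unitBall m, f x = g x) {r : ℝ}
    (hr : r ∈ Set.Ioo (0 : ℝ) 1) : meanNorm f r = meanNorm g r := by
  rw [meanNorm_eq_l2norm, meanNorm_eq_l2norm]
  congr 1
  funext η
  refine h _ (mem_ball_zero_iff.2 ?_)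
  rw [norm_smul, norm_eq_of_mem_sphere, mul_one, Real.norm_of_nonneg hr.1.le]
  exact hr.2

theorem hardyNorm_congr {f g : Pt m → Cl m} (h : ∀ x ∈ unitBall m, f x = g x) :
    hardyNorm f = hardyNorm g := by
  rw [hardyNorm, hardyNorm, Set.image_congr fun r hr => meanNorm_congr h hr]

/-! ### Measurability and square integrability of boundary values -/

/-- For a fixed x, the η whose approach region and ball contain x form an open set. The condition is
therefore an intersection of closed implications, for an arbitrary `f`. -/
theorem isClosed_oscillation (f : Pt m → Cl m) (α δ ε : ℝ) :
    IsClosed {η : Pt m | ∀ x ∈ approachRegion η α ∩ Metric.ball η δ,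
      ∀ y ∈ approachRegion η α ∩ Metric.ball η δ, dist (f x) (f y) ≤ ε} := by
  simp only [Set.ofPred_forall]
  have hop : ∀ x : Pt m, IsOpen {η : Pt m | x ∈ approachRegion η α ∩ Metric.ball η δ} := by
    intro x
    have : {η : Pt m | x ∈ approachRegion η α ∩ Metric.ball η δ} =
        {η | x ∈ unitBall m} ∩ {η | ‖x - η‖ < α * (1 - ‖x‖)} ∩ {η | dist x η < δ} := by
      ext η; rfl
    rw [this]
    exact (isOpen_const.inter (isOpen_lt (by fun_prop) (by fun_prop))).inter
      (isOpen_lt (by fun_prop) (by fun_prop))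
  refine isClosed_iInter fun x => ?_
  have h1 : ∀ y, IsClosed {η : Pt m | x ∈ approachRegion η α ∩ Metric.ball η δ →
      y ∈ approachRegion η α ∩ Metric.ball η δ → dist (f x) (f y) ≤ ε} := fun y =>
    isClosed_imp (hop x) (isClosed_imp (hop y) isClosed_const)
  convert isClosed_iInter h1 using 1
  ext η
  simp only [Set.mem_iInter, Set.mem_ofPred_eq]
  tauto

/-- Cauchy's criterion with countably many apertures, radii and tolerances, so that the set of such
η is Borel. The apertures k + 2 exceed 1 and exhaust all α; nested regions force a common limit. -/
theorem exists_hasNTLimit_iff (f : Pt m → Cl m) (η : Metric.sphere (0 : Pt m) 1) :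
    (∃ L, HasNTLimit f η L) ↔ ∀ k j : ℕ, ∃ i : ℕ,
      ∀ x ∈ approachRegion (η : Pt m) (k + 2) ∩ Metric.ball (η : Pt m) (i + 1 : ℝ)⁻¹,
      ∀ y ∈ approachRegion (η : Pt m) (k + 2) ∩ Metric.ball (η : Pt m) (i + 1 : ℝ)⁻¹,
        dist (f x) (f y) ≤ (j + 1 : ℝ)⁻¹ := by
  have hk : ∀ k : ℕ, (1 : ℝ) < k + 2 := fun k => by have := k.cast_nonneg (α := ℝ); linarith
  constructor
  · rintro ⟨L, hL⟩ k j
    have hj : (0 : ℝ) < (j + 1 : ℝ)⁻¹ / 2 := by positivity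
    have h1 := (hL (k + 2) (hk k)).eventually (Metric.ball_mem_nhds L hj)
    obtain ⟨δ, hδ, h2⟩ := Metric.mem_nhdsWithin_iff.1 h1
    obtain ⟨i, hi⟩ := exists_nat_one_div_lt hδ
    rw [one_div] at hi
    have h3 : ∀ x ∈ approachRegion (η : Pt m) (k + 2) ∩ Metric.ball (η : Pt m) (i + 1 : ℝ)⁻¹,
        dist (f x) L < (j + 1 : ℝ)⁻¹ / 2 := fun x hx =>
      h2 ⟨Metric.ball_subset_ball hi.le hx.2, hx.1⟩
    exact ⟨i, fun x hx y hy => by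
      have := dist_triangle_right (f x) (f y) L
      linarith [h3 x hx, h3 y hy]⟩
  · intro h
    have h1 : ∀ k : ℕ, ∃ L, Tendsto f (𝓝[approachRegion (η : Pt m) (k + 2)] (η : Pt m)) (𝓝 L) := by
      intro k
      have := approachRegion_neBot η (hk k)
      refine cauchy_map_iff_exists_tendsto.1 (Metric.cauchy_iff.2 ⟨inferInstance, fun ε hε => ?_⟩)
      obtain ⟨j, hj⟩ := exists_nat_one_div_lt hε
      rw [one_div] at hj
      obtain ⟨i, hi⟩ := h k j
      refine ⟨f '' (approachRegion (η : Pt m) (k + 2) ∩ Metric.ball (η : Pt m) (i + 1 : ℝ)⁻¹),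
        image_mem_map (inter_mem_nhdsWithin _ (Metric.ball_mem_nhds _ (by positivity))), ?_⟩
      rintro _ ⟨x, hx, rfl⟩ _ ⟨y, hy, rfl⟩
      exact (hi x hx y hy).trans_lt hj
    choose L hL using h1
    have h2 : ∀ k, L k = L 0 := fun k => by
      have := approachRegion_neBot η (hk 0)
      refine tendsto_nhds_unique ((hL k).mono_left (nhdsWithin_mono _
        (approachRegion_mono _ ?_))) (hL 0)
      have := k.cast_nonneg (α := ℝ)
      push_cast; linarith
    refine ⟨L 0, fun α _ => ?_⟩
    obtain ⟨k, hk'⟩ := exists_nat_ge α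
    rw [← h2 k]
    exact (hL k).mono_left (nhdsWithin_mono _ (approachRegion_mono _ (by linarith)))

theorem measurableSet_exists_hasNTLimit (f : Pt m → Cl m) :
    MeasurableSet {η : Metric.sphere (0 : Pt m) 1 | ∃ L, HasNTLimit f η L} := by
  simp only [exists_hasNTLimit_iff, Set.ofPred_forall, Set.ofPred_exists]
  refine MeasurableSet.iInter fun k => MeasurableSet.iInter fun j => MeasurableSet.iUnion fun i => ?_
  have := ((isClosed_oscillation f (k + 2) (i + 1 : ℝ)⁻¹ (j + 1 : ℝ)⁻¹).preimage
    (continuous_subtype_val (p := fun x => x ∈ Metric.sphere (0 : Pt m) 1))).measurableSet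
  simp only [Set.ofPred_forall, Set.preimage_iInter] at this
  exact this

theorem HasNTLimit.tendsto_radial {f : Pt m → Cl m} {η : Metric.sphere (0 : Pt m) 1} {L : Cl m}
    (h : HasNTLimit f η L) : Tendsto (fun r : ℝ => f (r • (η : Pt m))) (𝓝[Set.Ioo 0 1] 1) (𝓝 L) :=
  (h 2 one_lt_two).comp (_root_.tendsto_radial η one_lt_two)

theorem continuous_smul_sphere {f : Pt m → Cl m} (hf : ContinuousOn f (unitBall m)) {r : ℝ}
    (hr : r ∈ Set.Ioo (0 : ℝ) 1) :
    Continuous fun η : Metric.sphere (0 : Pt m) 1 => f (r • (η : Pt m)) := by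
  refine hf.comp_continuous (by fun_prop) fun η => mem_ball_zero_iff.2 ?_
  rw [norm_smul, norm_eq_of_mem_sphere, mul_one, Real.norm_of_nonneg hr.1.le]
  exact hr.2

/-- The boundary values of a function in the Hardy space are square integrable. -/
theorem MemHardy.memLp_boundaryValue {f : Pt m → Cl m} (hf : MemHardy f) :
    MemLp (fun η : Metric.sphere (0 : Pt m) 1 => boundaryValue f η) 2 (surface m) := by
  obtain ⟨M, hM⟩ := hf.2
  have hc := hf.1.1.continuousOn
  -- Off `A` the boundary value is 0 by convention. So the cut-off dilates converge everywhere,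
  -- almost everywhere existence of non-tangential limits is not needed, and Fatou's lemma bounds
  -- the norm.
  set A := {η : Metric.sphere (0 : Pt m) 1 | ∃ L, HasNTLimit f η L} with hA
  have hAm : MeasurableSet A := measurableSet_exists_hasNTLimit f
  -- The second summand 1 makes already `r 0` = 1/2 positive.
  set r : ℕ → ℝ := fun k => 1 - 1 / ((k : ℝ) + 1 + 1) with hr
  have hrk : ∀ k, r k ∈ Set.Ioo (0 : ℝ) 1 := fun k => by
    have hk : (0 : ℝ) < (k : ℝ) + 1 + 1 := by positivity
    constructor
    · simp only [hr, sub_pos]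
      rw [div_lt_one hk]
      have := k.cast_nonneg (α := ℝ); linarith
    · simp only [hr, sub_lt_self_iff]; positivity
  have hr1 : Tendsto r atTop (𝓝[Set.Ioo 0 1] 1) := by
    refine tendsto_nhdsWithin_iff.2 ⟨?_, Eventually.of_forall hrk⟩
    have h1 := (tendsto_add_atTop_iff_nat 1).2 (tendsto_one_div_add_atTop_nhds_zero_nat (𝕜 := ℝ))
    have h2 := h1.const_sub 1
    rw [sub_zero] at h2
    refine h2.congr fun k => ?_
    simp [hr]
  set F : ℕ → Metric.sphere (0 : Pt m) 1 → Cl m := fun k =>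
    A.indicator fun η => f (r k • (η : Pt m)) with hF
  have hFm : ∀ k, AEStronglyMeasurable (F k) (surface m) := fun k =>
    (continuous_smul_sphere hc (hrk k)).aestronglyMeasurable.indicator hAm
  have hlim : ∀ η : Metric.sphere (0 : Pt m) 1,
      Tendsto (fun k => F k η) atTop (𝓝 (boundaryValue f η)) := by
    intro η
    by_cases hη : η ∈ A
    · obtain ⟨L, hL⟩ := hη
      rw [hL.boundaryValue_eq]
      refine (hL.tendsto_radial.comp hr1).congr fun k => ?_
      simp only [hF, Function.comp_apply]
      rw [Set.indicator_of_mem (show η ∈ A from ⟨L, hL⟩)]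
    · have h0 : boundaryValue f η = 0 := dif_neg hη
      rw [h0]
      refine tendsto_const_nhds.congr fun k => ?_
      simp only [hF]
      rw [Set.indicator_of_notMem hη]
  have hb : ∀ k, eLpNorm (F k) 2 (surface m) ≤
      ENNReal.ofReal ((Real.sqrt (sphereArea m)⁻¹)⁻¹ * M) := by
    intro k
    have hL : MemLp (fun η : Metric.sphere (0 : Pt m) 1 => f (r k • (η : Pt m))) 2 (surface m) :=
      memLp_of_continuous (continuous_smul_sphere hc (hrk k))
    refine (eLpNorm_indicator_le _).trans ?_
    rw [← ENNReal.ofReal_toReal hL.eLpNorm_ne_top]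
    refine ENNReal.ofReal_le_ofReal ?_
    rw [← Lp.norm_toLp _ hL]
    have h1 : l2norm (fun η : Metric.sphere (0 : Pt m) 1 => f (r k • (η : Pt m))) ≤ M :=
      hM ⟨r k, hrk k, rfl⟩
    rw [l2norm_eq_norm_toLp hL] at h1
    have hs : 0 < Real.sqrt (sphereArea m)⁻¹ := Real.sqrt_pos.2 (inv_pos.2 sphereArea_pos)
    rw [le_inv_mul_iff₀ hs]
    exact h1
  refine ⟨aestronglyMeasurable_of_tendsto_ae atTop hFm (Eventually.of_forall hlim), ?_⟩
  refine (Lp.eLpNorm_lim_le_liminf_eLpNorm hFm _ (Eventually.of_forall hlim)).trans_lt ?_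
  refine lt_of_le_of_lt (liminf_le_liminf (Eventually.of_forall hb)) ?_
  rw [liminf_const]
  exact ENNReal.ofReal_lt_top

/-! ### Uniform limits of monogenic functions -/

/-- The constant in the reproducing formula of the Szegő kernel. -/
def szegoConst (m : ℕ) : ℝ := (sphereArea m)⁻¹ * cauchyConst m

theorem szegoConst_pos : 0 < szegoConst m := mul_pos (inv_pos.2 sphereArea_pos) cauchyConst_pos

namespace BallC

/-- The uniform limits of monogenic functions. -/
def monoC (m : ℕ) : Submodule ℝ (BallC m) := (mono m).topologicalClosure

theorem mono_le_monoC : mono m ≤ monoC m := Submodule.le_topologicalClosure _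

theorem isClosed_monoC : IsClosed (monoC m : Set (BallC m)) :=
  Submodule.isClosed_topologicalClosure _

/-- Only closed conditions, such as the reproducing formula and the bound on spherical means, are
transferred to the closure. That uniform limits are again monogenic is not needed. -/
theorem monoC_induction {s : Set (BallC m)} (hs : IsClosed s) (h : ∀ u ∈ mono m, u ∈ s)
    {u : BallC m} (hu : u ∈ monoC m) : u ∈ s :=
  closure_minimal h hs hu

theorem rmul_mem_monoC {u : BallC m} (hu : u ∈ monoC m) (c : Cl m) : rmul c u ∈ monoC m :=
  map_mem_closure (rmul c).continuous hu fun _ hv => rmul_mem_mono hv c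

theorem continuous_ev_apply (x : Pt m) : Continuous fun u : BallC m => u.ev x := by
  by_cases hx : x ∈ Metric.closedBall (0 : Pt m) 1
  · simp only [ev_of_mem _ hx]
    exact continuous_eval_const _
  · simp only [ev, dif_neg hx]
    exact continuous_const

theorem meanNorm_ev_add_le (u v : BallC m) {r : ℝ} (h0 : 0 ≤ r) (h1 : r ≤ 1) :
    meanNorm (u + v).ev r ≤ meanNorm u.ev r + meanNorm v.ev r := by
  simp only [meanNorm_eq_l2norm, ev_add]
  exact l2norm_add_le (memLp_of_continuous (u.continuous_ev_smul_sphere h0 h1))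
    (memLp_of_continuous (v.continuous_ev_smul_sphere h0 h1))

theorem continuous_meanNorm_ev {r : ℝ} (h0 : 0 ≤ r) (h1 : r ≤ 1) :
    Continuous fun u : BallC m => meanNorm u.ev r := by
  refine (LipschitzWith.of_le_add_mul (areaConst m).toNNReal fun u v => ?_).continuous
  rw [Real.coe_toNNReal _ areaConst_nonneg, dist_eq_norm]
  have h := meanNorm_ev_add_le v (u - v) h0 h1
  rw [add_sub_cancel] at h
  linarith [meanNorm_ev_le (u - v) r]

theorem continuous_bnorm : Continuous (bnorm : BallC m → ℝ) := by
  simp only [funext bnorm_eq_meanNorm]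
  exact continuous_meanNorm_ev zero_le_one le_rfl

theorem pair_szegoC_of_mem_monoC {u : BallC m} (hu : u ∈ monoC m) {c : Pt m}
    (hc : c ∈ unitBall m) : pair u (szegoC c) = szegoConst m • u.ev c := by
  have h1 : Continuous fun u : BallC m => pair u (szegoC c) := (pairL.flip (szegoC c)).continuous
  have h2 : Continuous fun u : BallC m => szegoConst m • u.ev c :=
    (continuous_const_smul (szegoConst m)).comp (continuous_ev_apply c)
  have h3 : ∀ v ∈ mono m, v ∈ {u : BallC m | pair u (szegoC c) = szegoConst m • u.ev c} :=
    fun v hv => by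
      rw [Set.mem_ofPred_eq, szegoConst]
      exact pair_szegoC hv hc
  exact monoC_induction (isClosed_eq h1 h2) h3 hu

theorem hardyNorm_eq_bnorm_of_mem_monoC {u : BallC m} (hu : u ∈ monoC m) :
    hardyNorm u.ev = u.bnorm := by
  refine le_antisymm (csSup_le ((Set.nonempty_Ioo.2 one_pos).image _) ?_) u.bnorm_le_hardyNorm
  rintro _ ⟨r, hr, rfl⟩
  exact monoC_induction (s := {u | meanNorm u.ev r ≤ u.bnorm})
    (isClosed_le (continuous_meanNorm_ev hr.1.le hr.2.le) continuous_bnorm)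
    (fun v hv => meanNorm_le_bnorm hv hr.1.le hr.2) hu

/-- The reproducing formula recovers the interior values from the boundary pairing. -/
theorem eq_zero_of_mem_monoC {u : BallC m} (hu : u ∈ monoC m) (h : u.bnorm = 0) : u = 0 := by
  refine ext_ball fun x hx => ?_
  have h1 := pair_szegoC_of_mem_monoC hu hx
  have h2 := norm_pair_le u (szegoC x)
  rw [h, mul_zero] at h2
  rw [norm_le_zero_iff.1 h2] at h1
  rw [ev_zero]
  exact (smul_eq_zero_iff_right szegoConst_pos.ne').1 h1.symm

theorem bnorm_sq_eq_zero_of_pair {u : BallC m} (h : pair u u = 0) : u.bnorm = 0 := by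
  have := inner_one_pair_self u
  rw [h, inner_zero_right] at this
  exact pow_eq_zero_iff two_ne_zero |>.1 this.symm

theorem eq_zero_of_pair_self {u : BallC m} (hu : u ∈ monoC m) (h : pair u u = 0) : u = 0 :=
  eq_zero_of_mem_monoC hu (bnorm_sq_eq_zero_of_pair h)

theorem hardyNorm_congr_ev {f : Pt m → Cl m} {u : BallC m} (hu : u ∈ monoC m)
    (h : ∀ x ∈ unitBall m, f x = u.ev x) : hardyNorm f = u.bnorm := by
  rw [hardyNorm_congr h, hardyNorm_eq_bnorm_of_mem_monoC hu]

/-! ### Orthogonal projections -/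

/-- ⟨β, β⟩ may be a zero divisor; a linear inverse on the range of its left multiplication suffices
for projections and keeps them linear. -/
theorem exists_genInverse (G : Cl m) :
    ∃ R : Cl m →ₗ[ℝ] Cl m, ∀ w ∈ LinearMap.range (mulL G).toLinearMap, G * R w = w := by
  set T := (mulL G).toLinearMap with hT
  obtain ⟨g, hg⟩ := T.rangeRestrict.exists_rightInverse_of_surjective T.range_rangeRestrict
  obtain ⟨R, hR⟩ := LinearMap.exists_extend g
  refine ⟨R, fun w hw => ?_⟩
  have h1 : R w = g ⟨w, hw⟩ := by rw [← hR]; rfl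
  have h2 := LinearMap.congr_fun hg ⟨w, hw⟩
  rw [h1]
  exact congrArg Subtype.val h2

/-- A linear generalized inverse of the left multiplication by `G`. -/
def genInverse (G : Cl m) : Cl m →L[ℝ] Cl m :=
  LinearMap.toContinuousLinearMap (exists_genInverse G).choose

theorem mul_genInverse {G w : Cl m} (hw : w ∈ LinearMap.range (mulL G).toLinearMap) :
    G * genInverse G w = w := (exists_genInverse G).choose_spec w hw

/-- Left multiplication by ⟨β, β⟩ is self-adjoint, so its range is the orthogonal complement of its
kernel. For v in the kernel βv has norm 0, hence βv = 0, and v is orthogonal to every ⟨u, β⟩. -/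
theorem pair_mem_range {β : BallC m} (hβ : β ∈ monoC m) (u : BallC m) :
    pair u β ∈ LinearMap.range (mulL (pair β β)).toLinearMap := by
  set p := LinearMap.range (mulL (pair β β)).toLinearMap
  rw [← Submodule.orthogonal_orthogonal p]
  intro v hv
  have h1 : pair β β * v = 0 := by
    refine ext_inner_left ℝ fun y => ?_
    rw [inner_zero_right, ← conj_pair, ← inner_mul_left]
    exact hv _ ⟨y, rfl⟩
  have h2 : rmul v β = 0 := by
    refine eq_zero_of_pair_self (rmul_mem_monoC hβ v) ?_
    rw [pair_rmul_left, pair_rmul_right, mul_assoc, h1, mul_zero]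
  have h3 : conj v * pair u β = 0 := by
    rw [← pair_rmul_right, h2, ← pairL_apply, map_zero]
  have h4 : inner ℝ (v * 1) (pair u β) = 0 := by
    rw [inner_mul_left, h3, inner_zero_right]
  rwa [mul_one] at h4

/-- The coefficient of the orthogonal projection onto the span of `β`. -/
def projCoeff (β : BallC m) : BallC m →L[ℝ] Cl m := genInverse (pair β β) ∘L pairL.flip β

theorem projCoeff_apply (β u : BallC m) :
    projCoeff β u = genInverse (pair β β) (pair u β) := rfl

/-- Right multiplication of a fixed function by a variable constant. -/
def rmulL (β : BallC m) : Cl m →L[ℝ] BallC m :=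
  LinearMap.toContinuousLinearMap
    { toFun := fun c => rmul c β
      map_add' := fun c d => ext_ball fun x _ => by simp [mul_add]
      map_smul' := fun r c => ext_ball fun x _ => by simp }

theorem rmulL_apply (β : BallC m) (c : Cl m) : rmulL β c = rmul c β := rfl

/-- The orthogonal projection onto the span of `β`. -/
def projL (β : BallC m) : BallC m →L[ℝ] BallC m := rmulL β ∘L projCoeff β

theorem projL_apply (β u : BallC m) : projL β u = rmul (projCoeff β u) β := rfl

theorem pair_projL {β : BallC m} (hβ : β ∈ monoC m) (u : BallC m) :
    pair (projL β u) β = pair u β := by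
  rw [projL_apply, pair_rmul_left, projCoeff_apply, mul_genInverse (pair_mem_range hβ u)]

theorem projL_mem_monoC {β : BallC m} (hβ : β ∈ monoC m) (u : BallC m) : projL β u ∈ monoC m := by
  rw [projL_apply]
  exact rmul_mem_monoC hβ _

theorem rmul_eq_rmul_of_pair_eq {β : BallC m} (hβ : β ∈ monoC m) {c d : Cl m}
    (h : pair (rmul c β) β = pair (rmul d β) β) : rmul c β = rmul d β := by
  have h1 : rmul c β - rmul d β = rmul (c - d) β := ((rmulL β).map_sub c d).symm
  rw [← sub_eq_zero, h1]
  refine eq_zero_of_pair_self (rmul_mem_monoC hβ _) ?_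
  rw [pair_rmul_right, ← h1, pair_sub_left, h, sub_self, mul_zero]

theorem projL_rmul {β : BallC m} (hβ : β ∈ monoC m) (c : Cl m) : projL β (rmul c β) = rmul c β := by
  have h := pair_projL hβ (rmul c β)
  rw [projL_apply] at h ⊢
  exact rmul_eq_rmul_of_pair_eq hβ h

theorem projL_eq_zero {β u : BallC m} (h : pair u β = 0) : projL β u = 0 := by
  rw [projL_apply, projCoeff_apply, h, map_zero, ← rmulL_apply, map_zero]

theorem pair_projL_eq_zero {β γ : BallC m} (h : pair β γ = 0) (u : BallC m) :
    pair (projL β u) γ = 0 := by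
  rw [projL_apply, pair_rmul_left, h, zero_mul]

theorem pair_projL_eq_zero_right {β γ : BallC m} (h : pair γ β = 0) (u : BallC m) :
    pair γ (projL β u) = 0 := by
  rw [projL_apply, pair_rmul_right, h, mul_zero]

/-- `proj` picks its coefficient by `Classical.epsilon`, but all coefficients that satisfy the
orthogonality give the same product with β. -/
theorem proj_eq {β u : BallC m} (hβ : β ∈ monoC m) {b α : Pt m → Cl m}
    (hb : ∀ x ∈ unitBall m, b x = β.ev x) (hα : ∀ x ∈ unitBall m, α x = u.ev x) :
    ∀ x ∈ unitBall m, proj b α x = (projL β u).ev x := by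
  have key : ∀ c, hardyInner (fun y => α y - b y * c) b = pair u β - pair (rmul c β) β := fun c => by
    rw [← pair_sub_left]
    refine hardyInner_of_eqOn (fun x hx => ?_) hb
    rw [hb x hx, hα x hx, ev_sub, ev_rmul]
  have hex : ∃ c, hardyInner (fun y => α y - b y * c) b = 0 :=
    ⟨projCoeff β u, by rw [key, ← projL_apply, pair_projL hβ, sub_self]⟩
  have h1 := Classical.epsilon_spec hex
  rw [key, sub_eq_zero] at h1
  intro x hx
  have h3 := pair_projL hβ u
  rw [projL_apply, h1] at h3
  rw [proj, hb x hx, ← ev_rmul, projL_apply, rmul_eq_rmul_of_pair_eq hβ h3]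

/-! ### The Gram–Schmidt step -/

variable {ι : Type*}

/-- The difference of the identity and the orthogonal projections onto the `V i`, `i ∈ s`. -/
def complL (V : ι → BallC m) (s : Finset ι) : BallC m →L[ℝ] BallC m :=
  ContinuousLinearMap.id ℝ _ - ∑ i ∈ s, projL (V i)

theorem complL_apply (V : ι → BallC m) (s : Finset ι) (u : BallC m) :
    complL V s u = u - ∑ i ∈ s, projL (V i) u := by
  simp [complL]

theorem complL_mem_monoC {V : ι → BallC m} {s : Finset ι} (hV : ∀ i ∈ s, V i ∈ monoC m)
    {u : BallC m} (hu : u ∈ monoC m) : complL V s u ∈ monoC m := by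
  rw [complL_apply]
  exact Submodule.sub_mem _ hu (Submodule.sum_mem _ fun i hi => projL_mem_monoC (hV i hi) u)

theorem pair_complL {V : ι → BallC m} {s : Finset ι} (hV : ∀ i ∈ s, V i ∈ monoC m)
    (ho : ∀ i ∈ s, ∀ j ∈ s, i ≠ j → pair (V i) (V j) = 0) {i : ι} (hi : i ∈ s) (u : BallC m) :
    pair (complL V s u) (V i) = 0 := by
  rw [complL_apply, pair_sub_left, pair_sum_left, Finset.sum_eq_single i, pair_projL (hV i hi),
    sub_self]
  · exact fun j hj hji => pair_projL_eq_zero (ho j hj i hi hji) u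
  · exact fun h => absurd hi h

/-- A function orthogonal to the V_i does not see the projections. Applied to S_b, its pairing with
T_b is a multiple of its value at `b`. -/
theorem pair_complL_right {V : ι → BallC m} {s : Finset ι} {g : BallC m}
    (hg : ∀ i ∈ s, pair g (V i) = 0) (u : BallC m) : pair g (complL V s u) = pair g u := by
  rw [complL_apply, pair_sub_right, pair_sum_right, Finset.sum_eq_zero, sub_zero]
  exact fun i hi => pair_projL_eq_zero_right (hg i hi) u

theorem complL_rmul_self {V : ι → BallC m} {s : Finset ι} (hV : ∀ i ∈ s, V i ∈ monoC m)
    (ho : ∀ i ∈ s, ∀ j ∈ s, i ≠ j → pair (V i) (V j) = 0) {i : ι} (hi : i ∈ s) (c : Cl m) :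
    complL V s (rmul c (V i)) = 0 := by
  rw [complL_apply, Finset.sum_eq_single i, projL_rmul (hV i hi), sub_self]
  · intro j hj hji
    refine projL_eq_zero ?_
    rw [pair_rmul_left, ho i hi j hj hji.symm, zero_mul]
  · exact fun h => absurd hi h

/-- The function `T_b`. -/
def tmC (V : ι → BallC m) (s : Finset ι) (b : Pt m) : BallC m := complL V s (szegoC b)

theorem tmC_mem_monoC {V : ι → BallC m} {s : Finset ι} (hV : ∀ i ∈ s, V i ∈ monoC m) {b : Pt m}
    (hb : b ∈ unitBall m) : tmC V s b ∈ monoC m :=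
  complL_mem_monoC hV (mono_le_monoC (szegoC_mem_mono hb))

variable {n : ℕ}

theorem tmT_eq {B : Fin n → Pt m → Cl m} {V : Fin n → BallC m} {s : Finset (Fin n)}
    (hV : ∀ i ∈ s, V i ∈ monoC m) (hB : ∀ i ∈ s, ∀ x ∈ unitBall m, B i x = (V i).ev x)
    {b : Pt m} (hb : b ∈ unitBall m) : ∀ x ∈ unitBall m, tmT B s b x = (tmC V s b).ev x := by
  intro x hx
  rw [tmT, tmC, complL_apply, ev_sub, ev_sum, ev_szegoC hb (Metric.ball_subset_closedBall hx)]
  congr 1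
  refine Finset.sum_congr rfl fun i hi => ?_
  exact proj_eq (hV i hi) (hB i hi)
    (fun y hy => (ev_szegoC hb (Metric.ball_subset_closedBall hy)).symm) x hx

theorem tmB_eq {B : Fin n → Pt m → Cl m} {V : Fin n → BallC m} {s : Finset (Fin n)}
    (hV : ∀ i ∈ s, V i ∈ monoC m) (hB : ∀ i ∈ s, ∀ x ∈ unitBall m, B i x = (V i).ev x)
    {b : Pt m} (hb : b ∈ unitBall m) : ∀ x ∈ unitBall m,
      tmB B s b x = ((tmC V s b).bnorm⁻¹ • tmC V s b).ev x := by
  intro x hx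
  rw [tmB, tmT_eq hV hB hb x hx, hardyNorm_congr_ev (tmC_mem_monoC hV hb) (tmT_eq hV hB hb), ev_smul]

end BallC

/-! ### Leading terms of smooth curves -/

/-- Taylor's formula to an order n for which γ is not o(ρⁿ): some coefficient up to order n is
nonzero, and the first such coefficient is the limit. -/
theorem exists_leading_term {E : Type*} [NormedAddCommGroup E] [NormedSpace ℝ E] {γ : ℝ → E}
    (hγ : ∀ n : ℕ, ContDiffAt ℝ n γ 0)
    (hflat : ∃ p : ℕ, ¬ Tendsto (fun ρ : ℝ => (ρ ^ p)⁻¹ • γ ρ) (𝓝[>] 0) (𝓝 0)) :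
    ∃ (p : ℕ) (V : E), V ≠ 0 ∧ Tendsto (fun ρ : ℝ => (ρ ^ p)⁻¹ • γ ρ) (𝓝[>] 0) (𝓝 V) := by
  classical
  obtain ⟨n, hn⟩ := hflat
  obtain ⟨u, hu, hγu⟩ := (hγ n).contDiffOn le_rfl (by simp)
  obtain ⟨δ, hδ, hball⟩ := Metric.mem_nhds_iff.1 hu
  have ht := taylor_tendsto (convex_ball (0 : ℝ) δ) (Metric.mem_ball_self hδ) (hγu.mono hball)
  rw [Metric.isOpen_ball.nhdsWithin_eq (Metric.mem_ball_self hδ)] at ht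
  simp only [sub_zero, taylor_within_apply] at ht
  set c : ℕ → E := fun k => ((k.factorial : ℝ)⁻¹) • iteratedDerivWithin k γ (Metric.ball 0 δ) 0
    with hc
  have hsum : ∀ ρ : ℝ, ∑ k ∈ Finset.range (n + 1), (((k.factorial : ℝ)⁻¹) * ρ ^ k) •
      iteratedDerivWithin k γ (Metric.ball 0 δ) 0 = ∑ k ∈ Finset.range (n + 1), ρ ^ k • c k :=
    fun ρ => Finset.sum_congr rfl fun k _ => by rw [hc, smul_smul, mul_comm]
  simp only [hsum] at ht
  replace ht := ht.mono_left (nhdsWithin_le_nhds (s := Set.Ioi 0))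
  have hex : ∃ k, k < n + 1 ∧ c k ≠ 0 := by
    by_contra! h
    refine hn (ht.congr fun ρ => ?_)
    rw [Finset.sum_eq_zero fun k hk => by rw [h k (Finset.mem_range.1 hk), smul_zero], sub_zero]
  set p := Nat.find hex
  obtain ⟨hpn, hp⟩ : p < n + 1 ∧ c p ≠ 0 := Nat.find_spec hex
  have hlt : ∀ k, k < p → c k = 0 := fun k hk => by
    by_contra h
    exact Nat.find_min hex hk ⟨hk.trans hpn, h⟩
  refine ⟨p, c p, hp, ?_⟩
  have hid : Tendsto (fun ρ : ℝ => ρ) (𝓝[>] 0) (𝓝 0) := nhdsWithin_le_nhds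
  have h1 : Tendsto (fun ρ : ℝ => ρ ^ (n - p) •
      ((ρ ^ n)⁻¹ • (γ ρ - ∑ k ∈ Finset.range (n + 1), ρ ^ k • c k))) (𝓝[>] 0) (𝓝 0) := by
    have := (hid.pow (n - p)).smul ht
    rwa [smul_zero] at this
  have h2 : Tendsto (fun ρ : ℝ => ∑ k ∈ Finset.range (n + 1), (ρ ^ p)⁻¹ • ρ ^ k • c k)
      (𝓝[>] 0) (𝓝 (∑ k ∈ Finset.range (n + 1), if k = p then c p else 0)) := by
    refine tendsto_finsetSum _ fun k _ => ?_
    rcases lt_trichotomy k p with h | h | h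
    · simp [hlt k h, h.ne]
    · subst h
      rw [if_pos rfl]
      refine tendsto_const_nhds.congr' ?_
      filter_upwards [self_mem_nhdsWithin] with ρ hρ
      rw [smul_smul, inv_mul_cancel₀ (pow_ne_zero _ (ne_of_gt hρ)), one_smul]
    · rw [if_neg h.ne']
      have h3 := (hid.pow (k - p)).smul_const (c k)
      rw [zero_pow (Nat.sub_pos_of_lt h).ne', zero_smul] at h3
      refine h3.congr' ?_
      filter_upwards [self_mem_nhdsWithin] with ρ hρ
      rw [smul_smul (ρ ^ p)⁻¹ (ρ ^ k), pow_sub₀ _ (ne_of_gt hρ) h.le, mul_comm]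
  rw [Finset.sum_ite_eq' _ p, if_pos (Finset.mem_range.2 hpn)] at h2
  have h4 := h1.add h2
  rw [zero_add] at h4
  refine h4.congr' ?_
  filter_upwards [self_mem_nhdsWithin] with ρ hρ
  have hρ0 : ρ ≠ 0 := ne_of_gt hρ
  rw [← Finset.smul_sum, smul_smul, pow_sub₀ _ hρ0 (Nat.lt_succ_iff.1 hpn), mul_comm (ρ ^ n),
    mul_assoc, mul_inv_cancel₀ (pow_ne_zero _ hρ0), mul_one, ← smul_add, sub_add_cancel]

theorem tendsto_eval_zeroPoly {ι : Type*} [Fintype ι] (z : ι → ℂ) (N : ι → ℕ) (c w : ℂ) :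
    Tendsto (fun ρ : ℝ => ((ρ : ℂ) ^ (∑ j, if z j = c then N j else 0))⁻¹ *
      (zeroPoly z N).eval (c + ρ * w)) (𝓝[>] 0)
      (𝓝 (∏ j, if z j = c then w ^ N j else (c - z j) ^ N j)) := by
  have hid : Tendsto (fun ρ : ℝ => (ρ : ℂ)) (𝓝[>] 0) (𝓝 0) := by
    have := (Complex.continuous_ofReal.tendsto 0).mono_left (nhdsWithin_le_nhds (s := Set.Ioi 0))
    simpa using this
  have h1 : Tendsto (fun ρ : ℝ => ∏ j, ((ρ : ℂ) ^ (if z j = c then N j else 0))⁻¹ *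
      (c + ρ * w - z j) ^ N j) (𝓝[>] 0)
      (𝓝 (∏ j, if z j = c then w ^ N j else (c - z j) ^ N j)) := by
    refine tendsto_finsetProd _ fun j _ => ?_
    split_ifs with h
    · refine tendsto_const_nhds.congr' ?_
      filter_upwards [self_mem_nhdsWithin] with ρ hρ
      have hρ0 : (ρ : ℂ) ≠ 0 := Complex.ofReal_ne_zero.2 (ne_of_gt hρ)
      rw [h, add_sub_cancel_left, mul_pow, ← mul_assoc, inv_mul_cancel₀ (pow_ne_zero _ hρ0), one_mul]
    · have h2 := (((hid.mul_const w).const_add c).sub_const (z j)).pow (N j)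
      simpa using h2
  refine h1.congr fun ρ => ?_
  rw [eval_zeroPoly, Finset.prod_mul_distrib, Finset.prod_inv_distrib, Finset.prod_pow_eq_pow_sum]

/-! ### Testing T_b with polynomials: vanishing orders and leading terms -/

namespace BallC

theorem pair_polyC_szegoC {s : Pt m} (hs : IsImaginaryUnit s) (q : Polynomial ℂ) (v : Cl m)
    {b : Pt m} (hb : b ∈ unitBall m) : pair (polyC s q v) (szegoC b) =
      szegoConst m • (complexToCl s (q.eval (complexCoord s b)) * v) := by
  rw [pair_szegoC_of_mem_monoC (mono_le_monoC (polyC_mem_mono hs q v)) hb,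
    ev_polyC _ _ _ (Metric.ball_subset_closedBall hb), polyFn]

variable {ι : Type*}

/-- `V` is orthogonal to the functions `x ↦ q(x₀ + s⟨s, x⟩) v` for which `q` has zeros of order
`N j` at the points that correspond to the `a j`. -/
def Annihilates (a : ι → Pt m) (N : ι → ℕ) (V : BallC m) : Prop :=
  ∀ s, IsImaginaryUnit s → ∀ (q : Polynomial ℂ) (v : Cl m),
    (∀ j, (Polynomial.X - Polynomial.C (complexCoord s (a j))) ^ N j ∣ q) →
      pair (polyC s q v) V = 0

theorem Annihilates.mono_order {a : ι → Pt m} {N N' : ι → ℕ} {V : BallC m}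
    (h : Annihilates a N V) (hN : N ≤ N') : Annihilates a N' V := fun s hs q v hq =>
  h s hs q v fun j => (pow_dvd_pow _ (hN j)).trans (hq j)

theorem Annihilates.smul {a : ι → Pt m} {N : ι → ℕ} {V : BallC m} (h : Annihilates a N V)
    (r : ℝ) : Annihilates a N (r • V) := fun s hs q v hq => by
  rw [pair_smul_right, h s hs q v hq, smul_zero]

theorem pair_polyC_tmC {a : ι → Pt m} {N : ι → ℕ} {V : ι → BallC m} {t : Finset ι}
    (hV : ∀ i ∈ t, Annihilates a N (V i)) {s : Pt m} (hs : IsImaginaryUnit s) {q : Polynomial ℂ}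
    (hq : ∀ j, (Polynomial.X - Polynomial.C (complexCoord s (a j))) ^ N j ∣ q) (v : Cl m)
    {b : Pt m} (hb : b ∈ unitBall m) : pair (polyC s q v) (tmC V t b) =
      szegoConst m • (complexToCl s (q.eval (complexCoord s b)) * v) := by
  rw [tmC, pair_complL_right fun i hi => hV i hi s hs q v hq, pair_polyC_szegoC hs q v hb]

theorem annihilates_tmC {a : ι → Pt m} {N : ι → ℕ} {V : ι → BallC m} {t : Finset ι}
    (hV : ∀ i ∈ t, Annihilates a N (V i)) {k : ι} (hk : a k ∈ unitBall m) (hN : N k ≠ 0) :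
    Annihilates a N (tmC V t (a k)) := fun s hs q v hq => by
  rw [pair_polyC_tmC hV hs hq v hk]
  have h := (dvd_pow_self _ hN).trans (hq k)
  rw [Polynomial.dvd_iff_isRoot, Polynomial.IsRoot] at h
  rw [h, map_zero, zero_mul, smul_zero]

theorem dvd_zeroPoly [Fintype ι] (z : ι → ℂ) (N : ι → ℕ) (j : ι) :
    (Polynomial.X - Polynomial.C (z j)) ^ N j ∣ zeroPoly z N :=
  Finset.dvd_prod_of_mem _ (Finset.mem_univ j)

theorem bnorm_smul (r : ℝ) (u : BallC m) : (r • u).bnorm = |r| * u.bnorm := by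
  refine (pow_left_inj₀ (bnorm_nonneg _) (mul_nonneg (abs_nonneg _) (bnorm_nonneg _))
    two_ne_zero).1 ?_
  rw [← inner_one_pair_self, pair_smul_left, pair_smul_right, inner_smul_right, inner_smul_right,
    inner_one_pair_self, mul_pow, sq_abs]
  ring

/-- Normalization does not see positive scalar factors. -/
theorem normalize_smul {r : ℝ} (hr : 0 < r) (u : BallC m) :
    (r • u).bnorm⁻¹ • r • u = u.bnorm⁻¹ • u := by
  rw [bnorm_smul, abs_of_pos hr, smul_smul, mul_inv, mul_comm r⁻¹, mul_assoc,
    inv_mul_cancel₀ hr.ne', mul_one]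

theorem eventually_add_smul_mem_ball {c : Pt m} (hc : c ∈ unitBall m) (ω : Pt m) :
    ∀ᶠ ρ : ℝ in 𝓝[>] 0, c + ρ • ω ∈ unitBall m := by
  have h : Continuous fun ρ : ℝ => c + ρ • ω := by fun_prop
  refine (h.tendsto 0).mono_left nhdsWithin_le_nhds ?_
  rw [zero_smul, add_zero]
  exact Metric.isOpen_ball.mem_nhds hc

theorem contDiffAt_tmC {V : ι → BallC m} {t : Finset ι} {c : Pt m} (hc : c ∈ unitBall m)
    (ω : Pt m) (n : ℕ) : ContDiffAt ℝ n (fun ρ : ℝ => tmC V t (c + ρ • ω)) 0 := by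
  -- The order is raised by one because `contDiffAt_szegoC` excludes order 0.
  have h1 : ContDiffAt ℝ ((n + 1 : ℕ) : WithTop ℕ∞) szegoC (c + (0 : ℝ) • ω) := by
    rw [zero_smul, add_zero]
    exact contDiffAt_szegoC hc (by exact_mod_cast n.succ_ne_zero)
  have h2 : ContDiffAt ℝ ((n + 1 : ℕ) : WithTop ℕ∞) (fun ρ : ℝ => c + ρ • ω) 0 := by fun_prop
  have h3 : ContDiffAt ℝ ((n + 1 : ℕ) : WithTop ℕ∞) (fun ρ : ℝ => tmC V t (c + ρ • ω)) 0 :=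
    (complL V t).contDiff.contDiffAt.comp (0 : ℝ) (ContDiffAt.comp (g := szegoC) (0 : ℝ) h1 h2)
  exact h3.of_le (by exact_mod_cast n.le_succ)

-- The test polynomial vanishes at the image of `c` exactly to the order by which T is rescaled. The
-- rescaled pairing then tends to a nonzero element of the copy of ℂ, which is invertible. With W =
-- 0 this excludes flatness; in general it yields the invertibility of ⟨W, W⟩.
open Classical in
theorem exists_pair_leading_mul_eq_one [Fintype ι] (hm : 1 ≤ m) {a : ι → Pt m} {N : ι → ℕ}
    {V : ι → BallC m} {t : Finset ι} (hV : ∀ i ∈ t, Annihilates a N (V i)) {c ω : Pt m}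
    (hc : c ∈ unitBall m) (hω : ω ≠ 0) {W : BallC m}
    (hW : Tendsto (fun ρ : ℝ => (ρ ^ (∑ j, if a j = c then N j else 0))⁻¹ •
      tmC V t (c + ρ • ω)) (𝓝[>] 0) (𝓝 W)) :
    ∃ (h : BallC m) (w : Cl m), pair h W * w = 1 := by
  -- The index `none` makes the coordinate of ω nonzero; the others separate the image of `c` from
  -- those of the parameters different from `c`.
  obtain ⟨s, hs, hy⟩ := exists_imaginaryUnit hm
    (fun o : Option ι => o.elim ω fun j => if a j = c then ω else c - a j) (by
      rintro (_ | j)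
      · exact hω
      · simp only [Option.elim_some]
        split_ifs with h
        · exact hω
        · exact sub_ne_zero.2 (Ne.symm h))
  set z : ι → ℂ := fun j => complexCoord s (a j) with hz
  have hzj : ∀ j, z j = complexCoord s c ↔ a j = c := fun j => by
    refine ⟨fun h => ?_, fun h => by simp only [hz, h]⟩
    by_contra hne
    have h1 := hy (some j)
    rw [Option.elim_some, if_neg hne, map_sub] at h1
    exact h1 (sub_eq_zero.2 h.symm)
  have h1 := tendsto_eval_zeroPoly z N (complexCoord s c) (complexCoord s ω)
  simp only [hzj] at h1
  set d := ∑ j, if a j = c then N j else 0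
  set L := ∏ j, if a j = c then complexCoord s ω ^ N j else (complexCoord s c - z j) ^ N j
  have hL : L ≠ 0 := by
    refine Finset.prod_ne_zero_iff.2 fun j _ => ?_
    split_ifs with h
    · exact pow_ne_zero _ (hy none)
    · exact pow_ne_zero _ (sub_ne_zero.2 fun h' => h ((hzj j).1 h'.symm))
  set h := polyC s (zeroPoly z N) 1
  have h2 : Tendsto (fun ρ : ℝ => pair h ((ρ ^ d)⁻¹ • tmC V t (c + ρ • ω))) (𝓝[>] 0)
      (𝓝 (pair h W)) := ((pairL h).continuous.tendsto _).comp hW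
  have h3 : Tendsto (fun ρ : ℝ => szegoConst m • complexToCl s (((ρ : ℂ) ^ d)⁻¹ *
      (zeroPoly z N).eval (complexCoord s c + ρ * complexCoord s ω))) (𝓝[>] 0)
      (𝓝 (szegoConst m • complexToCl s L)) :=
    (((complexToCl s).continuous.tendsto _).comp h1).const_smul _
  have h4 := h3.congr' (f₂ := fun ρ : ℝ => pair h ((ρ ^ d)⁻¹ • tmC V t (c + ρ • ω))) (by
    filter_upwards [eventually_add_smul_mem_ball hc ω] with ρ hρ
    rw [pair_smul_right, pair_polyC_tmC hV hs (dvd_zeroPoly z N) 1 hρ, mul_one, map_add, map_smul,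
      Complex.real_smul, smul_comm ((ρ ^ d)⁻¹), ← map_smul (complexToCl s) (ρ ^ d)⁻¹, Complex.real_smul,
      Complex.ofReal_inv, Complex.ofReal_pow])
  refine ⟨h, (szegoConst m)⁻¹ • complexToCl s L⁻¹, ?_⟩
  rw [tendsto_nhds_unique h2 h4, smul_mul_smul_comm, hs.map_mul_inv hL,
    mul_inv_cancel₀ szegoConst_pos.ne', one_smul]

/-- The functions `T_{c + ρω}` have a leading term as `ρ → 0`. -/
theorem exists_leading_tmC [Finite ι] (hm : 1 ≤ m) {a : ι → Pt m} {N : ι → ℕ} {V : ι → BallC m}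
    {t : Finset ι} (hV : ∀ i ∈ t, Annihilates a N (V i)) {c ω : Pt m} (hc : c ∈ unitBall m)
    (hω : ω ≠ 0) : ∃ (p : ℕ) (W : BallC m), W ≠ 0 ∧
      Tendsto (fun ρ : ℝ => (ρ ^ p)⁻¹ • tmC V t (c + ρ • ω)) (𝓝[>] 0) (𝓝 W) := by
  have := Fintype.ofFinite ι
  refine exists_leading_term (contDiffAt_tmC hc ω) ?_
  -- A flat curve would have rescaled limit 0 at the total order of the test polynomial, and 0
  -- cannot pair to an invertible number.
  by_contra! hflat
  obtain ⟨h, w, hw⟩ := exists_pair_leading_mul_eq_one hm hV hc hω (hflat _)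
  rw [← pairL_apply, map_zero, zero_mul] at hw
  exact zero_ne_one hw

/-- A zero of order p + 1 of q makes the pairing with T_{a_k+ρω} of size ρ^(p+1), which still
vanishes in the limit after division by ρ^p. -/
theorem annihilates_leading {a : ι → Pt m} {N : ι → ℕ} {V : ι → BallC m} {t : Finset ι}
    (hV : ∀ i ∈ t, Annihilates a N (V i)) {k : ι} (hk : a k ∈ unitBall m) {ω : Pt m} {p : ℕ}
    {W : BallC m} (hW : Tendsto (fun ρ : ℝ => (ρ ^ p)⁻¹ • tmC V t (a k + ρ • ω)) (𝓝[>] 0) (𝓝 W))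
    (hN : p + 1 ≤ N k) : Annihilates a N W := by
  intro s hs q v hq
  obtain ⟨q', rfl⟩ := (pow_dvd_pow _ hN).trans (hq k)
  set q := (Polynomial.X - Polynomial.C (complexCoord s (a k))) ^ (p + 1) * q'
  have h2 : Tendsto (fun ρ : ℝ => pair (polyC s q v) ((ρ ^ p)⁻¹ • tmC V t (a k + ρ • ω))) (𝓝[>] 0)
      (𝓝 (pair (polyC s q v) W)) := ((pairL (polyC s q v)).continuous.tendsto _).comp hW
  refine tendsto_nhds_unique h2 ?_
  have h1 : Continuous fun ρ : ℝ => szegoConst m • (complexToCl s (ρ • (complexCoord s ω ^ (p + 1) *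
      q'.eval (complexCoord s (a k + ρ • ω)))) * v) := by
    have := q'.continuous
    have h3 : Continuous fun ρ : ℝ => q'.eval (complexCoord s (a k + ρ • ω)) :=
      this.comp (by fun_prop)
    have h4 : Continuous fun ρ : ℝ => ρ • (complexCoord s ω ^ (p + 1) *
      q'.eval (complexCoord s (a k + ρ • ω))) := continuous_id.smul (continuous_const.mul h3)
    exact (continuous_const_smul (szegoConst m)).comp
      ((mulRightL v).continuous.comp ((complexToCl s).continuous.comp h4))
  have h5 := (h1.tendsto 0).mono_left (nhdsWithin_le_nhds (s := Set.Ioi 0))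
  rw [zero_smul, map_zero, zero_mul, smul_zero] at h5
  refine h5.congr' ?_
  filter_upwards [eventually_add_smul_mem_ball hk ω, self_mem_nhdsWithin] with ρ hρ hρ0
  have hρ1 : ρ ≠ 0 := ne_of_gt hρ0
  have hev : q.eval (complexCoord s (a k + ρ • ω)) = ρ ^ (p + 1) •
      (complexCoord s ω ^ (p + 1) * q'.eval (complexCoord s (a k + ρ • ω))) := by
    simp only [q, Polynomial.eval_mul, Polynomial.eval_pow, Polynomial.eval_sub, Polynomial.eval_X,
      Polynomial.eval_C]
    rw [← map_sub, add_sub_cancel_left, map_smul, smul_pow, smul_mul_assoc]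
  rw [pair_smul_right, pair_polyC_tmC hV hs hq v hρ, smul_comm, hev, map_smul, map_smul,
    smul_mul_assoc, smul_mul_assoc, smul_smul (ρ ^ p)⁻¹, pow_succ ρ, ← mul_assoc (ρ ^ p)⁻¹,
    inv_mul_cancel₀ (pow_ne_zero _ hρ1), one_mul]

end BallC

/-! ### Takenaka–Malmquist systems consist of continuous functions on the closed ball -/

theorem l2norm_sub_le {F G : Metric.sphere (0 : Pt m) 1 → Cl m} (hF : MemLp F 2 (surface m))
    (hG : MemLp G 2 (surface m)) : l2norm (fun η => F η - G η) ≤ l2norm F + l2norm G := by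
  have h1 : l2norm (fun η => -G η) = l2norm G := by simp only [l2norm, norm_neg]
  have h2 := l2norm_add_le hF hG.neg
  simp only [Pi.neg_apply, ← sub_eq_add_neg] at h2
  rw [← h1]
  exact h2

theorem eq_zero_of_l2norm_eq_zero {F : Metric.sphere (0 : Pt m) 1 → Cl m} (hF : Continuous F)
    (h : l2norm F = 0) (η : Metric.sphere (0 : Pt m) 1) : F η = 0 := by
  have h1 := l2norm_sq F
  rw [h, zero_pow two_ne_zero, eq_comm,
    mul_eq_zero_iff_left (inv_ne_zero sphereArea_pos.ne')] at h1
  have hc : Continuous fun η => ‖F η‖ ^ 2 := hF.norm.pow 2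
  rw [integral_eq_zero_iff_of_nonneg (fun η => by positivity)
    (hc.integrable_of_hasCompactSupport (HasCompactSupport.of_compactSpace _))] at h1
  have h2 := (Continuous.ae_eq_iff_eq (surface m) hc continuous_zero).1 h1
  have h3 := congrFun h2 η
  simpa using h3

theorem eq_zero_of_meanNorm_eq_zero {f : Pt m → Cl m} (hf : ContinuousOn f (unitBall m))
    (h : ∀ r ∈ Set.Ioo (0 : ℝ) 1, meanNorm f r = 0) {x : Pt m} (hx : x ∈ unitBall m) :
    f x = 0 := by
  have h1 : ∀ y ∈ unitBall m, y ≠ 0 → f y = 0 := by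
    intro y hy hy0
    have hn : 0 < ‖y‖ := norm_pos_iff.2 hy0
    have h2 := eq_zero_of_l2norm_eq_zero
      (continuous_smul_sphere hf ⟨hn, mem_ball_zero_iff.1 hy⟩)
      (h ‖y‖ ⟨hn, mem_ball_zero_iff.1 hy⟩)
      ⟨‖y‖⁻¹ • y, by simp [norm_smul, inv_mul_cancel₀ hn.ne']⟩
    rwa [smul_smul, mul_inv_cancel₀ hn.ne', one_smul] at h2
  by_cases hx0 : x = 0
  · subst hx0
    have h2 : Tendsto f (𝓝[≠] (0 : Pt m)) (𝓝 (f 0)) :=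
      (hf.continuousAt (Metric.isOpen_ball.mem_nhds hx)).tendsto.mono_left nhdsWithin_le_nhds
    refine tendsto_nhds_unique h2 (tendsto_const_nhds.congr' ?_)
    filter_upwards [self_mem_nhdsWithin,
      nhdsWithin_le_nhds (Metric.isOpen_ball.mem_nhds hx)] with y hy hyb
    exact (h1 y hyb hy).symm
  · exact h1 x hx hx0

namespace BallC

/-- A limit in the Hardy norm of uniformly convergent functions is the uniform limit. -/
theorem eq_ev_of_tendsto_hardyNorm {β : Pt m → Cl m} (hβ : MemHardy β) {u : BallC m}
    {g : ℝ → Pt m → Cl m} {w : ℝ → BallC m} {l : Filter ℝ} [l.NeBot]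
    (hg : ∀ᶠ ρ in l, ∀ x ∈ unitBall m, g ρ x = (w ρ).ev x) (hw : Tendsto w l (𝓝 u))
    (hh : Tendsto (fun ρ => hardyNorm fun x => g ρ x - β x) l (𝓝 0)) {x : Pt m}
    (hx : x ∈ unitBall m) : β x = u.ev x := by
  obtain ⟨M, hM⟩ := hβ.2
  have hβc := hβ.1.1.continuousOn
  have hsub : ContinuousOn (fun x => u.ev x - β x) (unitBall m) :=
    (u.continuousOn_ev.mono Metric.ball_subset_closedBall).sub hβc
  refine (sub_eq_zero.1 (eq_zero_of_meanNorm_eq_zero hsub (fun r hr => ?_) hx)).symm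
  refine le_antisymm ?_ (Real.sqrt_nonneg _)
  have hLβ : MemLp (fun η : Metric.sphere (0 : Pt m) 1 => β (r • (η : Pt m))) 2 (surface m) :=
    memLp_of_continuous (continuous_smul_sphere hβc hr)
  have hLu : ∀ v : BallC m, MemLp (fun η : Metric.sphere (0 : Pt m) 1 => v.ev (r • (η : Pt m))) 2
      (surface m) := fun v => memLp_of_continuous (v.continuous_ev_smul_sphere hr.1.le hr.2.le)
  have hlim : Tendsto (fun ρ => areaConst m * ‖u - w ρ‖ + hardyNorm fun x => g ρ x - β x) l
      (𝓝 0) := by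
    have h1 : Tendsto (fun ρ => ‖u - w ρ‖) l (𝓝 0) := by
      have := (tendsto_const_nhds (x := u)).sub hw
      rw [sub_self] at this
      simpa using this.norm
    have h2 := (h1.const_mul (areaConst m)).add hh
    rwa [mul_zero, add_zero] at h2
  refine ge_of_tendsto hlim ?_
  filter_upwards [hg] with ρ hρ
  -- For an unbounded set `sSup` would be 0 by convention, and the Hardy norm would control no
  -- spherical mean.
  have hb : BddAbove (meanNorm (fun x => g ρ x - β x) '' Set.Ioo 0 1) := by
    refine ⟨areaConst m * ‖w ρ‖ + M, ?_⟩
    rintro _ ⟨t, ht, rfl⟩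
    rw [meanNorm_congr (g := fun x => (w ρ).ev x - β x) (fun x hx => by rw [hρ x hx]) ht]
    refine (l2norm_sub_le (memLp_of_continuous ((w ρ).continuous_ev_smul_sphere ht.1.le ht.2.le))
      (memLp_of_continuous (continuous_smul_sphere hβc ht))).trans ?_
    exact add_le_add ((w ρ).meanNorm_ev_le t) (hM ⟨t, ht, rfl⟩)
  have h1 : meanNorm (fun x => g ρ x - β x) r ≤ hardyNorm fun x => g ρ x - β x :=
    le_csSup hb ⟨r, hr, rfl⟩
  rw [meanNorm_congr (g := fun x => (w ρ).ev x - β x) (fun x hx => by rw [hρ x hx]) hr] at h1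
  have h2 := l2norm_add_le (hLu (u - w ρ)) ((hLu (w ρ)).sub hLβ)
  simp only [ev_sub, Pi.sub_apply, sub_add_sub_cancel] at h2
  have h3 := (u - w ρ).meanNorm_ev_le r
  rw [meanNorm_eq_l2norm] at h1 h3 ⊢
  simp only [ev_sub] at h3
  exact h2.trans (add_le_add h3 h1)

open Classical in
/-- The uniform limit of monogenic functions that is given by `f` on the ball, if there is one. -/
def ofFun (f : Pt m → Cl m) : BallC m :=
  if h : ∃ u ∈ monoC m, ∀ x ∈ unitBall m, f x = u.ev x then h.choose else 0

theorem ofFun_eq {f : Pt m → Cl m} {u : BallC m} (hu : u ∈ monoC m)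
    (h : ∀ x ∈ unitBall m, f x = u.ev x) : ofFun f = u := by
  have hex : ∃ u ∈ monoC m, ∀ x ∈ unitBall m, f x = u.ev x := ⟨u, hu, h⟩
  rw [ofFun, dif_pos hex]
  exact ext_ball fun x hx => by rw [← hex.choose_spec.2 x hx, h x hx]

open Classical in
/-- The orders `M` at the repeated parameters and `1` at the others. -/
def testOrder {ι : Type*} (a : ι → Pt m) (M : ℕ) (j : ι) : ℕ :=
  if ∃ i, i ≠ j ∧ a i = a j then M + 1 else 1

theorem testOrder_ne_zero {ι : Type*} (a : ι → Pt m) (M : ℕ) (j : ι) : testOrder a M j ≠ 0 := by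
  unfold testOrder; split_ifs <;> simp

theorem testOrder_mono {ι : Type*} (a : ι → Pt m) : Monotone (testOrder a) := fun M N h j => by
  unfold testOrder; split_ifs <;> simp [h]

variable {n : ℕ}

theorem tmC_leading_properties {V : Fin n → BallC m} {t : Finset (Fin n)}
    (hV : ∀ i ∈ t, V i ∈ monoC m) (ho : ∀ i ∈ t, ∀ j ∈ t, i ≠ j → pair (V i) (V j) = 0) {c ω : Pt m}
    (hc : c ∈ unitBall m) {p : ℕ} {W : BallC m}
    (hW : Tendsto (fun ρ : ℝ => (ρ ^ p)⁻¹ • tmC V t (c + ρ • ω)) (𝓝[>] 0) (𝓝 W)) :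
    W ∈ monoC m ∧ ∀ i ∈ t, pair W (V i) = 0 := by
  constructor
  · refine isClosed_monoC.mem_of_tendsto hW ?_
    filter_upwards [eventually_add_smul_mem_ball hc ω] with ρ hρ
    exact Submodule.smul_mem _ _ (tmC_mem_monoC hV hρ)
  · intro i hi
    have h1 : Tendsto (fun ρ : ℝ => pair ((ρ ^ p)⁻¹ • tmC V t (c + ρ • ω)) (V i)) (𝓝[>] 0)
        (𝓝 (pair W (V i))) := ((pairL.flip (V i)).continuous.tendsto _).comp hW
    refine tendsto_nhds_unique h1 (tendsto_const_nhds.congr fun ρ => ?_)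
    rw [pair_smul_left, tmC, pair_complL hV ho hi, smul_zero]

/-- The properties of the members of a Takenaka–Malmquist system. -/
structure IsMember (a : Fin n → Pt m) (B : Fin n → Pt m → Cl m) (k : Fin n) : Prop where
  mem : ofFun (B k) ∈ monoC m
  eq : ∀ x ∈ unitBall m, B k x = (ofFun (B k)).ev x
  orth : ∀ i < k, pair (ofFun (B k)) (ofFun (B i)) = 0
  ann : ∃ M, Annihilates a (testOrder a M) (ofFun (B k))

/-- At a repeated parameter the normalized curve converges uniformly to its normalized leading
coefficient, which must be the Hardy limit `B k`. The test order is allowed to grow along the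
induction, but only at repeated parameters. -/
theorem isMember (hm : 1 ≤ m) {a : Fin n → Pt m} (ha : ∀ i, a i ∈ unitBall m)
    {B : Fin n → Pt m → Cl m} (hB : IsTMSystem a B) (k : Fin n) : IsMember a B k := by
  induction k using WellFoundedLT.induction with
  | ind k ih =>
    set V : Fin n → BallC m := fun i => ofFun (B i) with hVdef
    set t := Finset.Iio k with ht
    have htk : ∀ i ∈ t, i < k := fun i hi => Finset.mem_Iio.1 hi
    have hV : ∀ i ∈ t, V i ∈ monoC m := fun i hi => (ih i (htk i hi)).mem
    have hBV : ∀ i ∈ t, ∀ x ∈ unitBall m, B i x = (V i).ev x := fun i hi => (ih i (htk i hi)).eq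
    have ho : ∀ i ∈ t, ∀ j ∈ t, i ≠ j → pair (V i) (V j) = 0 := by
      intro i hi j hj hij
      rcases lt_or_gt_of_ne hij with h | h
      · rw [← conj_pair, (ih j (htk j hj)).orth i h, conj_zero]
      · exact (ih i (htk i hi)).orth j h
    obtain ⟨M, hM⟩ : ∃ M, ∀ i ∈ t, Annihilates a (testOrder a M) (V i) := by
      choose! N hN using fun i (hi : i ∈ t) => (ih i (htk i hi)).ann
      exact ⟨t.sup N, fun i hi => (hN i hi).mono_order (testOrder_mono a (Finset.le_sup hi))⟩
    suffices h : ∃ u ∈ monoC m, (∀ x ∈ unitBall m, B k x = u.ev x) ∧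
        (∀ i ∈ t, pair u (V i) = 0) ∧ ∃ M, Annihilates a (testOrder a M) u by
      obtain ⟨u, hu, h1, h2, h3⟩ := h
      have h4 := ofFun_eq hu h1
      exact ⟨by rwa [h4], by rwa [h4], fun i hi => by rw [h4]; exact h2 i (Finset.mem_Iio.2 hi),
        by rwa [h4]⟩
    obtain ⟨hk1, hk2, hk3⟩ := hB k
    by_cases hrep : ∃ j < k, a j = a k
    · obtain ⟨ω, hω, hlim⟩ := hk3 hrep
      have hω0 : ω ≠ 0 := by rintro rfl; simp at hω
      obtain ⟨p, W, hW0, hW⟩ := exists_leading_tmC hm hM (ha k) hω0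
      obtain ⟨hWm, hWo⟩ := tmC_leading_properties hV ho (ha k) hW
      have hWb : W.bnorm ≠ 0 := fun h => hW0 (eq_zero_of_mem_monoC hWm h)
      refine ⟨W.bnorm⁻¹ • W, Submodule.smul_mem _ _ hWm, fun x hx => ?_,
        fun i hi => by rw [pair_smul_left, hWo i hi, smul_zero], max M p, ?_⟩
      -- The positive factor ρ^(-p) does not affect the normalization, but makes the limit nonzero.
      · have hnorm : Tendsto (fun ρ : ℝ => ((ρ ^ p)⁻¹ • tmC V t (a k + ρ • ω)).bnorm⁻¹ •
            (ρ ^ p)⁻¹ • tmC V t (a k + ρ • ω)) (𝓝[>] 0) (𝓝 (W.bnorm⁻¹ • W)) :=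
          (((continuous_bnorm.tendsto W).comp hW).inv₀ hWb).smul hW
        refine eq_ev_of_tendsto_hardyNorm hk1 ?_ hnorm hlim hx
        filter_upwards [eventually_add_smul_mem_ball (ha k) ω, self_mem_nhdsWithin] with ρ hρ hρ0
        intro x hx
        rw [normalize_smul (inv_pos.2 (pow_pos hρ0 p))]
        exact tmB_eq hV hBV hρ x hx
      -- The parameter `a k` is repeated, so its test order is `max M p + 1`, which leaves room for
      -- p + 1.
      · refine (annihilates_leading (fun i hi => (hM i hi).mono_order
          (testOrder_mono a (le_max_left M p))) (ha k) hW ?_).smul _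
        have hex : ∃ i, i ≠ k ∧ a i = a k := by
          obtain ⟨j, hj, hjk⟩ := hrep
          exact ⟨j, hj.ne, hjk⟩
        rw [testOrder, if_pos hex]
        exact Nat.succ_le_succ (le_max_right M p)
    · push Not at hrep
      refine ⟨(tmC V t (a k)).bnorm⁻¹ • tmC V t (a k),
        Submodule.smul_mem _ _ (tmC_mem_monoC hV (ha k)), fun x hx => ?_,
        fun i hi => by rw [pair_smul_left, tmC, pair_complL hV ho hi, smul_zero], M,
        (annihilates_tmC hM (ha k) (testOrder_ne_zero a M k)).smul _⟩
      rw [hk2 hrep hx]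
      exact tmB_eq hV hBV (ha k) x hx

/-- A Takenaka–Malmquist system in terms of continuous functions on the closed ball. -/
structure IsTMFamily (a : Fin n → Pt m) (M : ℕ) (V : Fin n → BallC m) : Prop where
  mem : ∀ i, V i ∈ monoC m
  orth : ∀ i j, i ≠ j → pair (V i) (V j) = 0
  ann : ∀ i, Annihilates a (testOrder a M) (V i)
  eq : ∀ k, (∀ j < k, a j ≠ a k) →
    V k = (tmC V (Finset.Iio k) (a k)).bnorm⁻¹ • tmC V (Finset.Iio k) (a k)

theorem exists_isTMFamily (hm : 1 ≤ m) {a : Fin n → Pt m} (ha : ∀ i, a i ∈ unitBall m)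
    {B : Fin n → Pt m → Cl m} (hB : IsTMSystem a B) : ∃ (M : ℕ) (V : Fin n → BallC m),
      IsTMFamily a M V ∧ ∀ i, ∀ x ∈ unitBall m, B i x = (V i).ev x := by
  have h := isMember hm ha hB
  choose N hN using fun i => (h i).ann
  refine ⟨Finset.univ.sup N, fun i => ofFun (B i), ⟨fun i => (h i).mem, ?_, ?_, ?_⟩,
    fun i => (h i).eq⟩
  · intro i j hij
    rcases lt_or_gt_of_ne hij with h' | h'
    · rw [← conj_pair, (h j).orth i h', conj_zero]
    · exact (h i).orth j h'
  · exact fun i => (hN i).mono_order (testOrder_mono a (Finset.le_sup (Finset.mem_univ i)))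
  · intro k hk
    refine ofFun_eq (Submodule.smul_mem _ _ (tmC_mem_monoC (fun i _ => (h i).mem) (ha k)))
      fun x hx => ?_
    rw [(hB k).2.1 hk hx]
    exact tmB_eq (fun i _ => (h i).mem) (fun i _ => (h i).eq) (ha k) x hx

end BallC

/-! ### The energy as a function on the continuous functions on the closed ball -/

/-- The norm of `Cl m` is not an algebra norm in general. Continuity of inversion is taken from the
operator algebra, through the left regular representation. -/
theorem Cl.continuousAt_inverse {G : Cl m} (hG : IsUnit G) :
    ContinuousAt (Ring.inverse : Cl m → Cl m) G := by
  have hu : ∀ {a : Cl m}, IsUnit a → IsUnit (mulL a) := fun {a} ha => by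
    obtain ⟨v, rfl⟩ := ha
    refine ⟨⟨mulL v, mulL ↑v⁻¹, ?_, ?_⟩, rfl⟩ <;>
    · ext1 x
      simp [← mul_assoc]
  have h1 : ContinuousAt (fun a : Cl m => Ring.inverse (mulL a) (1 : Cl m)) G := by
    obtain ⟨v, hv⟩ := hu hG
    have h2 := NormedRing.inverse_continuousAt v
    rw [hv] at h2
    have h3 : ContinuousAt (fun a : Cl m => Ring.inverse (mulL a)) G :=
      h2.comp (f := fun a : Cl m => mulL a) mulL.continuous.continuousAt
    exact h3.clm_apply continuousAt_const
  refine h1.congr ?_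
  have h4 : ∀ᶠ a in 𝓝 G, IsUnit (mulL a) :=
    mulL.continuous.continuousAt (Units.isOpen.mem_nhds (hu hG))
  filter_upwards [h4] with a ha
  have h5 : IsUnit a := isUnit_of_forall_mul_eq_zero fun v hv => by
    have h6 := congrArg (fun T : Cl m →L[ℝ] Cl m => T v) (Ring.inverse_mul_cancel _ ha)
    simp only [mul_apply_eq_comp, mulL_apply, hv, map_zero] at h6
    exact h6.symm
  have h7 : a * Ring.inverse (mulL a) (1 : Cl m) = 1 :=
    congrArg (fun T : Cl m →L[ℝ] Cl m => T 1) (Ring.mul_inverse_cancel _ ha)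
  rw [← Ring.inverse_mul_cancel_left a (Ring.inverse (mulL a) (1 : Cl m)) h5, h7, mul_one]

namespace BallC

/-- The pairing with a square integrable function. -/
def pairingL {F : Metric.sphere (0 : Pt m) 1 → Cl m} (hF : MemLp F 2 (surface m)) :
    BallC m →L[ℝ] Cl m :=
  LinearMap.mkContinuous
    { toFun := fun u => pairing F fun η => u.ev η
      map_add' := fun u v => by simp only [ev_add]; exact pairing_add_right hF u.memLp v.memLp
      map_smul' := fun r u => by simp only [ev_smul]; exact pairing_smul_right r _ _ }
    (‖(mulL : Cl m →L[ℝ] _)‖ * areaConst m * l2norm F) fun u => by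
      refine (norm_pairing_le hF u.memLp).trans ?_
      have h1 : l2norm (fun η : Metric.sphere (0 : Pt m) 1 => u.ev η) ≤ areaConst m * ‖u‖ := u.bnorm_le
      have h2 := l2norm_nonneg F
      calc _ ≤ ‖(mulL : Cl m →L[ℝ] _)‖ * (areaConst m * ‖u‖) * l2norm F := by gcongr
        _ = _ := by ring

theorem pairingL_apply {F : Metric.sphere (0 : Pt m) 1 → Cl m} (hF : MemLp F 2 (surface m))
    (u : BallC m) : pairingL hF u = pairing F fun η => u.ev η := rfl

/-- The coefficient of the projection of `F` onto the span of `T`. -/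
def energyCoeff (F : Metric.sphere (0 : Pt m) 1 → Cl m) (T : BallC m) : Cl m :=
  Ring.inverse (pair T T) * pairing F fun η => T.ev η

/-- The norm of the projection of `F` onto the span of `T`. -/
def energy (F : Metric.sphere (0 : Pt m) 1 → Cl m) (T : BallC m) : ℝ :=
  (rmul (energyCoeff F T) T).bnorm

variable {F : Metric.sphere (0 : Pt m) 1 → Cl m} {T : BallC m}

theorem energy_nonneg : 0 ≤ energy F T := bnorm_nonneg _

theorem mul_energyCoeff (hT : IsUnit (pair T T)) :
    pair T T * energyCoeff F T = pairing F fun η => T.ev η :=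
  Ring.mul_inverse_cancel_left _ _ hT

theorem energyCoeff_unique (hT : IsUnit (pair T T)) {y : Cl m}
    (hy : pair T T * y = pairing F fun η => T.ev η) : energyCoeff F T = y := by
  rw [energyCoeff, ← hy, Ring.inverse_mul_cancel_left _ _ hT]

theorem isUnit_pair_smul (hT : IsUnit (pair T T)) {r : ℝ} (hr : r ≠ 0) :
    IsUnit (pair (r • T) (r • T)) := by
  refine isUnit_of_forall_mul_eq_zero fun v hv => ?_
  rw [pair_smul_left, pair_smul_right, smul_mul_assoc, smul_mul_assoc, smul_eq_zero_iff_right hr,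
    smul_eq_zero_iff_right hr] at hv
  exact hT.mul_right_eq_zero.1 hv

/-- The coefficient scales by r⁻¹. Hence `T` may be replaced by its normalization or by a difference
quotient without changing the energy. -/
theorem energy_smul (hT : IsUnit (pair T T)) {r : ℝ} (hr : r ≠ 0) :
    energy F (r • T) = energy F T := by
  have h1 : energyCoeff F (r • T) = r⁻¹ • energyCoeff F T := by
    refine energyCoeff_unique (isUnit_pair_smul hT hr) ?_
    simp only [ev_smul]
    rw [pairing_smul_right, ← mul_energyCoeff hT, pair_smul_left, pair_smul_right, smul_smul,
      smul_mul_smul_comm, mul_assoc, mul_inv_cancel₀ hr, mul_one]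
  have h2 : rmul (r⁻¹ • energyCoeff F T) (r • T) = rmul (energyCoeff F T) T :=
    ext_ball fun x _ => by
      rw [ev_rmul, ev_rmul, ev_smul, smul_mul_smul_comm, mul_inv_cancel₀ hr, one_smul]
  rw [energy, h1, h2, energy]

theorem energy_sq (hF : MemLp F 2 (surface m)) (hT : IsUnit (pair T T)) :
    energy F T ^ 2 = inner ℝ (energyCoeff F T) (pairingL hF T) := by
  rw [energy, ← inner_one_pair_self, pair_rmul_left, pair_rmul_right, mul_assoc, mul_energyCoeff hT,
    ← inner_mul_left, mul_one, pairingL_apply]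

/-- Bessel's inequality: E² is the real inner product of F with its projection, hence at most E
times the norm of F. -/
theorem energy_le (hF : MemLp F 2 (surface m)) (hT : IsUnit (pair T T)) :
    energy F T ≤ l2norm F := by
  have h1 := energy_sq hF hT
  rw [pairingL_apply, inner_pairing hF T.memLp] at h1
  have h2 := abs_integral_inner_le hF (rmul (energyCoeff F T) T).memLp
  simp only [ev_rmul] at h2
  rw [← h1] at h2
  have h3 : l2norm (fun η : Metric.sphere (0 : Pt m) 1 => T.ev η * energyCoeff F T) = energy F T := by
    simp only [energy, bnorm, ev_rmul]
  rw [h3, abs_of_nonneg (sq_nonneg _), sq] at h2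
  rcases (energy_nonneg (F := F) (T := T)).eq_or_lt with h | h
  · rw [← h]; exact l2norm_nonneg F
  · exact le_of_mul_le_mul_left h2 h

theorem continuousAt_energy (hF : MemLp F 2 (surface m)) (hT : IsUnit (pair T T)) :
    ContinuousAt (energy F) T := by
  have h1 : Continuous fun u : BallC m => pair u u :=
    pairL.continuous.clm_apply continuous_id
  have h4 : ContinuousAt (fun u : BallC m => Ring.inverse (pair u u)) T :=
    ContinuousAt.comp (f := fun u : BallC m => pair u u) (continuousAt_inverse hT) h1.continuousAt
  have h5 : ContinuousAt (fun u : BallC m => pairing F fun η => u.ev η) T :=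
    (pairingL hF).continuous.continuousAt
  have h2 : ContinuousAt (energyCoeff F) T := h4.mul h5
  have h3 : energy F = fun u => Real.sqrt (inner ℝ (1 : Cl m)
      (conj (energyCoeff F u) * (pair u u * energyCoeff F u))) := by
    funext u
    rw [← mul_assoc, mul_assoc, ← pair_rmul_left, ← pair_rmul_right, inner_one_pair_self,
      Real.sqrt_sq (bnorm_nonneg _), energy]
  rw [h3]
  refine ContinuousAt.sqrt (continuousAt_const.inner ?_)
  have h6 : ContinuousAt (fun u : BallC m => conj (energyCoeff F u)) T :=
    ContinuousAt.comp (f := energyCoeff F) continuous_conj.continuousAt h2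
  exact h6.mul (h1.continuousAt.mul h2)

/-- If ⟨T, T⟩v = 0, then Tv = 0, so conj(v) annihilates ⟨h, T⟩ from the left, and the right inverse
`w` gives v = 0. -/
theorem isUnit_pair_self (hT : T ∈ monoC m) {h : BallC m} {w : Cl m} (hw : pair h T * w = 1) :
    IsUnit (pair T T) := by
  refine isUnit_of_forall_mul_eq_zero fun v hv => ?_
  have h1 : rmul v T = 0 := by
    refine eq_zero_of_pair_self (rmul_mem_monoC hT v) ?_
    rw [pair_rmul_left, pair_rmul_right, mul_assoc, hv, mul_zero]
  have h2 : conj v * pair h T = 0 := by rw [← pair_rmul_right, h1, ← pairL_apply, map_zero]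
  have h3 : conj v = 0 := by rw [← mul_one (conj v), ← hw, ← mul_assoc, h2, zero_mul]
  rw [← conj_conj v, h3, conj_zero]

theorem bnorm_ne_zero_of_isUnit (hT : T ∈ monoC m) (h : IsUnit (pair T T)) : T.bnorm ≠ 0 := by
  intro h0
  rw [eq_zero_of_mem_monoC hT h0, pair_zero_left] at h
  exact not_isUnit_zero h

open Classical in
theorem isUnit_pair_leading {ι : Type*} [Fintype ι] (hm : 1 ≤ m) {a : ι → Pt m} {N : ι → ℕ}
    {V : ι → BallC m} {t : Finset ι} (hV : ∀ i ∈ t, Annihilates a N (V i)) {c ω : Pt m}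
    (hc : c ∈ unitBall m) (hω : ω ≠ 0) {W : BallC m} (hWm : W ∈ monoC m)
    (hW : Tendsto (fun ρ : ℝ => (ρ ^ (∑ j, if a j = c then N j else 0))⁻¹ •
      tmC V t (c + ρ • ω)) (𝓝[>] 0) (𝓝 W)) : IsUnit (pair W W) := by
  obtain ⟨h, w, hw⟩ := exists_pair_leading_mul_eq_one hm hV hc hω hW
  exact isUnit_pair_self hWm hw

theorem continuousAt_tmC {ι : Type*} {V : ι → BallC m} {t : Finset ι} {b : Pt m}
    (hb : b ∈ unitBall m) : ContinuousAt (tmC V t) b :=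
  (complL V t).continuous.continuousAt.comp (contDiffAt_szegoC hb (n := 1) one_ne_zero).continuousAt

variable {n : ℕ} {a : Fin n → Pt m} {M : ℕ} {V : Fin n → BallC m}

theorem IsTMFamily.tmC_mem (hV : IsTMFamily a M V) (t : Finset (Fin n)) {b : Pt m}
    (hb : b ∈ unitBall m) : tmC V t b ∈ monoC m := tmC_mem_monoC (fun i _ => hV.mem i) hb

/-- The order-zero case of the leading term argument: no parameter equals `b`, so nothing is divided
out, W is T_b itself and the direction is immaterial. -/
theorem IsTMFamily.isUnit_gram (hV : IsTMFamily a M V) (hm : 1 ≤ m) {b : Pt m}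
    (hb : b ∈ unitBall m) (hba : b ∉ Set.range a) :
    IsUnit (pair (tmC V Finset.univ b) (tmC V Finset.univ b)) := by
  classical
  refine isUnit_pair_leading hm (t := Finset.univ) (fun i _ => hV.ann i) hb
    (ω := EuclideanSpace.single 0 1) (fun h => by simpa using congrArg norm h)
    (hV.tmC_mem _ hb) ?_
  have h0 : (∑ j, if a j = b then testOrder a M j else 0) = 0 :=
    Finset.sum_eq_zero fun j _ => if_neg fun h => hba ⟨j, h⟩
  simp only [h0, pow_zero, inv_one, one_smul]
  have h1 : Tendsto (fun ρ : ℝ => b + ρ • (EuclideanSpace.single 0 1 : Pt m)) (𝓝[>] 0) (𝓝 b) := by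
    have h2 : Continuous fun ρ : ℝ => b + ρ • (EuclideanSpace.single 0 1 : Pt m) := by fun_prop
    have h3 := (h2.tendsto 0).mono_left (nhdsWithin_le_nhds (s := Set.Ioi 0))
    rwa [zero_smul, add_zero] at h3
  exact (continuousAt_tmC hb).tendsto.comp h1

theorem tmEnergy_eq {f : Pt m → Cl m} {B : Fin n → Pt m → Cl m} (hV : ∀ i, V i ∈ monoC m)
    (hB : ∀ i, ∀ x ∈ unitBall m, B i x = (V i).ev x) {b : Pt m} (hb : b ∈ unitBall m)
    (hT : IsUnit (pair (tmC V Finset.univ b) (tmC V Finset.univ b))) :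
    tmEnergy f B b = energy (fun η : Metric.sphere (0 : Pt m) 1 => boundaryValue f η)
      (tmC V Finset.univ b) := by
  have hTm := tmC_mem_monoC (s := Finset.univ) (fun i _ => hV i) hb
  have h1 := tmB_eq (s := Finset.univ) (fun i _ => hV i) (fun i _ => hB i) hb
  set T := tmC V Finset.univ b
  have h0 : T.bnorm⁻¹ ≠ 0 := inv_ne_zero (bnorm_ne_zero_of_isUnit hTm hT)
  rw [← energy_smul hT h0, tmEnergy, hardyInner_of_eqOn h1 h1, hardyInner_of_eqOn_right f h1]
  refine hardyNorm_congr_ev (rmul_mem_monoC (Submodule.smul_mem _ _ hTm) _) fun x hx => ?_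
  rw [h1 x hx, ev_rmul, energyCoeff]

end BallC

/-! ### Decay of the energy at the boundary -/

/-- The cone over a point lies in a line, which is a null set in dimension m + 1 ≥ 2. -/
theorem surface_singleton (hm : 1 ≤ m) (η : Metric.sphere (0 : Pt m) 1) : surface m {η} = 0 := by
  rw [surface, Measure.toSphere_apply' _ (measurableSet_singleton η), Set.image_singleton]
  refine mul_eq_zero_of_right _ (measure_mono_null (t := (Submodule.span ℝ {(η : Pt m)} : Set (Pt m)))
    ?_ (Measure.addHaar_submodule _ _ fun h => ?_))
  · rintro _ ⟨r, -, _, rfl, rfl⟩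
    exact Submodule.smul_mem _ r (Submodule.mem_span_singleton_self _)
  · have h1 := finrank_span_singleton (K := ℝ) (show (η : Pt m) ≠ 0 from fun h0 => by
      have := norm_eq_of_mem_sphere η
      rw [h0, norm_zero] at this
      exact zero_ne_one this)
    rw [h, finrank_top, finrank_euclideanSpace_fin] at h1
    omega

theorem tendsto_l2norm_indicator_ball (hm : 1 ≤ m) {F : Metric.sphere (0 : Pt m) 1 → Cl m}
    (hF : MemLp F 2 (surface m)) (ζ : Metric.sphere (0 : Pt m) 1) :
    Tendsto (fun k : ℕ => l2norm ((Metric.ball ζ ((k : ℝ) + 1)⁻¹).indicator F)) atTop (𝓝 0) := by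
  set A : ℕ → Set (Metric.sphere (0 : Pt m) 1) := fun k => Metric.ball ζ ((k : ℝ) + 1)⁻¹
  have hA : ∀ k, MeasurableSet (A k) := fun k => Metric.isOpen_ball.measurableSet
  have hanti : Antitone A := fun k l h => Metric.ball_subset_ball
    (inv_anti₀ (by positivity) (by have : (k : ℝ) ≤ l := by exact_mod_cast h
                                   linarith))
  have hint : Integrable (fun η => ‖F η‖ ^ 2) (surface m) := hF.integrable_norm_pow two_ne_zero
  have h1 := tendsto_setIntegral_of_antitone hA hanti ⟨0, hint.integrableOn⟩
  have h2 : (⋂ k, A k) ⊆ {ζ} := by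
    intro η hη
    rw [Set.mem_iInter] at hη
    rw [Set.mem_singleton_iff, ← dist_le_zero]
    refine le_of_forall_pos_le_add fun ε hε => ?_
    obtain ⟨k, hk⟩ := exists_nat_one_div_lt hε
    rw [one_div] at hk
    rw [zero_add]
    exact (Metric.mem_ball.1 (hη k)).le.trans hk.le
  rw [Measure.restrict_eq_zero.2 (measure_mono_null h2 (surface_singleton hm ζ)),
    integral_zero_measure] at h1
  have h3 : ∀ k, l2norm ((A k).indicator F) =
      Real.sqrt ((sphereArea m)⁻¹ * ∫ η in A k, ‖F η‖ ^ 2 ∂surface m) := by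
    intro k
    rw [l2norm, ← integral_indicator (hA k)]
    congr 3
    funext η
    by_cases h : η ∈ A k <;> simp [h]
  have h4 := (h1.const_mul (sphereArea m)⁻¹).sqrt
  rw [mul_zero, Real.sqrt_zero] at h4
  exact h4.congr fun k => (h3 k).symm

namespace BallC

theorem norm_szegoC_sphere_mul {b : Pt m} (hb : b ∈ unitBall m) (η : Metric.sphere (0 : Pt m) 1)
    (y : Cl m) : ‖(szegoC b).ev η * y‖ =
      (‖(η : Pt m) - b‖ ^ (m + 1))⁻¹ * (‖(η : Pt m) - b‖ * ‖y‖) := by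
  have h : conj (1 - conj (toCl b) * toCl (η : Pt m)) =
      conj (toCl (η : Pt m)) * toCl ((η : Pt m) - b) := by
    rw [toCl_sub, mul_sub, conj_toCl_mul_self, norm_eq_of_mem_sphere, one_pow, one_smul, conj_sub,
      conj_one, Cl.conj_mul, conj_conj]
  rw [ev_szegoC hb (sphere_mem η), szego_sphere, h, smul_mul_assoc, norm_smul, mul_assoc,
    norm_conj_toCl_mul, norm_toCl_mul, norm_eq_of_mem_sphere, one_mul,
    Real.norm_of_nonneg (by positivity)]

theorem norm_szegoC_sphere {b : Pt m} (hb : b ∈ unitBall m) (η : Metric.sphere (0 : Pt m) 1) :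
    ‖(szegoC b).ev η‖ = (‖(η : Pt m) - b‖ ^ (m + 1))⁻¹ * ‖(η : Pt m) - b‖ := by
  have h := norm_szegoC_sphere_mul hb η 1
  rwa [mul_one, norm_one', mul_one] at h

/-- On the sphere S_b is a real multiple of a product of paravectors, so its left multiplication is
pointwise a multiple of an isometry. This recovers the size of a coefficient y from the norm of S_b
y. -/
theorem bnorm_rmul_szegoC {b : Pt m} (hb : b ∈ unitBall m) (y : Cl m) :
    (rmul y (szegoC b)).bnorm = ‖y‖ * (szegoC b).bnorm := by
  refine (pow_left_inj₀ (bnorm_nonneg _) (mul_nonneg (norm_nonneg _) (bnorm_nonneg _))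
    two_ne_zero).1 ?_
  have h : ∫ η : Metric.sphere (0 : Pt m) 1, ‖(rmul y (szegoC b)).ev η‖ ^ 2 ∂surface m =
      ‖y‖ ^ 2 * ∫ η : Metric.sphere (0 : Pt m) 1, ‖(szegoC b).ev η‖ ^ 2 ∂surface m := by
    rw [← integral_const_mul]
    congr 1
    funext η
    rw [ev_rmul, norm_szegoC_sphere_mul hb, norm_szegoC_sphere hb]
    ring
  rw [mul_pow, bnorm_sq, bnorm_sq, mul_left_comm, h]

theorem tendsto_bnorm_szegoC (hm : 1 ≤ m) {u : ℕ → Pt m} (hu : ∀ j, u j ∈ unitBall m) {b : Pt m}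
    (hb : ‖b‖ = 1) (hub : Tendsto u atTop (𝓝 b)) :
    Tendsto (fun j => (szegoC (u j)).bnorm) atTop atTop := by
  have h1 : Tendsto (fun j => (1 - ‖u j‖ ^ 2) ^ m) atTop (𝓝[>] 0) := by
    refine tendsto_nhdsWithin_iff.2 ⟨?_, Eventually.of_forall fun j => ?_⟩
    · have h := ((hub.norm.pow 2).const_sub 1).pow m
      rwa [hb, one_pow, sub_self, zero_pow (by omega)] at h
    · have := mem_ball_zero_iff.1 (hu j)
      have h0 : 0 < 1 - ‖u j‖ ^ 2 := by nlinarith [norm_nonneg (u j)]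
      exact pow_pos h0 m
  have h2 := (tendsto_inv_nhdsGT_zero.comp h1).const_mul_atTop (szegoConst_pos (m := m))
  have h3 := Real.tendsto_sqrt_atTop.comp h2
  refine h3.congr fun j => ?_
  simp only [Function.comp_apply]
  rw [szegoConst, ← bnorm_szegoC_sq (hu j), Real.sqrt_sq (bnorm_nonneg _)]

/-- Inside the δ-ball around ζ, Cauchy–Schwarz gives the norm of S_b times the L² norm of F there.
Outside, |η - b| lies between δ/2 and 2, so S_b is bounded independently of `b`. -/
theorem norm_pairing_szegoC_le {F : Metric.sphere (0 : Pt m) 1 → Cl m}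
    (hF : MemLp F 2 (surface m)) {b : Pt m} (hb : b ∈ unitBall m) (ζ : Metric.sphere (0 : Pt m) 1)
    {δ : ℝ} (hδ : 0 < δ) (hbζ : ‖b - ζ‖ ≤ δ / 2) :
    ‖pairing F fun η => (szegoC b).ev η‖ ≤ ‖(mulL : Cl m →L[ℝ] _)‖ *
      ((szegoC b).bnorm * l2norm ((Metric.ball ζ δ).indicator F) +
        areaConst m * (((δ / 2) ^ (m + 1))⁻¹ * 2) * l2norm F) := by
  set A := Metric.ball ζ δ with hA
  have hAm : MeasurableSet A := Metric.isOpen_ball.measurableSet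
  set S : Metric.sphere (0 : Pt m) 1 → Cl m := fun η => (szegoC b).ev η with hS
  have hSL : MemLp S 2 (surface m) := (szegoC b).memLp
  have h1 : pairing F S = pairing (A.indicator F) S + pairing F (Aᶜ.indicator S) := by
    rw [pairing, pairing, pairing, ← smul_add,
      ← integral_add (integrable_conj_mul (hF.indicator hAm) hSL)
        (integrable_conj_mul hF (hSL.indicator hAm.compl))]
    congr 2
    funext η
    by_cases h : η ∈ A <;> simp [h]
  have h2 := norm_pairing_le (hF.indicator hAm) hSL
  have h3 := norm_pairing_le hF (hSL.indicator hAm.compl)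
  have h4 : l2norm (Aᶜ.indicator S) ≤ areaConst m * (((δ / 2) ^ (m + 1))⁻¹ * 2) := by
    refine l2norm_le_of_bound (by positivity) fun η => ?_
    by_cases h : η ∈ A
    · rw [Set.indicator_of_notMem (by simpa using h), norm_zero]; positivity
    · rw [Set.indicator_of_mem (by simpa using h), hS, norm_szegoC_sphere hb]
      have h5 : δ ≤ ‖(η : Pt m) - ζ‖ := by
        rw [hA, Metric.mem_ball, not_lt, Subtype.dist_eq, dist_eq_norm] at h
        exact h
      have h6 : δ / 2 ≤ ‖(η : Pt m) - b‖ := by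
        have := norm_sub_le_norm_sub_add_norm_sub (η : Pt m) b ζ
        linarith
      have h7 : ‖(η : Pt m) - b‖ ≤ 2 := by
        have := norm_sub_le (η : Pt m) b
        rw [norm_eq_of_mem_sphere] at this
        linarith [mem_ball_zero_iff.1 hb]
      gcongr
  have h8 : l2norm S = (szegoC b).bnorm := rfl
  rw [h8] at h2
  have h9 := l2norm_nonneg F
  rw [h1]
  calc _ ≤ _ := norm_add_le _ _
    _ ≤ ‖(mulL : Cl m →L[ℝ] _)‖ * (szegoC b).bnorm * l2norm (A.indicator F) +
        ‖(mulL : Cl m →L[ℝ] _)‖ * (areaConst m * (((δ / 2) ^ (m + 1))⁻¹ * 2)) * l2norm F := by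
      refine add_le_add h2 (h3.trans ?_)
      gcongr
    _ = _ := by ring

/-- The pairings with the normalized Szegő kernels tend to zero at the boundary. -/
theorem tendsto_pairing_szegoC (hm : 1 ≤ m) {F : Metric.sphere (0 : Pt m) 1 → Cl m}
    (hF : MemLp F 2 (surface m)) {u : ℕ → Pt m} (hu : ∀ j, u j ∈ unitBall m) {b : Pt m}
    (hb : ‖b‖ = 1) (hub : Tendsto u atTop (𝓝 b)) :
    Tendsto (fun j => ‖pairing F fun η => (szegoC (u j)).ev η‖ / (szegoC (u j)).bnorm)
      atTop (𝓝 0) := by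
  set ζ : Metric.sphere (0 : Pt m) 1 := ⟨b, mem_sphere_zero_iff_norm.2 hb⟩ with hζ
  set K := ‖(mulL : Cl m →L[ℝ] Cl m →L[ℝ] Cl m)‖
  have hN := tendsto_bnorm_szegoC hm hu hb hub
  rw [Metric.tendsto_atTop]
  intro ε hε
  have h1 := (tendsto_l2norm_indicator_ball hm hF ζ).const_mul K
  rw [mul_zero] at h1
  obtain ⟨k, hk⟩ := (h1.eventually (gt_mem_nhds (half_pos hε))).exists
  set δ : ℝ := ((k : ℝ) + 1)⁻¹ with hδ'
  have hδ : 0 < δ := by positivity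
  set C := K * (areaConst m * (((δ / 2) ^ (m + 1))⁻¹ * 2) * l2norm F)
  have h2 := (tendsto_const_nhds (x := C)).div_atTop hN
  have h3 : ∀ᶠ j in atTop, ‖u j - b‖ < δ / 2 := by
    have := hub.eventually (Metric.ball_mem_nhds b (half_pos hδ))
    simpa only [Metric.mem_ball, dist_eq_norm] using this
  rw [← eventually_atTop]
  filter_upwards [h3, h2.eventually (gt_mem_nhds (half_pos hε)), hN.eventually_gt_atTop 0] with j h4 h5 h6
  have h7 := norm_pairing_szegoC_le hF (hu j) ζ hδ h4.le
  rw [Real.dist_eq, sub_zero, abs_of_nonneg (by positivity), div_lt_iff₀ h6]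
  rw [div_lt_iff₀ h6] at h5
  refine h7.trans_lt ?_
  have h8 := mul_lt_mul_of_pos_right hk h6
  calc _ = K * l2norm ((Metric.ball ζ δ).indicator F) * (szegoC (u j)).bnorm + C := by ring
    _ < ε / 2 * (szegoC (u j)).bnorm + ε / 2 * (szegoC (u j)).bnorm := add_lt_add h8 h5
    _ = _ := by ring

/-- Although S_b blows up at the boundary, its coefficients ⟨S_b, V_i⟩ are multiples of the
conjugates of V_i(b), and V_i is bounded. -/
theorem exists_norm_sub_tmC_le {ι : Type*} {V : ι → BallC m} {t : Finset ι}
    (hV : ∀ i ∈ t, V i ∈ monoC m) :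
    ∃ C, 0 ≤ C ∧ ∀ b ∈ unitBall m, ‖szegoC b - tmC V t b‖ ≤ C := by
  refine ⟨∑ i ∈ t, ‖rmulL (V i)‖ * (‖genInverse (pair (V i) (V i))‖ * (szegoConst m * ‖V i‖)),
    Finset.sum_nonneg fun i _ => by have := szegoConst_pos (m := m); positivity, fun b hb => ?_⟩
  rw [tmC, complL_apply, sub_sub_cancel]
  refine (norm_sum_le _ _).trans (Finset.sum_le_sum fun i hi => ?_)
  rw [projL_apply, projCoeff_apply, ← rmulL_apply]
  refine ((rmulL (V i)).le_opNorm _).trans ?_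
  gcongr
  refine ((genInverse (pair (V i) (V i))).le_opNorm _).trans ?_
  gcongr
  rw [← conj_pair, norm_conj, pair_szegoC_of_mem_monoC (hV i hi) hb, norm_smul,
    Real.norm_of_nonneg szegoConst_pos.le]
  have := szegoConst_pos (m := m)
  gcongr
  exact norm_ev_le _ _

/-- Let y be the coefficient of the projection, E the energy, I = |⟨F, S_b⟩| and N = ‖S_b‖. Then E²
≤ |y|(I + C₁) and N|y| ≤ E + C₂|y|, because T_b differs from S_b by a bounded function. Eliminating
y gives E(N - C₂) ≤ I + C₁. -/
theorem tendsto_energy_boundary {ι : Type*} {V : ι → BallC m} {t : Finset ι} (hm : 1 ≤ m)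
    (hV : ∀ i ∈ t, V i ∈ monoC m) {F : Metric.sphere (0 : Pt m) 1 → Cl m}
    (hF : MemLp F 2 (surface m)) {u : ℕ → Pt m} (hu : ∀ j, u j ∈ unitBall m) {b : Pt m}
    (hb : ‖b‖ = 1) (hub : Tendsto u atTop (𝓝 b))
    (hT : ∀ j, IsUnit (pair (tmC V t (u j)) (tmC V t (u j)))) :
    Tendsto (fun j => energy F (tmC V t (u j))) atTop (𝓝 0) := by
  obtain ⟨C, hC, hQ⟩ := exists_norm_sub_tmC_le hV
  set C₁ := ‖pairingL hF‖ * C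
  set C₂ := ‖(mulL : Cl m →L[ℝ] Cl m →L[ℝ] Cl m)‖ * (areaConst m * C)
  have hN := tendsto_bnorm_szegoC hm hu hb hub
  have hI := tendsto_pairing_szegoC hm hF hu hb hub
  set I : ℕ → ℝ := fun j => ‖pairing F fun η => (szegoC (u j)).ev η‖
  set N : ℕ → ℝ := fun j => (szegoC (u j)).bnorm
  have hlim : Tendsto (fun j => (I j / N j + C₁ / N j) / (1 - C₂ / N j)) atTop (𝓝 0) := by
    have h1 : Tendsto (fun j => (I j / N j + C₁ / N j) / (1 - C₂ / N j)) atTop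
        (𝓝 ((0 + 0) / (1 - 0))) := (hI.add (tendsto_const_nhds.div_atTop hN)).div
      ((tendsto_const_nhds.div_atTop hN).const_sub 1) (by norm_num)
    rwa [add_zero, zero_div] at h1
  refine squeeze_zero' (Eventually.of_forall fun j => energy_nonneg) ?_ hlim
  filter_upwards [hN.eventually_gt_atTop 0, hN.eventually_gt_atTop C₂] with j hj0 hj
  set T := tmC V t (u j)
  set Q := szegoC (u j) - T with hQdef
  have hTQ : T = szegoC (u j) - Q := by rw [hQdef, sub_sub_cancel]
  have hQn : ‖Q‖ ≤ C := hQ _ (hu j)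
  set y := energyCoeff F T
  set E := energy F T
  have hE0 : 0 ≤ E := energy_nonneg
  have h1 : E ^ 2 ≤ ‖y‖ * (I j + C₁) := by
    have h3 : E ^ 2 = inner ℝ y (pairingL hF T) := energy_sq hF (hT j)
    have h4 : pairingL hF T = pairingL hF (szegoC (u j)) - pairingL hF Q := by
      rw [← map_sub, ← hTQ]
    rw [h3]
    refine (real_inner_le_norm _ _).trans ?_
    rw [h4]
    gcongr
    refine (norm_sub_le _ _).trans ?_
    gcongr
    · exact le_of_eq rfl
    · exact ((pairingL hF).le_opNorm _).trans (mul_le_mul_of_nonneg_left hQn (norm_nonneg _))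
  have h2 : N j * ‖y‖ ≤ E + C₂ * ‖y‖ := by
    have h3 : rmul y (szegoC (u j)) = rmul y T + rmul y Q := by
      rw [← map_add, hQdef, add_sub_cancel]
    have h4 := bnorm_add_le (rmul y T) (rmul y Q)
    rw [← h3, bnorm_rmul_szegoC (hu j)] at h4
    have h5 : (rmul y Q).bnorm ≤ C₂ * ‖y‖ := by
      have h6 := l2norm_mul_le Q.memLp y
      have h7 : l2norm (fun η : Metric.sphere (0 : Pt m) 1 => Q.ev η) ≤ areaConst m * C :=
        Q.bnorm_le.trans (mul_le_mul_of_nonneg_left hQn areaConst_nonneg)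
      simp only [bnorm, ev_rmul]
      refine h6.trans ?_
      simp only [C₂]
      gcongr
    rw [mul_comm]
    exact h4.trans (by gcongr; exact le_of_eq rfl)
  have hD : (0 : ℝ) < 1 - C₂ / N j := by rw [sub_pos, div_lt_one hj0]; exact hj
  rw [le_div_iff₀ hD, ← add_div, le_div_iff₀ hj0]
  have h8 : E * (1 - C₂ / N j) * N j = E * (N j - C₂) := by field_simp
  rw [h8]
  rcases hE0.eq_or_lt with h | h
  · rw [← h, zero_mul]
    have : 0 ≤ C₁ := by positivity
    positivity
  · have h9 : ‖y‖ * (N j - C₂) ≤ E := by linarith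
    have hIC : 0 ≤ I j + C₁ := by positivity
    refine le_of_mul_le_mul_left ?_ h
    calc E * (E * (N j - C₂)) = E ^ 2 * (N j - C₂) := by ring
      _ ≤ ‖y‖ * (I j + C₁) * (N j - C₂) := mul_le_mul_of_nonneg_right h1 (sub_nonneg.2 hj.le)
      _ = ‖y‖ * (N j - C₂) * (I j + C₁) := by ring
      _ ≤ E * (I j + C₁) := mul_le_mul_of_nonneg_right h9 hIC

end BallC

/-! ### Directional limits at a simple parameter -/

namespace BallC

variable {n : ℕ} {a : Fin n → Pt m} {M : ℕ} {V : Fin n → BallC m}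

theorem rmul_one (u : BallC m) : rmul 1 u = u := ext_ball fun x _ => by simp

theorem IsTMFamily.complL_rmul (hV : IsTMFamily a M V) (i : Fin n) (c : Cl m) :
    complL V Finset.univ (rmul c (V i)) = 0 :=
  complL_rmul_self (fun j _ => hV.mem j) (fun j _ k _ => hV.orth j k) (Finset.mem_univ i) c

/-- At its first occurrence the parameter enters the system by Gram–Schmidt, so S_{a_i} lies in the
span of the V_j with j ≤ i, which the full step kills. -/
theorem IsTMFamily.tmC_eq_zero (hV : IsTMFamily a M V) (ha : ∀ i, a i ∈ unitBall m) {i : Fin n}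
    (hi : ∀ j < i, a j ≠ a i) : tmC V Finset.univ (a i) = 0 := by
  set t := Finset.Iio i
  have h1 : tmC V t (a i) = (tmC V t (a i)).bnorm • V i := by
    by_cases h0 : (tmC V t (a i)).bnorm = 0
    · rw [h0, zero_smul]
      exact eq_zero_of_mem_monoC (hV.tmC_mem t (ha i)) h0
    · rw [hV.eq i hi, smul_smul, mul_inv_cancel₀ h0, one_smul]
  have h2 : szegoC (a i) = tmC V t (a i) + ∑ j ∈ t, projL (V j) (szegoC (a i)) := by
    rw [tmC, complL_apply, sub_add_cancel]
  rw [tmC, h2, h1, map_add, map_smul, map_sum]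
  have h3 := hV.complL_rmul i 1
  rw [rmul_one] at h3
  rw [h3, smul_zero, zero_add]
  refine Finset.sum_eq_zero fun j _ => ?_
  rw [projL_apply]
  exact hV.complL_rmul j _

/-- The derivative of the Gram–Schmidt step with respect to the parameter. -/
def tmDeriv (V : Fin n → BallC m) (b : Pt m) : Pt m →L[ℝ] BallC m :=
  complL V Finset.univ ∘L fderiv ℝ szegoC b

/-- The differential quotient for arbitrary scalings `c` and increments `d`. It serves both the
maximizing sequence and the ray. -/
theorem tendsto_smul_tmC {b : Pt m} (hb : b ∈ unitBall m) (h0 : tmC V Finset.univ b = 0) {α : Type*}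
    {l : Filter α} {c : α → ℝ} {d : α → Pt m} {ω : Pt m} (hd : Tendsto d l (𝓝 0))
    (hcd : Tendsto (fun j => c j • d j) l (𝓝 ω)) :
    Tendsto (fun j => c j • tmC V Finset.univ (b + d j)) l (𝓝 (tmDeriv V b ω)) := by
  have h1 : HasFDerivAt (tmC V Finset.univ) (tmDeriv V b) b :=
    (complL V Finset.univ).hasFDerivAt.comp b
      ((contDiffAt_szegoC hb (n := 1) one_ne_zero).differentiableAt one_ne_zero).hasFDerivAt
  have h2 := h1.hasFDerivWithinAt (s := Set.univ) |>.lim hd (Eventually.of_forall fun _ => trivial) hcd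
  simpa only [h0, sub_zero] using h2

theorem tendsto_inv_smul_tmC {b : Pt m} (hb : b ∈ unitBall m) (h0 : tmC V Finset.univ b = 0)
    (ω : Pt m) : Tendsto (fun ρ : ℝ => ρ⁻¹ • tmC V Finset.univ (b + ρ • ω)) (𝓝[>] 0)
      (𝓝 (tmDeriv V b ω)) := by
  refine tendsto_smul_tmC hb h0 ?_ ?_
  · have h : Continuous fun ρ : ℝ => ρ • ω := by fun_prop
    have h1 := (h.tendsto 0).mono_left (nhdsWithin_le_nhds (s := Set.Ioi 0))
    rwa [zero_smul] at h1
  · refine tendsto_const_nhds.congr' ?_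
    filter_upwards [self_mem_nhdsWithin] with ρ hρ
    rw [smul_smul, inv_mul_cancel₀ (ne_of_gt hρ), one_smul]

/-- A parameter that occurs once has test order exactly 1, so the derivative is the leading term at
the order that the invertibility criterion requires. -/
theorem IsTMFamily.isUnit_tmDeriv (hV : IsTMFamily a M V) (hm : 1 ≤ m) {i : Fin n}
    (ha : a i ∈ unitBall m) (hi : ∀ j, a j = a i → j = i) (h0 : tmC V Finset.univ (a i) = 0)
    {ω : Pt m} (hω : ω ≠ 0) : IsUnit (pair (tmDeriv V (a i) ω) (tmDeriv V (a i) ω)) := by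
  classical
  have h1 := tendsto_inv_smul_tmC ha h0 ω
  have h2 : Tendsto (fun ρ : ℝ => (ρ ^ 1)⁻¹ • tmC V Finset.univ (a i + ρ • ω)) (𝓝[>] 0)
      (𝓝 (tmDeriv V (a i) ω)) := by simpa only [pow_one] using h1
  refine isUnit_pair_leading hm (t := Finset.univ) (fun j _ => hV.ann j) ha hω
    (tmC_leading_properties (fun j _ => hV.mem j) (fun j _ k _ => hV.orth j k) ha h2).1 ?_
  have h3 : (∑ j, if a j = a i then testOrder a M j else 0) = 1 := by
    rw [Finset.sum_eq_single i]
    · rw [if_pos rfl, testOrder, if_neg]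
      rintro ⟨j, hj, hji⟩
      exact hj (hi j hji)
    · exact fun j _ hj => if_neg fun h => hj (hi j h)
    · exact fun h => absurd (Finset.mem_univ i) h
  rwa [h3]

/-! ### The maximum of the energy -/

variable {f : Pt m → Cl m} {B : Fin n → Pt m → Cl m}

/-- The boundary values of `f` as a function on the sphere. -/
def bdry (f : Pt m → Cl m) (η : Metric.sphere (0 : Pt m) 1) : Cl m := boundaryValue f η

theorem IsTMFamily.tmEnergy_eq (hV : IsTMFamily a M V) (hm : 1 ≤ m)
    (hB : ∀ i, ∀ x ∈ unitBall m, B i x = (V i).ev x) {b : Pt m} (hb : b ∈ unitBall m)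
    (hba : b ∉ Set.range a) : tmEnergy f B b = energy (bdry f) (tmC V Finset.univ b) :=
  BallC.tmEnergy_eq hV.mem hB hb (hV.isUnit_gram hm hb hba)

theorem eventually_notMem_range {b ω : Pt m} (hω : ω ≠ 0) :
    ∀ᶠ ρ : ℝ in 𝓝[>] 0, b + ρ • ω ∉ Set.range a := by
  have h1 : ∀ j, ∀ᶠ ρ : ℝ in 𝓝[>] 0, b + ρ • ω ≠ a j := by
    intro j
    by_cases hj : a j = b
    · filter_upwards [self_mem_nhdsWithin] with ρ hρ h
      rw [hj, add_eq_left, smul_eq_zero] at h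
      exact h.elim (ne_of_gt hρ) hω
    · have h : Continuous fun ρ : ℝ => b + ρ • ω := by fun_prop
      have h2 := (h.tendsto 0).mono_left (nhdsWithin_le_nhds (s := Set.Ioi 0))
      rw [zero_smul, add_zero] at h2
      exact h2.eventually_ne (Ne.symm hj)
  filter_upwards [eventually_all.2 h1] with ρ hρ
  rintro ⟨j, hj⟩
  exact hρ j hj.symm

theorem IsTMFamily.exists_direction (hV : IsTMFamily a M V) (hm : 1 ≤ m)
    (ha : ∀ i, a i ∈ unitBall m) (hF : MemLp (bdry f) 2 (surface m))
    (hB : ∀ i, ∀ x ∈ unitBall m, B i x = (V i).ev x) {i : Fin n} (hi : ∀ j, a j = a i → j = i)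
    {u : ℕ → Pt m} (hu : ∀ j, u j ∈ unitBall m ∧ u j ∉ Set.range a)
    (hub : Tendsto u atTop (𝓝 (a i))) {E : ℝ}
    (hE : Tendsto (fun j => tmEnergy f B (u j)) atTop (𝓝 E)) :
    ∃ ω : Pt m, ‖ω‖ = 1 ∧ Tendsto (fun ρ : ℝ => tmEnergy f B (a i + ρ • ω)) (𝓝[>] 0) (𝓝 E) := by
  have h0 := hV.tmC_eq_zero ha (i := i) fun j hj h => hj.ne (hi j h)
  set b := a i with hb
  have hne : ∀ j, ‖u j - b‖ ≠ 0 := fun j h =>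
    (hu j).2 ⟨i, (sub_eq_zero.1 (norm_eq_zero.1 h)).symm⟩
  have hdir : ∀ j, ‖u j - b‖⁻¹ • (u j - b) ∈ Metric.sphere (0 : Pt m) 1 := fun j => by
    rw [mem_sphere_zero_iff_norm, norm_smul, norm_inv, norm_norm, inv_mul_cancel₀ (hne j)]
  -- The unit directions of approach subconverge. The energy of the difference quotients is the
  -- original energy, so its limit depends on ω only.
  obtain ⟨ω, hω, φ, hφ, hlim⟩ := (isCompact_sphere (0 : Pt m) 1).tendsto_subseq hdir
  have hω1 : ‖ω‖ = 1 := mem_sphere_zero_iff_norm.1 hω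
  have hω0 : ω ≠ 0 := by rintro rfl; simp at hω1
  have hunit := hV.isUnit_tmDeriv hm (ha i) hi h0 hω0
  have hcont := continuousAt_energy hF hunit
  have hd : Tendsto (fun j => u (φ j) - b) atTop (𝓝 0) := by
    have := (hub.comp hφ.tendsto_atTop).sub_const b
    rwa [sub_self] at this
  have h1 := hcont.tendsto.comp (tendsto_smul_tmC (ha i) h0 hd hlim)
  have h2 : Tendsto (fun j => tmEnergy f B (u (φ j))) atTop
      (𝓝 (energy (bdry f) (tmDeriv V b ω))) := by
    refine h1.congr fun j => ?_
    have hg := hV.isUnit_gram hm (hu (φ j)).1 (hu (φ j)).2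
    rw [hV.tmEnergy_eq hm hB (hu (φ j)).1 (hu (φ j)).2, Function.comp_apply, add_sub_cancel]
    exact energy_smul hg (inv_ne_zero (hne (φ j)))
  rw [tendsto_nhds_unique (hE.comp hφ.tendsto_atTop) h2]
  refine ⟨ω, hω1, ?_⟩
  refine (hcont.tendsto.comp (tendsto_inv_smul_tmC (ha i) h0 ω)).congr' ?_
  filter_upwards [eventually_add_smul_mem_ball (ha i) ω, eventually_notMem_range (a := a) hω0,
    self_mem_nhdsWithin] with ρ h3 h4 h5
  rw [hV.tmEnergy_eq hm hB h3 h4, Function.comp_apply]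
  exact energy_smul (hV.isUnit_gram hm h3 h4) (inv_ne_zero (ne_of_gt h5))

theorem exists_mem_ball_notMem_range (a : Fin n → Pt m) : ∃ b ∈ unitBall m, b ∉ Set.range a :=
  (infinite_of_mem_nhds (0 : Pt m) (Metric.ball_mem_nhds 0 one_pos)).exists_notMem_finite
    (Set.finite_range a)

/-- A maximizing sequence at which the energy has a positive limit accumulates inside the ball. -/
theorem IsTMFamily.exists_max (hV : IsTMFamily a M V) (hm : 1 ≤ m)
    (ha : ∀ i, a i ∈ unitBall m) (hF : MemLp (bdry f) 2 (surface m))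
    (hB : ∀ i, ∀ x ∈ unitBall m, B i x = (V i).ev x) {E : ℝ} (hE0 : 0 < E) {u : ℕ → Pt m}
    (hu : ∀ j, u j ∈ unitBall m ∧ u j ∉ Set.range a)
    (hE : Tendsto (fun j => tmEnergy f B (u j)) atTop (𝓝 E)) :
    ∃ b ∈ unitBall m, IsEnergyAt f a B b E ∧ ((∃! i, a i = b) → ∃ ω : Pt m, ‖ω‖ = 1 ∧
      Tendsto (fun ρ : ℝ => tmEnergy f B (b + ρ • ω)) (𝓝[>] 0) (𝓝 E)) := by
  obtain ⟨b, hb, φ, hφ, hlim⟩ := (isCompact_closedBall (0 : Pt m) 1).tendsto_subseq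
    fun j => Metric.ball_subset_closedBall (hu j).1
  have hE' := hE.comp hφ.tendsto_atTop
  have hu' : ∀ j, (u ∘ φ) j ∈ unitBall m ∧ (u ∘ φ) j ∉ Set.range a := fun j => hu (φ j)
  have heq : ∀ j, tmEnergy f B ((u ∘ φ) j) = energy (bdry f) (tmC V Finset.univ ((u ∘ φ) j)) :=
    fun j => hV.tmEnergy_eq hm hB (hu' j).1 (hu' j).2
  have hbb : b ∈ unitBall m := by
    rw [mem_ball_zero_iff]
    -- A limit point on the unit sphere would force the limit `E` of the energies to be 0.
    refine lt_of_le_of_ne (mem_closedBall_zero_iff.1 hb) fun hb1 => ?_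
    have h1 := tendsto_energy_boundary hm (t := Finset.univ) (fun i _ => hV.mem i) hF
      (fun j => (hu' j).1) hb1 hlim fun j => hV.isUnit_gram hm (hu' j).1 (hu' j).2
    exact hE0.ne (tendsto_nhds_unique (h1.congr fun j => (heq j).symm) hE')
  refine ⟨b, hbb, ?_, ?_⟩
  · by_cases hba : b ∈ Set.range a
    · exact Or.inr ⟨hba, u ∘ φ, hu', hlim, hE'⟩
    · refine Or.inl ⟨hba, ?_⟩
      rw [hV.tmEnergy_eq hm hB hbb hba]
      have h1 := (continuousAt_energy hF (hV.isUnit_gram hm hbb hba)).tendsto.comp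
        ((continuousAt_tmC hbb).tendsto.comp hlim)
      exact tendsto_nhds_unique hE' (h1.congr fun j => (heq j).symm)
  · rintro ⟨i, rfl, hi⟩
    exact hV.exists_direction hm ha hF hB hi hu' hlim hE'

end BallC

end

/-! ### The maximum selection principle -/

theorem theorem5p1 (m : ℕ) (hm : 1 ≤ m) (f : Pt m → Cl m) (hf : MemHardy f)
    (n : ℕ) (a : Fin n → Pt m) (ha : ∀ i, a i ∈ unitBall m)
    (B : Fin n → Pt m → Cl m) (hB : IsTMSystem a B) :
    ∃ b ∈ unitBall m, ∃ E : ℝ, IsEnergyAt f a B b E ∧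
      IsLUB {E' : ℝ | ∃ b' ∈ unitBall m, IsEnergyAt f a B b' E'} E ∧
      ((∃! i, a i = b) →
        ∃ ω : Pt m, ‖ω‖ = 1 ∧
          Tendsto (fun ρ : ℝ => tmEnergy f B (b + ρ • ω)) (𝓝[>] 0) (𝓝 E)) := by
  obtain ⟨M, V, hV, hBV⟩ := BallC.exists_isTMFamily hm ha hB
  have hF : MemLp (BallC.bdry f) 2 (surface m) := hf.memLp_boundaryValue
  -- Values at the parameters are limits of values off the parameters, so the supremum over `R` is
  -- the supremum of all values.
  set R : Set ℝ := {E | ∃ b ∈ unitBall m, b ∉ Set.range a ∧ tmEnergy f B b = E}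
  obtain ⟨b₀, hb₀, hb₀a⟩ := BallC.exists_mem_ball_notMem_range a
  have hne : R.Nonempty := ⟨_, b₀, hb₀, hb₀a, rfl⟩
  have hbdd : BddAbove R := by
    refine ⟨l2norm (BallC.bdry f), ?_⟩
    rintro _ ⟨b, hb, hba, rfl⟩
    rw [hV.tmEnergy_eq hm hBV hb hba]
    exact BallC.energy_le hF (hV.isUnit_gram hm hb hba)
  set E := sSup R
  have hle : ∀ b ∈ unitBall m, b ∉ Set.range a → tmEnergy f B b ≤ E := fun b hb hba =>
    le_csSup hbdd ⟨b, hb, hba, rfl⟩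
  have hlub : IsLUB {E' : ℝ | ∃ b' ∈ unitBall m, IsEnergyAt f a B b' E'} E := by
    refine ⟨?_, fun K hK => csSup_le hne ?_⟩
    · rintro E' ⟨b, hb, ⟨hba, rfl⟩ | ⟨-, u, hu, -, hlim⟩⟩
      · exact hle b hb hba
      · exact le_of_tendsto hlim (Eventually.of_forall fun j => hle _ (hu j).1 (hu j).2)
    · rintro _ ⟨b, hb, hba, rfl⟩
      exact hK ⟨b, hb, Or.inl ⟨hba, rfl⟩⟩
  have h0 : 0 ≤ tmEnergy f B b₀ := by
    rw [hV.tmEnergy_eq hm hBV hb₀ hb₀a]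
    exact BallC.energy_nonneg
  rcases (h0.trans (hle b₀ hb₀ hb₀a)).eq_or_lt with h | h
  -- Zero supremum: the energy vanishes off the parameters, and `b₀` is not a parameter, so the last
  -- clause is void.
  · refine ⟨b₀, hb₀, E, Or.inl ⟨hb₀a, le_antisymm (h ▸ h0) (hle b₀ hb₀ hb₀a)⟩, hlub, ?_⟩
    rintro ⟨i, hi, -⟩
    exact absurd ⟨i, hi⟩ hb₀a
  · obtain ⟨e, -, he, heR⟩ := exists_seq_tendsto_sSup hne hbdd
    choose u hu1 hu2 hu3 using heR
    obtain ⟨b, hb, h1, h2⟩ := hV.exists_max hm ha hF hBV h (fun j => ⟨hu1 j, hu2 j⟩)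
      (he.congr fun j => (hu3 j).symm)
    exact ⟨b, hb, E, h1, hlub, h2⟩
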